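/- Setting. A depth-$D$ quantum circuit on $N_{\rm d}$ qubits is a unitary $U=U_D\cdots U_2U_1$ in which every layer $U_m$ consists of non-overlapping controlled-Z gates $\mathrm{CZ}=I-2|11\rangle\langle 11|$ on pairs of qubits (any pairs are allowed), followed by arbitrary single-qubit unitaries. A $K$-local all-to-all Hamiltonian protocol on $N_{\rm tot}$ qubits with evolution time $T\ge 0$ is a time-dependent Hamiltonian $H(t)=H_{\rm int}(t)+H_{\rm rot}(t)$, $t\in[0,T]$, where $$H_{\rm int}(t)=\sum_{k=2}^K N_{\rm tot}^{2-k}\sum_{i_1<\cdots<i_k}\sum_{a_1,\dots,a_k\in\{1,2,3\}}J^{a_1\cdots a_k}_{i_1\cdots i_k}(t)\,X^{a_1}_{i_1}\cdots X^{a_k}_{i_k},\qquad \sum_{a_1,\dots,a_k}\bigl|J^{a_1\cdots a_k}_{i_1\cdots i_k}(t)\bigr|\le 1,$$ $$H_{\rm rot}(t)=\sum_i\sum_{a}h_i^a(t)X_i^a ,$$ $X_i^1,X_i^2,X_i^3$ are the Pauli matrices $X,Y,Z$ on qubit $i$, and the coefficients $J$ and $h$ are real functions of time, integrable on $[0,T]$;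 the on-site fields $h_i^a$ may be arbitrarily strong. Its evolution operator is the time-ordered exponential $\mathcal T\mathrm e^{-\mathrm i\int_0^TH(t)\,\mathrm dt}$. Statement. For all constants $\delta\in(0,1)$ and $\kappa>0$ there are a locality $K\ge 2$ and an $N_0$, depending only on $\delta$ and $\kappa$, such that the following holds for all $N\ge N_0$, all $N_{\rm d}\le N$ (in particular for $N_{\rm d}\ll N$) and all $D$. For every depth-$D$ quantum circuit $U$ on $N_{\rm d}$ data qubits there is a $K$-local all-to-all Hamiltonian protocol on the $N_{\rm tot}=N_{\rm d}+N$ qubits formed by the data qubits and $N$ ancilla qubits, with evolution time $$T\le \frac{D\,N_{\rm d}}{N}\,N^{\delta},$$ such that $$\Bigl\|\mathcal T\mathrm e^{-\mathrm i\int_0^TH(t)\,\mathrm dt}\,\bigl(|\psi\rangle\otimes|\mathbf 0\rangle\bigr)-\bigl(U|\psi\rangle\bigr)\otimes|\mathbf 0\rangle\Bigr\|\le D\,N^{-\kappa}$$ for every normalized state $|\psi\rangle$ of the data qubits, where $|\mathbf 0\rangle$ is the all-zero state of the ancillas. -/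

import Mathlib

/-!
# Quantum circuits and all-to-all Hamiltonian protocols on qubits

The Hilbert space of qubits labelled by a finite type `Q` is `EuclideanSpace ℂ (Q → Fin 2)`: its
orthonormal basis consists of the bit strings `Q → Fin 2`. Operators are matrices in this basis.
-/

namespace AllToAll

/-- Operators on the Hilbert space of the qubits labelled by `Q`. -/
abbrev Operator (Q : Type) : Type := Matrix (Q → Fin 2) (Q → Fin 2) ℂ

/-- States of the qubits labelled by `Q`. -/
abbrev State (Q : Type) : Type := EuclideanSpace ℂ (Q → Fin 2)

/-- An operator acting on a state. -/
noncomputable def act {Q : Type} [Fintype Q] [DecidableEq Q] (A : Operator Q) (ψ : State Q) :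
    State Q :=
  WithLp.toLp 2 (Matrix.mulVec A (WithLp.ofLp ψ))

/-- The tensor product `⨂ i, A i` of single-qubit operators. -/
def tensorOp {Q : Type} [Fintype Q] (A : Q → Matrix (Fin 2) (Fin 2) ℂ) : Operator Q :=
  Matrix.of fun x y => ∏ i, A i (x i) (y i)

/-- The Pauli matrices `X`, `Y`, `Z`. -/
noncomputable def pauli : Fin 3 → Matrix (Fin 2) (Fin 2) ℂ :=
  ![!![0, 1; 1, 0], !![0, -Complex.I; Complex.I, 0], !![1, 0; 0, -1]]

/-- The Pauli matrix `a` on qubit `i` (and the identity on the other qubits). -/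
noncomputable def sitePauli {Q : Type} [Fintype Q] [DecidableEq Q] (i : Q) (a : Fin 3) :
    Operator Q :=
  tensorOp fun j => if j = i then pauli a else 1

/-! ### Circuits -/

/-- The controlled-Z gate `I - 2 |11⟩⟨11|` on the qubits `i` and `j`. -/
def cz {Q : Type} [Fintype Q] [DecidableEq Q] (i j : Q) : Operator Q :=
  Matrix.diagonal fun x => if x i = 1 ∧ x j = 1 then -1 else 1

/-- A circuit layer: non-overlapping CZ gates, together with a single-qubit unitary for each
qubit, which is applied after the CZ gates. -/
structure Layer (Q : Type) where
  gates : List (Q × Q)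
  gates_ne : ∀ g ∈ gates, g.1 ≠ g.2
  gates_disjoint : gates.Pairwise fun g g' =>
    g.1 ≠ g'.1 ∧ g.1 ≠ g'.2 ∧ g.2 ≠ g'.1 ∧ g.2 ≠ g'.2
  rot : Q → Matrix.unitaryGroup (Fin 2) ℂ

/-- The unitary implemented by a layer. -/
def Layer.unitary {Q : Type} [Fintype Q] [DecidableEq Q] (L : Layer Q) : Operator Q :=
  tensorOp (fun i => (L.rot i : Matrix (Fin 2) (Fin 2) ℂ)) *
    (L.gates.map fun g => cz g.1 g.2).prod

/-- `IsCircuit D U`: the unitary `U = U_D ⋯ U_2 U_1` is a circuit of depth `D`, each `U_m` being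
the unitary of a layer. -/
inductive IsCircuit {Q : Type} [Fintype Q] [DecidableEq Q] : ℕ → Operator Q → Prop
  | zero : IsCircuit 0 1
  | succ {D : ℕ} {U : Operator Q} (L : Layer Q) (hU : IsCircuit D U) :
      IsCircuit (D + 1) (L.unitary * U)

/-! ### All-to-all Hamiltonians -/

/-- A Pauli string: every qubit carries the identity (`none`) or one of the three Pauli matrices
(`some a`). A string whose support is `{i₁ < ⋯ < i_k}` amounts to the labels `a₁, …, a_k`. -/
abbrev PauliString (Q : Type) : Type := Q → Option (Fin 3)

/-- The qubits on which a Pauli string is not the identity. -/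
def PauliString.support {Q : Type} [Fintype Q] (P : PauliString Q) : Finset Q :=
  Finset.univ.filter fun i => (P i).isSome = true

/-- The product of Pauli matrices described by a Pauli string. -/
noncomputable def PauliString.op {Q : Type} [Fintype Q] (P : PauliString Q) : Operator Q :=
  tensorOp fun i => (P i).elim 1 pauli

/-- A time-dependent `K`-local all-to-all Hamiltonian on the time interval `[0, T]`, given by its
coefficients in the Pauli basis: couplings `J t P` of the strings `P` with support of size
`2, …, K`, of total strength at most `1` on every set of qubits of such a size, and on-site fields
`h t i a` of arbitrary strength. -/
structure Protocol (Q : Type) [Fintype Q] [DecidableEq Q] (K : ℕ) where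
  T : ℝ
  T_nonneg : 0 ≤ T
  J : ℝ → PauliString Q → ℝ
  h : ℝ → Q → Fin 3 → ℝ
  J_le : ∀ t ∈ Set.Icc 0 T, ∀ s : Finset Q, 2 ≤ s.card → s.card ≤ K →
    ∑ P : PauliString Q with P.support = s, |J t P| ≤ 1
  J_integrable : ∀ P, IntervalIntegrable (fun t => J t P) MeasureTheory.volume 0 T
  h_integrable : ∀ i a, IntervalIntegrable (fun t => h t i a) MeasureTheory.volume 0 T

namespace Protocol

variable {Q : Type} [Fintype Q] [DecidableEq Q] {K : ℕ}

/-- The interaction part: a `k`-body term carries the normalization `N_tot ^ (2 - k)`, where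
`N_tot` is the number of all qubits. -/
noncomputable def hamInt (p : Protocol Q K) (t : ℝ) : Operator Q :=
  ∑ P : PauliString Q with 2 ≤ P.support.card ∧ P.support.card ≤ K,
    (((Fintype.card Q : ℝ) ^ (2 - (P.support.card : ℤ)) * p.J t P : ℝ) : ℂ) • P.op

/-- The on-site part. -/
noncomputable def hamRot (p : Protocol Q K) (t : ℝ) : Operator Q :=
  ∑ i : Q, ∑ a : Fin 3, ((p.h t i a : ℝ) : ℂ) • sitePauli i a

/-- The Hamiltonian `H(t)`. -/
noncomputable def ham (p : Protocol Q K) (t : ℝ) : Operator Q := p.hamInt t + p.hamRot t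

/-- `p.IsEvolution W`: the operator `W` is the time-ordered exponential of `-i H(t)` over `[0, T]`,
that is, the value at time `T` of the continuous solution of the Schrödinger equation
`U(t) = 1 - i ∫₀ᵗ H(s) U(s) ds` (written out for the matrix entries). -/
def IsEvolution (p : Protocol Q K) (W : Operator Q) : Prop :=
  ∃ U : ℝ → Operator Q,
    (∀ x y, ContinuousOn (fun t => U t x y) (Set.Icc 0 p.T)) ∧
    (∀ t ∈ Set.Icc 0 p.T, ∀ x y,
      U t x y = (1 : Operator Q) x y - Complex.I * ∫ s in (0 : ℝ)..t, (p.ham s * U s) x y) ∧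
    U p.T = W

end Protocol

/-! ### Data qubits and ancillas -/

/-- The state `|ψ⟩ ⊗ |0⟩`, with data qubits labelled by `A` and ancillas labelled by `B`. -/
noncomputable def withAncillas {A : Type} (B : Type) [Fintype B] (ψ : State A) :
    State (A ⊕ B) :=
  WithLp.toLp 2 fun x => if (∀ b : B, x (Sum.inr b) = 0) then ψ (fun a => x (Sum.inl a)) else 0

/-- The protocol `p` on data qubits `A` and ancillas `B`, the latter starting in the all-zero state
and returning to it, simulates the unitary `U` on the data qubits with error at most `ε` for every
normalized input state. -/
def Simulates {A B : Type} [Fintype A] [DecidableEq A] [Fintype B] [DecidableEq B] {K : ℕ}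
    (p : Protocol (A ⊕ B) K) (U : Operator A) (ε : ℝ) : Prop :=
  ∃ W : Operator (A ⊕ B), p.IsEvolution W ∧
    ∀ ψ : State A, ‖ψ‖ = 1 → ‖act W (withAncillas B ψ) - withAncillas B (act U ψ)‖ ≤ ε

end AllToAll

/-! The gates of a layer are executed one after the other, so it is enough to perform one CZ gate in
time `N ^ (-1 + δ) / 2` with an error smaller than any fixed power of `N`. A layer has at most `Nd`
gates, and single-qubit unitaries are cheap because the fields are unrestricted.

For a gate, the ancillas are divided into `2 * J + 1` blocks of `M ~ N` qubits. The all-zero state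
of a block is a large collective spin at the pole, which behaves like an oscillator with
fluctuations of size `M ^ (-1/2)`. In terms of spin components per particle, `t = σʸ` and `1 - D =
σᶻ + i σˣ` satisfy `[t, D] = -(2 / M) (1 - D)`, so the imaginary part of `log (1 - D)` is
canonically conjugate to `t`. Its truncation `angle m D` is a polynomial of degree `m` in the spin,
and `[t, angle m D]` is the scalar `-2i/M` up to the remainder `D ^ m + star D ^ m`, which is tiny
near the pole (`IsMode.comm_t_angle`). A Pauli matrix on any set of qubits outside a block, times
the angle of the block, is a `K`-local Hamiltonian with `K = m + 1`, and `exp (-i θ ...)` takes a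
time of order `θ / M`, independently of the size of the set (`PauliClass.reach_total`).

The group commutator of `exp (-i u Z_a angle)` and `exp (-i u Z_b t)` on the same mode is `exp (-i
(2 u² / M) Z_a Z_b)`, but a phase of order one would need `u ~ √M`, which is too slow. The remedy is
amplification. Conjugating the angle of a further mode `j` by `exp (-i (g / 2) M R t_j)` shifts it
by `g R`; with `R` the angle amplified so far this gives `chain`, approximately `angle_j + g R`.
Since `M t_j` is a sum of Pauli matrices over a block, the conjugation is again a collective pulse.
After `J` modes the base is multiplied by `g ^ J`, at the price of `2 ^ (J + 1) - 1` pulses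
(`reach_chain`). Both the angle and `t` of mode `0` are amplified in this way, by disjoint sets of
modes, and the group commutator has the phase `2 (u g ^ J)² / M`. With `u = N ^ (δ / 2)` and `J`
fixed, `g ≤ u` can be chosen such that this phase is `π / 4`, and the gate takes a time of order `u
/ M`. Single-qubit phases turn the result into CZ.

The error analysis rests on words. A state is small if every word of `k` letters `D`, `star D`, `t`
maps it to a vector of norm `O(M ^ (-k/2))`. The vacuum is small (`IsVacuum.isSmall`) and smallness
survives the evolutions with linearized generators (`IsSmall.evol`). Every remainder has at least
`m` letters. The linearization error is therefore at most of order `u (g ^ J / √M) ^ (m + 1)`, and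
`u g ^ J ≤ √M` bounds this by `u ^ (-m) = N ^ (-δ m / 2)`, which is made small by the choice of `m`
(`exists_norm_chain_sub_chainLin_le`, `exists_evol_chain_error`, `exists_gate_error`). All constants
depend on `m` and `J` only. -/

namespace AllToAll

/-! ### Smallness of states in terms of words, and orders of operators. -/

section Words

variable {E : Type} [NormedAddCommGroup E] [InnerProductSpace ℂ E]

/-! ### Words of letters -/

/-- `WordBound S k B φ`: every word of length `k` in the letters `S` maps `φ` to a vector of norm
at most `B`. -/
def WordBound (S : Set (E →L[ℂ] E)) : ℕ → ℝ → E → Prop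
  | 0, B, φ => ‖φ‖ ≤ B
  | k + 1, B, φ => ∀ x ∈ S, WordBound S k B (x φ)

namespace WordBound

variable {S S' : Set (E →L[ℂ] E)}

lemma mono {k : ℕ} {B B' : ℝ} {φ : E} (h : WordBound S k B φ) (hB : B ≤ B') :
    WordBound S k B' φ := by
  induction k generalizing φ with
  | zero => exact le_trans h hB
  | succ k ih => exact fun x hx => ih (h x hx)

lemma add {k : ℕ} {B B' : ℝ} {φ ψ : E} (h : WordBound S k B φ) (h' : WordBound S k B' ψ) :
    WordBound S k (B + B') (φ + ψ) := by
  induction k generalizing φ ψ with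
  | zero => exact (norm_add_le _ _).trans (add_le_add h h')
  | succ k ih =>
    intro x hx
    rw [map_add]
    exact ih (h x hx) (h' x hx)

lemma smul {k : ℕ} {B : ℝ} {φ : E} (c : ℂ) (h : WordBound S k B φ) :
    WordBound S k (‖c‖ * B) (c • φ) := by
  induction k generalizing φ with
  | zero =>
    simp only [WordBound] at h ⊢
    rw [norm_smul]
    gcongr
  | succ k ih =>
    intro x hx
    rw [map_smul]
    exact ih (h x hx)

lemma zero_vec (k : ℕ) {B : ℝ} (hB : 0 ≤ B) : WordBound S k B (0 : E) := by
  induction k with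
  | zero => simpa [WordBound] using hB
  | succ k ih =>
    intro x hx
    rw [map_zero]
    exact ih

/-- The mean value inequality. -/
lemma of_hasDerivAt {k : ℕ} {C s : ℝ} (hs : 0 ≤ s) (hs1 : s ≤ 1) (hC : 0 ≤ C) {f f' : ℝ → E}
    (hf : ∀ v ∈ Set.Icc 0 s, HasDerivAt f (f' v) v)
    (hb : ∀ v ∈ Set.Icc 0 s, WordBound S k C (f' v)) : WordBound S k C (f s - f 0) := by
  induction k generalizing f f' with
  | zero =>
    have := norm_image_sub_le_of_norm_deriv_le_segment' (f := f) (f' := f') (C := C) (a := 0)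
      (b := s) (fun x hx => (hf x hx).hasDerivWithinAt)
      (fun x hx => hb x (Set.Ico_subset_Icc_self hx)) s (Set.right_mem_Icc.2 hs)
    refine this.trans ?_
    nlinarith
  | succ k ih =>
    intro x hx
    rw [map_sub]
    refine ih (f := fun v => x (f v)) (f' := fun v => x (f' v)) (fun v hv => ?_)
      (fun v hv => hb v hv x hx)
    have := (x.restrictScalars ℝ).hasFDerivAt.comp_hasDerivAt v (hf v hv)
    exact this

/-- An operator commuting with the letters `S'` that is controlled by words of length `a`. -/
lemma apply_of_commute {T : E →L[ℂ] E} {a : ℕ} {c : ℝ} (hS : S' ⊆ S)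
    (hT : ∀ x ∈ S', Commute T x) {B : ℝ} (hB : 0 ≤ B)
    (h : ∀ B φ, 0 ≤ B → WordBound S a B φ → ‖T φ‖ ≤ c * B) {b : ℕ} {φ : E}
    (hφ : WordBound S (a + b) B φ) : WordBound S' b (c * B) (T φ) := by
  induction b generalizing φ with
  | zero => exact h B φ hB hφ
  | succ b ih =>
    intro x hx
    have : x (T φ) = T (x φ) := by
      have := (hT x hx).eq
      exact (DFunLike.congr_fun this φ).symm
    rw [this]
    exact ih (hφ x (hS hx))

lemma of_norm_le {c : ℝ} (hc : 0 ≤ c) (hS : ∀ x ∈ S, ‖x‖ ≤ c) {k : ℕ} {B : ℝ} {φ : E}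
    (h : ‖φ‖ ≤ B) : WordBound S k (c ^ k * B) φ := by
  induction k generalizing φ B with
  | zero => simpa [WordBound] using h
  | succ k ih =>
    intro x hx
    have : ‖x φ‖ ≤ c * B := (x.le_opNorm φ).trans
      (mul_le_mul (hS x hx) h (norm_nonneg _) hc)
    have := ih this
    rwa [← mul_assoc, ← pow_succ] at this

lemma succ_of {c : ℝ} (hc : 0 ≤ c) (hS : ∀ x ∈ S, ‖x‖ ≤ c) {k : ℕ} {B : ℝ} {φ : E}
    (h : WordBound S k B φ) : WordBound S (k + 1) (c * B) φ := by
  induction k generalizing φ with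
  | zero =>
    have := of_norm_le (k := 1) hc hS h
    rwa [pow_one] at this
  | succ k ih => exact fun x hx => ih (h x hx)

end WordBound

/-- `T` has order `l`: it gains `l` letters. -/
def HasOrder (S : Set (E →L[ℂ] E)) (l : ℕ) (c : ℝ) (T : E →L[ℂ] E) : Prop :=
  0 ≤ c ∧ ∀ k B φ, 0 ≤ B → WordBound S (k + l) B φ → WordBound S k (c * B) (T φ)

namespace HasOrder

variable {S : Set (E →L[ℂ] E)}

lemma letter {x : E →L[ℂ] E} (hx : x ∈ S) : HasOrder S 1 1 x := by
  refine ⟨zero_le_one, fun k B φ _ h => ?_⟩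
  rw [one_mul]
  exact h x hx

lemma one : HasOrder S 0 1 (1 : E →L[ℂ] E) := by
  refine ⟨zero_le_one, fun k B φ _ h => ?_⟩
  rw [one_mul]
  exact h

lemma mul {l l' : ℕ} {c c' : ℝ} {T T' : E →L[ℂ] E} (h : HasOrder S l c T)
    (h' : HasOrder S l' c' T') : HasOrder S (l + l') (c * c') (T * T') := by
  refine ⟨mul_nonneg h.1 h'.1, fun k B φ hB hφ => ?_⟩
  rw [mul_assoc]
  exact h.2 k _ _ (mul_nonneg h'.1 hB) (h'.2 (k + l) B φ hB (by rwa [add_assoc]))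

lemma add {l : ℕ} {c c' : ℝ} {T T' : E →L[ℂ] E} (h : HasOrder S l c T)
    (h' : HasOrder S l c' T') : HasOrder S l (c + c') (T + T') := by
  refine ⟨add_nonneg h.1 h'.1, fun k B φ hB hφ => ?_⟩
  rw [add_mul]
  exact (h.2 k B φ hB hφ).add (h'.2 k B φ hB hφ)

lemma smul {l : ℕ} {c : ℝ} {T : E →L[ℂ] E} (h : HasOrder S l c T) (a : ℂ) :
    HasOrder S l (‖a‖ * c) (a • T) := by
  refine ⟨mul_nonneg (norm_nonneg _) h.1, fun k B φ hB hφ => ?_⟩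
  rw [mul_assoc]
  exact (h.2 k B φ hB hφ).smul a

lemma neg {l : ℕ} {c : ℝ} {T : E →L[ℂ] E} (h : HasOrder S l c T) : HasOrder S l c (-T) := by
  simpa using h.smul (-1)

lemma sub {l : ℕ} {c c' : ℝ} {T T' : E →L[ℂ] E} (h : HasOrder S l c T)
    (h' : HasOrder S l c' T') : HasOrder S l (c + c') (T - T') := by
  rw [sub_eq_add_neg]
  exact h.add h'.neg

lemma zero {l : ℕ} : HasOrder S l 0 (0 : E →L[ℂ] E) := by
  refine ⟨le_rfl, fun k B φ hB hφ => ?_⟩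
  rw [zero_mul]
  exact WordBound.zero_vec k le_rfl

lemma sum {l : ℕ} {ι : Type} (s : Finset ι) {c : ι → ℝ} {T : ι → E →L[ℂ] E}
    (h : ∀ i ∈ s, HasOrder S l (c i) (T i)) :
    HasOrder S l (∑ i ∈ s, c i) (∑ i ∈ s, T i) := by
  classical
  induction s using Finset.induction_on with
  | empty => simpa using zero
  | insert a s ha ih =>
    rw [Finset.sum_insert ha, Finset.sum_insert ha]
    exact (h a (Finset.mem_insert_self a s)).add
      (ih fun i hi => h i (Finset.mem_insert_of_mem hi))

lemma pow {l : ℕ} {c : ℝ} {T : E →L[ℂ] E} (h : HasOrder S l c T) (n : ℕ) :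
    HasOrder S (n * l) (c ^ n) (T ^ n) := by
  induction n with
  | zero => simpa using one
  | succ n ih =>
    rw [pow_succ, pow_succ, add_mul, one_mul]
    exact ih.mul h

lemma mono {l : ℕ} {c c' : ℝ} {T : E →L[ℂ] E} (h : HasOrder S l c T) (hc : c ≤ c') :
    HasOrder S l c' T :=
  ⟨h.1.trans hc, fun k B φ hB hφ => (h.2 k B φ hB hφ).mono (by gcongr)⟩

/-- A letter has norm at most `a`, so surplus letters may be given up for a factor `a` each. This
brings operators of different degrees to a common order before they are added. -/
lemma of_add {n l l' : ℕ} {a c : ℝ} {T : E →L[ℂ] E} (ha : 0 ≤ a) (hS : ∀ x ∈ S, ‖x‖ ≤ a)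
    (h : HasOrder S l c T) (hl : l = l' + n) : HasOrder S l' (c * a ^ n) T := by
  subst hl
  induction n generalizing c with
  | zero => simpa using h
  | succ n ih =>
    rw [pow_succ', ← mul_assoc]
    refine ih ⟨mul_nonneg h.1 ha, fun k B φ hB hφ => ?_⟩
    have := h.2 k (a * B) φ (mul_nonneg ha hB) (hφ.succ_of ha hS)
    rwa [← mul_assoc] at this

lemma norm_apply_le {l : ℕ} {c B : ℝ} {T : E →L[ℂ] E} {φ : E} (h : HasOrder S l c T)
    (hφ : WordBound S l B φ) (hB : 0 ≤ B) : ‖T φ‖ ≤ c * B :=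
  h.2 0 B φ hB (by rwa [zero_add])

/-- A contraction commuting with all letters. -/
lemma of_commute {T : E →L[ℂ] E} (hT : ∀ x ∈ S, Commute T x) (h1 : ‖T‖ ≤ 1) :
    HasOrder S 0 1 T := by
  refine ⟨zero_le_one, fun k B φ hB hφ => ?_⟩
  refine WordBound.apply_of_commute (a := 0) (c := 1) subset_rfl hT hB (fun B φ _ h => ?_)
    (by simpa using hφ)
  rw [one_mul]
  refine (T.le_of_opNorm_le h1 φ).trans ?_
  rw [one_mul]
  exact h

end HasOrder

lemma hasDerivAt_clm_apply {A : ℝ → E →L[ℂ] E} {A' : E →L[ℂ] E} {f : ℝ → E} {f' : E} {v : ℝ}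
    (hA : HasDerivAt A A' v) (hf : HasDerivAt f f' v) :
    HasDerivAt (fun v => A v (f v)) (A' (f v) + A v f') v := by
  have h1 : HasDerivAt (fun v => (A v).restrictScalars ℝ) (A'.restrictScalars ℝ) v :=
    ((ContinuousLinearMap.restrictScalarsL ℂ E E ℝ ℝ).hasFDerivAt (x := A v)).comp_hasDerivAt v hA
  exact h1.clm_apply hf

lemma HasOrder.comm_pow {S : Set (E →L[ℂ] E)} {x y : E →L[ℂ] E} {b : ℝ} (hy : HasOrder S 0 3 y)
    (h : HasOrder S 0 b (x * y - y * x)) (n : ℕ) :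
    HasOrder S 0 (b * n * 3 ^ n) (x * y ^ n - y ^ n * x) := by
  induction n with
  | zero => simpa using HasOrder.zero
  | succ n ih =>
    have e : x * y ^ (n + 1) - y ^ (n + 1) * x =
        (x * y ^ n - y ^ n * x) * y + y ^ n * (x * y - y * x) := by
      rw [pow_succ]
      noncomm_ring
    rw [e]
    have h2 : HasOrder S 0 (3 ^ n) (y ^ n) := by simpa using hy.pow n
    refine ((ih.mul hy).add (h2.mul h)).mono ?_
    have := h.1
    push_cast
    have : (0:ℝ) ≤ b * 3 ^ n := by positivity
    rw [pow_succ]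
    nlinarith

lemma conj_pow {A B X : E →L[ℂ] E} (hAB : A * B = 1) (hBA : B * A = 1) (k : ℕ) :
    (A * X * B) ^ k = A * X ^ k * B := by
  induction k with
  | zero => simpa using hAB.symm
  | succ k ih =>
    rw [pow_succ, ih, pow_succ]
    calc A * X ^ k * B * (A * X * B) = A * X ^ k * (B * A) * (X * B) := by noncomm_ring
      _ = _ := by rw [hBA]; noncomm_ring

end Words

/-! ### Unitary groups and the propagation of word bounds. -/

section Evolution

variable {E : Type} [NormedAddCommGroup E] [InnerProductSpace ℂ E] [CompleteSpace E]

/-- The unitary group `exp (-i s H)`. -/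
noncomputable def evol (H : E →L[ℂ] E) (s : ℝ) : E →L[ℂ] E :=
  NormedSpace.exp (s • (-Complex.I • H))

lemma evol_zero (H : E →L[ℂ] E) : evol H 0 = 1 := by simp [evol]

lemma evol_add (H : E →L[ℂ] E) (s t : ℝ) : evol H (s + t) = evol H s * evol H t := by
  let _ : NormedAlgebra ℚ (E →L[ℂ] E) := .restrictScalars ℚ ℂ _
  rw [evol, add_smul, NormedSpace.exp_add_of_commute]
  · rfl
  · exact ((Commute.refl _).smul_left _).smul_right _

lemma evol_neg_mul (H : E →L[ℂ] E) (s : ℝ) : evol H (-s) * evol H s = 1 := by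
  rw [← evol_add, neg_add_cancel, evol_zero]

lemma evol_mul_neg (H : E →L[ℂ] E) (s : ℝ) : evol H s * evol H (-s) = 1 := by
  rw [← evol_add, add_neg_cancel, evol_zero]

lemma evol_smul (H : E →L[ℂ] E) (r s : ℝ) : evol ((r : ℂ) • H) s = evol H (s * r) := by
  rw [evol, evol, mul_smul, smul_comm (-Complex.I), Complex.coe_smul]

lemma hasDerivAt_evol (H : E →L[ℂ] E) (s : ℝ) :
    HasDerivAt (evol H) (evol H s * (-Complex.I • H)) s :=
  hasDerivAt_exp_smul_const (-Complex.I • H) s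

lemma Commute.evol_right {S H : E →L[ℂ] E} (h : Commute S H) (s : ℝ) : Commute S (evol H s) :=
  ((h.smul_right _).smul_right _).exp_right

lemma hasDerivAt_evol' (H : E →L[ℂ] E) (s : ℝ) :
    HasDerivAt (evol H) ((-Complex.I • H) * evol H s) s := by
  have := hasDerivAt_evol H s
  rwa [← (Commute.evol_right ((Commute.refl H).smul_left (-Complex.I)) s).eq] at this

lemma star_evol {H : E →L[ℂ] E} (hH : IsSelfAdjoint H) (s : ℝ) : star (evol H s) = evol H (-s) := by
  rw [evol, NormedSpace.star_exp, evol]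
  congr 1
  rw [star_smul, star_smul, hH.star_eq]
  simp

lemma norm_evol_apply {H : E →L[ℂ] E} (hH : IsSelfAdjoint H) (s : ℝ) (φ : E) :
    ‖evol H s φ‖ = ‖φ‖ := by
  have h : star (evol H s) * evol H s = 1 := by rw [star_evol hH, evol_neg_mul]
  have h2 := ContinuousLinearMap.apply_norm_sq_eq_inner_adjoint_left (evol H s) φ
  have h3 : (ContinuousLinearMap.adjoint (evol H s)).comp (evol H s) = 1 := h
  rw [h3] at h2
  simp only [one_apply_eq_self] at h2
  rw [inner_self_eq_norm_sq (𝕜 := ℂ)] at h2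
  exact (sq_eq_sq₀ (norm_nonneg _) (norm_nonneg _)).1 h2

lemma hasDerivAt_evol_sub (H : E →L[ℂ] E) (s v : ℝ) :
    HasDerivAt (fun v => evol H (s - v)) (-(evol H (s - v) * (-Complex.I • H))) v := by
  have := (hasDerivAt_evol H (s - v)).scomp v ((hasDerivAt_id v).const_sub s)
  rw [neg_one_smul] at this
  exact this

lemma hasDerivAt_evol_apply (H : E →L[ℂ] E) (v : ℝ) (φ : E) :
    HasDerivAt (fun v => evol H v φ) ((-Complex.I • H) (evol H v φ)) v := by
  have := hasDerivAt_clm_apply (hasDerivAt_evol' H v) (hasDerivAt_const v φ)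
  rwa [map_zero, add_zero] at this

/-- The growth of word bounds under a unitary evolution. -/
noncomputable def growth (b : ℝ) : ℕ → ℝ
  | 0 => 1
  | k + 1 => growth b k + b * growth b k ^ 2

lemma one_le_growth {b : ℝ} (hb : 0 ≤ b) (k : ℕ) : 1 ≤ growth b k := by
  induction k with
  | zero => exact le_rfl
  | succ k ih => exact ih.trans (le_add_of_nonneg_right (by positivity))

lemma growth_mono {b : ℝ} (hb : 0 ≤ b) : Monotone (growth b) :=
  monotone_nat_of_le_succ fun k => le_add_of_nonneg_right (by positivity)

/-- Word bounds under the evolution by a Hamiltonian `H` whose commutators with the letters are of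
the form `T x * Γ`, with `T x` of order `0` and a small `Γ`. -/
lemma WordBound.evol {S : Set (E →L[ℂ] E)} {H Γ : E →L[ℂ] E} {T : (E →L[ℂ] E) → E →L[ℂ] E} {b : ℝ}
    (hb : 0 ≤ b) (hH : IsSelfAdjoint H) (hΓH : Commute Γ H) (hΓS : ∀ x ∈ S, Commute Γ x)
    (hT : ∀ x ∈ S, x * H - H * x = T x * Γ) (hTo : ∀ x ∈ S, HasOrder S 0 b (T x))
    (hTΓ : ∀ x ∈ S, Commute Γ (T x)) (k : ℕ) {B : ℝ} {φ : E} (hB : 0 ≤ B)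
    (hφ : ∀ a l, a + l = k → WordBound S l B ((Γ ^ a) φ)) {s : ℝ} (hs : 0 ≤ s) (hs1 : s ≤ 1) :
    WordBound S k (growth b k * B) (evol H s φ) := by
  -- Duhamel: `x e^{-isH} φ` is `e^{-isH} x φ` plus an integral of `e^{-i(s-v)H} (T x) e^{-ivH} Γ
  -- φ`. The commutator uses up the letter `x` but produces a factor `Γ`, so `Γ` is counted as a
  -- letter in the hypothesis and the total length is preserved.
  induction k using Nat.strong_induction_on generalizing φ B s with
  | _ k ih =>
  rcases k with _ | k
  · simp only [WordBound, growth, one_mul]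
    rw [norm_evol_apply hH]
    exact hφ 0 0 rfl
  intro x hx
  have hg := one_le_growth hb k
  have hcomm : ∀ a, Commute (Γ ^ a) x := fun a => (hΓS x hx).pow_left a
  have hcommU : ∀ a v, Commute (Γ ^ a) (AllToAll.evol H v) :=
    fun a v => Commute.evol_right (hΓH.pow_left a) v
  have hcommT : ∀ a, Commute (Γ ^ a) (T x) := fun a => (hTΓ x hx).pow_left a
  have hx1 : WordBound S k (growth b k * B) (AllToAll.evol H s (x φ)) := by
    refine ih k (Nat.lt_succ_self k) hB (fun a l hal => ?_) hs hs1
    have := hφ a (l + 1) (by omega) x hx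
    have h2 : (Γ ^ a) (x φ) = x ((Γ ^ a) φ) := DFunLike.congr_fun (hcomm a).eq φ
    rwa [h2]
  -- Interpolates between `e^{-isH} x φ` at `v = 0` and `x e^{-isH} φ` at `v = s`.
  set f : ℝ → E := fun v => AllToAll.evol H (s - v) (x (AllToAll.evol H v φ)) with hf
  set f' : ℝ → E := fun v => AllToAll.evol H (s - v)
    ((-Complex.I) • (T x) (AllToAll.evol H v (Γ φ))) with hf'
  have hder : ∀ v, HasDerivAt f (f' v) v := by
    intro v
    have h := hasDerivAt_clm_apply (hasDerivAt_evol_sub H s v)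
      (hasDerivAt_clm_apply (hasDerivAt_const v x) (hasDerivAt_evol_apply H v φ))
    convert h using 1
    have e1 := DFunLike.congr_fun (hT x hx) (AllToAll.evol H v φ)
    have e2 := DFunLike.congr_fun (Commute.evol_right hΓH v).eq φ
    simp only [mul_apply_eq_comp, _root_.sub_apply] at e1 e2
    simp only [hf', ← e2, ← e1, _root_.neg_apply, mul_apply_eq_comp,
      _root_.smul_apply, map_neg, map_smul, map_sub, smul_sub,
      _root_.zero_apply, zero_add, neg_smul, neg_neg]
    abel
  -- The induction hypothesis is used for both evolutions in `f'`, on either side of `T x`; hence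
  -- the square in `growth`.
  have hbound : ∀ v ∈ Set.Icc 0 s, WordBound S k (b * growth b k ^ 2 * B) (f' v) := by
    intro v hv
    have key : ∀ l, l ≤ k → ∀ a, a + l = k → WordBound S l (growth b k * B)
        (AllToAll.evol H v ((Γ ^ a) (Γ φ))) := by
      intro l hl a hal
      refine (ih l (by omega) hB (fun a' l' h' => ?_) hv.1 (hv.2.trans hs1)).mono
        (by gcongr; exact growth_mono hb hl)
      have := hφ (a' + a + 1) l' (by omega)
      rw [pow_succ, pow_add] at this
      exact this
    have := ih k (Nat.lt_succ_self k) (B := b * (growth b k * B))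
      (φ := (-Complex.I) • (T x) (AllToAll.evol H v (Γ φ))) (by positivity)
      (fun a l hal => ?_) (s := s - v) (by linarith [hv.2]) (by linarith [hv.1])
    · refine this.mono (le_of_eq (by ring))
    · rw [map_smul]
      have h1 : (Γ ^ a) ((T x) (AllToAll.evol H v (Γ φ))) =
          (T x) (AllToAll.evol H v ((Γ ^ a) (Γ φ))) := by
        have e1 := DFunLike.congr_fun (hcommT a).eq (AllToAll.evol H v (Γ φ))
        have e2 := DFunLike.congr_fun (hcommU a v).eq (Γ φ)
        simp only [mul_apply_eq_comp] at e1 e2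
        rw [e1, e2]
      rw [h1]
      have h2 := ((hTo x hx).2 l _ _ (by positivity) (key l (by omega) a hal)).smul (-Complex.I)
      simpa using h2
  have hmv := WordBound.of_hasDerivAt hs hs1 (by positivity) (fun v _ => hder v) hbound
  have hfs : f s = x (AllToAll.evol H s φ) := by simp [hf, evol_zero]
  have hf0 : f 0 = AllToAll.evol H s (x φ) := by simp [hf, evol_zero]
  have := hmv.add hx1
  rw [hfs, hf0, sub_add_cancel] at this
  exact this.mono (le_of_eq (by simp only [growth]; ring))

end Evolution

/-! ### A collective spin near the pole and its angle variable. -/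

section Modes

variable {E : Type} [NormedAddCommGroup E] [InnerProductSpace ℂ E] [CompleteSpace E]

/-- A large collective spin near the pole: in terms of the spin components per particle, `t` is
`σʸ` and `D` is `1 - σᶻ - i σˣ`. -/
structure IsMode (M : ℝ) (D t : E →L[ℂ] E) : Prop where
  star_t : star t = t
  norm_D : ‖D‖ ≤ 3
  norm_t : ‖t‖ ≤ 1
  comm_t_D : t * D - D * t = (-(2 / M) : ℂ) • (1 - D)
  comm_D_star : D * star D - star D * D = (4 / M : ℂ) • t

/-- The letters of a mode. -/
def letters (D t : E →L[ℂ] E) : Set (E →L[ℂ] E) := {D, star D, t}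

/-- The rotation angle of a mode about the axis of `t`, a truncation of the imaginary part of
`log (1 - D)`. -/
noncomputable def angle (m : ℕ) (D : E →L[ℂ] E) : E →L[ℂ] E :=
  (Complex.I / 2) • ∑ k ∈ Finset.range m, ((k + 1 : ℂ)⁻¹) • (D ^ (k + 1) - star D ^ (k + 1))

lemma isSelfAdjoint_angle (m : ℕ) (D : E →L[ℂ] E) : IsSelfAdjoint (angle m D) := by
  rw [IsSelfAdjoint, angle, star_smul, star_sum]
  have h1 : star (Complex.I / 2) = -(Complex.I / 2) := by simp [neg_div]
  rw [h1, neg_smul, ← smul_neg, ← Finset.sum_neg_distrib]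
  congr 1
  refine Finset.sum_congr rfl fun k _ => ?_
  have h2 : star ((k + 1 : ℂ)⁻¹) = (k + 1 : ℂ)⁻¹ := by simp
  rw [star_smul, star_sub, star_pow, star_pow, star_star, h2, ← smul_neg, neg_sub]

lemma Commute.angle_right {A D : E →L[ℂ] E} (h : Commute A D) (h' : Commute A (star D)) (m : ℕ) :
    Commute A (angle m D) := by
  refine Commute.smul_right (Commute.sum_right _ _ _ fun k _ => Commute.smul_right ?_ _) _
  exact (h.pow_right _).sub_right (h'.pow_right _)

namespace IsMode

variable {M : ℝ} {D t : E →L[ℂ] E}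

lemma norm_letters (h : IsMode M D t) : ∀ x ∈ letters D t, ‖x‖ ≤ 3 := by
  rintro x (rfl | rfl | rfl)
  · exact h.norm_D
  · rw [norm_star]
    exact h.norm_D
  · exact h.norm_t.trans (by norm_num)

lemma comm_t_star (h : IsMode M D t) :
    t * star D - star D * t = (2 / M : ℂ) • (1 - star D) := by
  have := congrArg star h.comm_t_D
  rw [star_sub, star_mul, star_mul, h.star_t, star_smul, star_sub, star_one] at this
  have h2 : star (-(2 / M) : ℂ) = -(2 / M) := by simp
  rw [h2] at this
  rw [← neg_sub, this, neg_smul, neg_neg]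

/-- The commutator with `t` is a derivation and `[t, D]` commutes with `D`, so on polynomials in `D`
it acts as `-(2 / M) (1 - D) d/dD`. It thus sends the series of `-log (1 - D)` to a constant. -/
lemma comm_t_pow (h : IsMode M D t) (k : ℕ) :
    t * D ^ (k + 1) - D ^ (k + 1) * t = (-(2 / M) * (k + 1) : ℂ) • (D ^ k * (1 - D)) := by
  induction k with
  | zero => simpa using h.comm_t_D
  | succ k ih =>
    have e : t * D ^ (k + 1 + 1) - D ^ (k + 1 + 1) * t =
        (t * D ^ (k + 1) - D ^ (k + 1) * t) * D + D ^ (k + 1) * (t * D - D * t) := by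
      rw [pow_succ D (k + 1)]
      noncomm_ring
    rw [e, ih, h.comm_t_D, smul_mul_assoc, mul_smul_comm]
    have e2 : D ^ k * (1 - D) * D = D ^ (k + 1) * (1 - D) := by
      rw [pow_succ]
      noncomm_ring
    rw [e2, ← add_smul]
    congr 1
    push_cast
    ring

lemma comm_t_star_pow (h : IsMode M D t) (k : ℕ) :
    t * star D ^ (k + 1) - star D ^ (k + 1) * t =
      ((2 / M) * (k + 1) : ℂ) • (star D ^ k * (1 - star D)) := by
  have := congrArg star (h.comm_t_pow k)
  have h2 : star (-(2 / M) * (k + 1) : ℂ) = -((2 / M) * (k + 1)) := by simp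
  have h3 : (1 - star D) * star D ^ k = star D ^ k * (1 - star D) :=
    (((Commute.one_left _).sub_left (Commute.refl _)).pow_right k).eq
  rw [star_sub, star_mul, star_mul, h.star_t, star_smul, h2, star_mul, star_sub, star_one, star_pow,
    star_pow, h3] at this
  rw [← neg_sub, this, neg_smul, neg_neg]

/-- Up to the remainder `D ^ m`, the angle is canonically conjugate to `t`. -/
lemma comm_t_angle (h : IsMode M D t) (m : ℕ) :
    t * angle m D - angle m D * t = (-(Complex.I / M) : ℂ) • (2 - (D ^ m + star D ^ m)) := by
  have e : t * angle m D - angle m D * t = (Complex.I / 2) • ∑ k ∈ Finset.range m,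
      ((k + 1 : ℂ)⁻¹) • ((t * D ^ (k + 1) - D ^ (k + 1) * t) -
        (t * star D ^ (k + 1) - star D ^ (k + 1) * t)) := by
    rw [angle, mul_smul_comm, smul_mul_assoc, ← smul_sub, Finset.mul_sum, Finset.sum_mul,
      ← Finset.sum_sub_distrib]
    congr 1
    refine Finset.sum_congr rfl fun k _ => ?_
    rw [mul_smul_comm, smul_mul_assoc, ← smul_sub]
    congr 1
    noncomm_ring
  have e2 : ∀ k ∈ Finset.range m, ((k + 1 : ℂ)⁻¹) • ((t * D ^ (k + 1) - D ^ (k + 1) * t) -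
        (t * star D ^ (k + 1) - star D ^ (k + 1) * t)) =
      (-(2 / M) : ℂ) • (D ^ k * (1 - D) + star D ^ k * (1 - star D)) := by
    intro k _
    have hk : (k + 1 : ℂ) ≠ 0 := by exact_mod_cast Nat.succ_ne_zero k
    rw [h.comm_t_pow, h.comm_t_star_pow, smul_sub, smul_smul, smul_smul, smul_add]
    have e3 : ((k : ℂ) + 1)⁻¹ * (-(2 / M) * (k + 1)) = -(2 / M) := by field_simp
    have e4 : ((k : ℂ) + 1)⁻¹ * ((2 / M) * (k + 1)) = 2 / M := by field_simp
    rw [e3, e4, neg_smul, neg_smul]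
    abel
  -- The factors `k + 1` have cancelled, and the geometric sum `∑ D ^ k * (1 - D) = 1 - D ^ m`
  -- leaves only the remainder of the truncation.
  rw [e, Finset.sum_congr rfl e2, ← Finset.smul_sum, Finset.sum_add_distrib, ← Finset.sum_mul,
    ← Finset.sum_mul, geom_sum_mul_neg, geom_sum_mul_neg, smul_smul]
  have e5 : (2 : E →L[ℂ] E) = 1 + 1 := by norm_num
  rw [e5]
  congr 1
  · ring
  · abel

end IsMode

/-- `S` contains the letters of the mode, and every other letter commutes with these. -/
structure ModeIn (S : Set (E →L[ℂ] E)) (M : ℝ) (D t : E →L[ℂ] E) : Prop extends IsMode M D t where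
  subset : letters D t ⊆ S
  commute : ∀ x ∈ S, x ∈ letters D t ∨ ∀ y ∈ letters D t, Commute x y

namespace ModeIn

variable {S : Set (E →L[ℂ] E)} {M : ℝ} {D t : E →L[ℂ] E}

lemma self (h : IsMode M D t) : ModeIn (letters D t) M D t :=
  ⟨h, subset_rfl, fun _ hx => Or.inl hx⟩

lemma hasOrder_D (h : ModeIn S M D t) : HasOrder S 1 1 D :=
  HasOrder.letter (h.subset (Or.inl rfl))

lemma hasOrder_star_D (h : ModeIn S M D t) : HasOrder S 1 1 (star D) :=
  HasOrder.letter (h.subset (Or.inr (Or.inl rfl)))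

lemma hasOrder_t (h : ModeIn S M D t) : HasOrder S 1 1 t :=
  HasOrder.letter (h.subset (Or.inr (Or.inr rfl)))

/-- Commutators of letters have order `0`. -/
lemma hasOrder_comm (h : ModeIn S M D t) (hM : 0 < M) (hS : ∀ x ∈ S, ‖x‖ ≤ 3) :
    ∀ x ∈ S, ∀ y ∈ letters D t, HasOrder S 0 (12 / M) (x * y - y * x) := by
  have h0 : (0 : ℝ) ≤ 12 / M := by positivity
  have zero : HasOrder S 0 (12 / M) (0 : E →L[ℂ] E) := HasOrder.zero.mono h0
  have hz : ∀ {x y : E →L[ℂ] E}, Commute x y → HasOrder S 0 (12 / M) (x * y - y * x) := by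
    intro x y hxy
    rw [hxy.eq, sub_self]
    exact zero
  have hsymm : ∀ {x y : E →L[ℂ] E}, HasOrder S 0 (12 / M) (x * y - y * x) →
      HasOrder S 0 (12 / M) (y * x - x * y) := by
    intro x y hxy
    rw [← neg_sub]
    exact hxy.neg
  have nM : ‖(M : ℂ)‖ = M := by
    rw [Complex.norm_real, Real.norm_of_nonneg hM.le]
  have ord : ∀ {y : E →L[ℂ] E}, HasOrder S 1 1 y → HasOrder S 0 3 y := by
    intro y hy
    simpa using hy.of_add (n := 1) (l' := 0) (by norm_num : (0:ℝ) ≤ 3) hS rfl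
  have h1 : HasOrder S 0 (12 / M) (t * D - D * t) := by
    rw [h.comm_t_D]
    refine ((HasOrder.one.sub (ord h.hasOrder_D)).smul _).mono (le_of_lt ?_)
    rw [norm_neg, norm_div, nM, Complex.norm_ofNat]
    rw [div_mul_eq_mul_div]
    gcongr
    norm_num
  have h2 : HasOrder S 0 (12 / M) (t * star D - star D * t) := by
    rw [h.comm_t_star]
    refine ((HasOrder.one.sub (ord h.hasOrder_star_D)).smul _).mono (le_of_lt ?_)
    rw [norm_div, nM, Complex.norm_ofNat]
    rw [div_mul_eq_mul_div]
    gcongr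
    norm_num
  have h3 : HasOrder S 0 (12 / M) (D * star D - star D * D) := by
    rw [h.comm_D_star]
    refine ((ord h.hasOrder_t).smul _).mono (le_of_eq ?_)
    rw [norm_div, nM, Complex.norm_ofNat]
    ring
  intro x hx y hy
  rcases h.commute x hx with hx' | hx'
  · rcases hx' with rfl | rfl | rfl <;> rcases hy with rfl | rfl | rfl
    · exact hz (Commute.refl _)
    · exact h3
    · exact hsymm h1
    · exact hsymm h3
    · exact hz (Commute.refl _)
    · exact hsymm h2
    · exact h1
    · exact h2
    · exact hz (Commute.refl _)
  · exact hz (hx' y hy)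

/-- A bound for the order constants of the angle. -/
noncomputable def angleConst (m : ℕ) : ℝ := 12 * ∑ k ∈ Finset.range m, (k + 1 : ℝ) * 3 ^ (k + 1)

lemma angleConst_nonneg (m : ℕ) : 0 ≤ angleConst m := by
  unfold angleConst
  positivity

lemma hasOrder_angle (h : ModeIn S M D t) (hS : ∀ x ∈ S, ‖x‖ ≤ 3) (m : ℕ) :
    HasOrder S 1 (angleConst m) (angle m D) := by
  have h1 : ∀ {y : E →L[ℂ] E}, HasOrder S 1 1 y → ∀ k, HasOrder S 1 (3 ^ k) (y ^ (k + 1)) := by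
    intro y hy k
    have := (hy.pow (k + 1)).of_add (n := k) (l' := 1) (by norm_num : (0:ℝ) ≤ 3) hS (by ring)
    simpa using this
  refine ((HasOrder.sum (Finset.range m) (c := fun k => 2 * 3 ^ k) fun k _ => ?_).smul _).mono
    (c := ‖Complex.I / 2‖ * ∑ k ∈ Finset.range m, 2 * 3 ^ k) ?_
  · refine (((h1 h.hasOrder_D k).sub (h1 h.hasOrder_star_D k)).smul _).mono ?_
    have : ‖((k : ℂ) + 1)⁻¹‖ ≤ 1 := by
      rw [norm_inv]
      have : ‖(k : ℂ) + 1‖ = k + 1 := by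
        have := Complex.norm_natCast (k + 1)
        push_cast at this
        exact this
      rw [this]
      exact inv_le_one_of_one_le₀ (by simp)
    nlinarith [pow_pos (by norm_num : (0:ℝ) < 3) k]
  · rw [norm_div, Complex.norm_I, Complex.norm_ofNat, angleConst, Finset.mul_sum, Finset.mul_sum]
    refine Finset.sum_le_sum fun k _ => ?_
    rw [pow_succ]
    have : (0:ℝ) < 3 ^ k := by positivity
    have : (0:ℝ) ≤ k := by positivity
    nlinarith

/-- A commutator with the angle removes a letter but gains `1 / M`, the square of the size of a
letter on the vacuum. This is why the evolutions generated by angles keep small states small. -/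
lemma hasOrder_comm_angle (h : ModeIn S M D t) (hM : 0 < M) (hS : ∀ x ∈ S, ‖x‖ ≤ 3) (m : ℕ) :
    ∀ x ∈ S, HasOrder S 0 (angleConst m / M) (x * angle m D - angle m D * x) := by
  intro x hx
  have e : x * angle m D - angle m D * x = (Complex.I / 2) • ∑ k ∈ Finset.range m,
      ((k + 1 : ℂ)⁻¹) • ((x * D ^ (k + 1) - D ^ (k + 1) * x) -
        (x * star D ^ (k + 1) - star D ^ (k + 1) * x)) := by
    rw [angle, mul_smul_comm, smul_mul_assoc, ← smul_sub, Finset.mul_sum, Finset.sum_mul,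
      ← Finset.sum_sub_distrib]
    congr 1
    refine Finset.sum_congr rfl fun k _ => ?_
    rw [mul_smul_comm, smul_mul_assoc, ← smul_sub]
    congr 1
    noncomm_ring
  have ord : ∀ {y : E →L[ℂ] E}, HasOrder S 1 1 y → HasOrder S 0 3 y := by
    intro y hy
    simpa using hy.of_add (n := 1) (l' := 0) (by norm_num : (0:ℝ) ≤ 3) hS rfl
  rw [e]
  refine ((HasOrder.sum (Finset.range m)
    (c := fun k => 2 * (12 / M * (k + 1 : ℕ) * 3 ^ (k + 1))) fun k _ => ?_).smul _).mono
    (c := ‖Complex.I / 2‖ * ∑ k ∈ Finset.range m, 2 * (12 / M * (k + 1 : ℕ) * 3 ^ (k + 1))) ?_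
  · have a1 := HasOrder.comm_pow (ord h.hasOrder_D) (h.hasOrder_comm hM hS x hx D (Or.inl rfl))
      (k + 1)
    have a2 := HasOrder.comm_pow (ord h.hasOrder_star_D)
      (h.hasOrder_comm hM hS x hx (star D) (Or.inr (Or.inl rfl))) (k + 1)
    refine ((a1.sub a2).smul _).mono ?_
    have : ‖((k : ℂ) + 1)⁻¹‖ ≤ 1 := by
      rw [norm_inv]
      have : ‖(k : ℂ) + 1‖ = k + 1 := by
        have := Complex.norm_natCast (k + 1)
        push_cast at this
        exact this
      rw [this]
      exact inv_le_one_of_one_le₀ (by simp)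
    have h0 := a1.1
    nlinarith
  · rw [norm_div, Complex.norm_I, Complex.norm_ofNat, angleConst, Finset.mul_sum, Finset.mul_sum,
      Finset.sum_div]
    refine Finset.sum_le_sum fun k _ => le_of_eq ?_
    push_cast
    ring

end ModeIn

end Modes

/-! ### Amplified angles. -/

section Chains

variable {E : Type} [NormedAddCommGroup E] [InnerProductSpace ℂ E] [CompleteSpace E]

/-- The amplified angle: the base `Y` is amplified by the factor `g` with every further mode. -/
noncomputable def chain (M g : ℝ) (m : ℕ) (Y : E →L[ℂ] E) (D t : ℕ → E →L[ℂ] E) : ℕ → E →L[ℂ] E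
  | 0 => Y
  | j + 1 =>
    evol (((g / 2 * M : ℝ) : ℂ) • (chain M g m Y D t j * t j)) (-1) * angle m (D j) *
      evol (((g / 2 * M : ℝ) : ℂ) • (chain M g m Y D t j * t j)) 1

/-- The linear approximation of the amplified angle. -/
noncomputable def chainLin (g : ℝ) (m : ℕ) (Y : E →L[ℂ] E) (D : ℕ → E →L[ℂ] E) : ℕ → E →L[ℂ] E
  | 0 => Y
  | j + 1 => angle m (D j) + (g : ℂ) • chainLin g m Y D j

/-- The data of a chain: a base `Y` and a sequence of modes commuting with the base and with each
other. -/
structure IsChain (S : Set (E →L[ℂ] E)) (M c : ℝ) (Y : E →L[ℂ] E) (D t : ℕ → E →L[ℂ] E) (J : ℕ) :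
    Prop where
  norm_le : ∀ x ∈ S, ‖x‖ ≤ 3
  base_sa : IsSelfAdjoint Y
  base_order : HasOrder S 1 c Y
  base_comm : ∀ x ∈ S, HasOrder S 0 (c / M) (x * Y - Y * x)
  mode : ∀ j < J, ModeIn S M (D j) (t j)
  base_commute : ∀ j < J, ∀ x ∈ letters (D j) (t j), Commute Y x
  commute : ∀ i < J, ∀ j < J, i ≠ j → ∀ x ∈ letters (D i) (t i), ∀ y ∈ letters (D j) (t j),
    Commute x y

variable {S : Set (E →L[ℂ] E)} {M c g : ℝ} {m J : ℕ} {Y : E →L[ℂ] E} {D t : ℕ → E →L[ℂ] E}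

lemma commute_chain {A : E →L[ℂ] E} {j : ℕ} (hY : Commute A Y)
    (h : ∀ i < j, ∀ x ∈ letters (D i) (t i), Commute A x) : Commute A (chain M g m Y D t j) := by
  induction j with
  | zero => exact hY
  | succ j ih =>
    have hj := ih fun i hi => h i (by omega)
    have hl := h j (Nat.lt_succ_self j)
    have hA : Commute A (angle m (D j)) :=
      Commute.angle_right (hl _ (Or.inl rfl)) (hl _ (Or.inr (Or.inl rfl))) m
    have hG : Commute A (((g / 2 * M : ℝ) : ℂ) • (chain M g m Y D t j * t j)) :=
      (hj.mul_right (hl _ (Or.inr (Or.inr rfl)))).smul_right _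
    exact ((Commute.evol_right hG _).mul_right hA).mul_right (Commute.evol_right hG _)

lemma commute_chainLin {A : E →L[ℂ] E} {j : ℕ} (hY : Commute A Y)
    (h : ∀ i < j, ∀ x ∈ letters (D i) (t i), Commute A x) : Commute A (chainLin g m Y D j) := by
  induction j with
  | zero => exact hY
  | succ j ih =>
    have hj := ih fun i hi => h i (by omega)
    have hl := h j (Nat.lt_succ_self j)
    exact (Commute.angle_right (hl _ (Or.inl rfl)) (hl _ (Or.inr (Or.inl rfl))) m).add_right
      (hj.smul_right _)

namespace IsChain

/-- The chain of length `i` is built from the base and the modes below `i` only. -/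
lemma commute_letters (h : IsChain S M c Y D t J) {i j : ℕ} (hij : i ≤ j) (hj : j < J) :
    ∀ x ∈ letters (D j) (t j), Commute (chain M g m Y D t i) x := by
  intro x hx
  refine (commute_chain (h.base_commute j hj x hx).symm fun k hk y hy => ?_).symm
  exact h.commute j hj k (by omega) (by omega) x hx y hy

lemma isSelfAdjoint_gen {i : ℕ} (hJ : IsSelfAdjoint (chain M g m Y D t i))
    (ht : IsSelfAdjoint (t i)) (hc : Commute (chain M g m Y D t i) (t i)) :
    IsSelfAdjoint (((g / 2 * M : ℝ) : ℂ) • (chain M g m Y D t i * t i)) := by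
  rw [IsSelfAdjoint, star_smul, star_mul, hJ.star_eq, ht.star_eq, hc.eq]
  simp

lemma isSelfAdjoint (h : IsChain S M c Y D t J) {j : ℕ} (hj : j ≤ J) :
    IsSelfAdjoint (chain M g m Y D t j) := by
  induction j with
  | zero => exact h.base_sa
  | succ j ih =>
    have hG := isSelfAdjoint_gen (ih (by omega)) (h.mode j hj).star_t
      (h.commute_letters le_rfl hj _ (Or.inr (Or.inr rfl)))
    have e := star_evol hG 1
    have e' := star_evol hG (-1)
    rw [neg_neg] at e'
    rw [IsSelfAdjoint, chain, star_mul, star_mul, e, e', (isSelfAdjoint_angle m (D j)).star_eq,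
      mul_assoc]

lemma isSelfAdjoint_lin (h : IsChain S M c Y D t J) {j : ℕ} (hj : j ≤ J) :
    IsSelfAdjoint (chainLin g m Y D j) := by
  induction j with
  | zero => exact h.base_sa
  | succ j ih =>
    refine (isSelfAdjoint_angle m (D j)).add ?_
    rw [IsSelfAdjoint, star_smul, (ih (by omega)).star_eq]
    simp

/-- The evolution generated by the coupling of a chain to its next mode. -/
lemma wordBound_evol (h : IsChain S M c Y D t J) (hM : 0 < M) {j : ℕ} (hj : j < J) {k : ℕ}
    {B : ℝ} {φ : E} (hB : 0 ≤ B)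
    (hφ : ∀ a l, a + l = k →
      WordBound (letters (D j) (t j)) l B ((((g : ℂ) • chain M g m Y D t j) ^ a) φ))
    {s : ℝ} (hs : 0 ≤ s) (hs1 : s ≤ 1) :
    WordBound (letters (D j) (t j)) k (growth 6 k * B)
      (evol (((g / 2 * M : ℝ) : ℂ) • (chain M g m Y D t j * t j)) s φ) := by
  set R := chain M g m Y D t j with hR
  have hm : ModeIn (letters (D j) (t j)) M (D j) (t j) := ModeIn.self (h.mode j hj).toIsMode
  have hc : ∀ x ∈ letters (D j) (t j), Commute R x := h.commute_letters le_rfl hj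
  have ht : t j ∈ letters (D j) (t j) := Or.inr (Or.inr rfl)
  -- The Hamiltonian is `(g / 2) M R t_j`, so its commutator with a letter `x` of mode `j` is `(M /
  -- 2) [x, t_j]` times the displacement `g R`. The first factor has order `0` with the constant `(M
  -- / 2) (12 / M) = 6`.
  refine WordBound.evol (Γ := (g : ℂ) • R) (T := fun x => ((M / 2 : ℝ) : ℂ) • (x * t j - t j * x))
    (by norm_num) (isSelfAdjoint_gen (h.isSelfAdjoint hj.le) (h.mode j hj).star_t (hc _ ht))
    ?_ ?_ ?_ ?_ ?_ k hB hφ hs hs1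
  · exact ((((Commute.refl R).mul_right (hc _ ht))).smul_right _).smul_left _
  · exact fun x hx => (hc x hx).smul_left _
  · intro x hx
    rw [mul_smul_comm, smul_mul_assoc, mul_smul_comm, smul_mul_assoc, smul_smul, ← smul_sub]
    have e1 : x * (R * t j) = x * t j * R := by rw [(hc _ ht).eq, mul_assoc]
    have e2 : R * t j * x = t j * x * R := by
      rw [(hc _ ht).eq, mul_assoc, (hc _ hx).eq, mul_assoc]
    rw [e1, e2, ← sub_mul]
    congr 1
    push_cast
    ring
  · intro x hx
    refine ((hm.hasOrder_comm hM (h.mode j hj).norm_letters x hx _ ht).smul _).mono (le_of_eq ?_)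
    rw [Complex.norm_real, Real.norm_of_nonneg (by positivity)]
    field_simp
    norm_num
  · intro x hx
    exact (((hc x hx).mul_right (hc _ ht)).sub_right ((hc _ ht).mul_right (hc x hx))).smul_right _
      |>.smul_left _

end IsChain

/-- Supplies the hypothesis of `wordBound_evol`: a factor `g R` counts as one letter amplified by `g
^ (j + 1)`, and it passes through the letters of mode `j`. The bound `k` on `a` makes the constant
the same for all ways of dividing a word into factors `g R` and letters. -/
lemma wordBound_chain_pow {C : ℕ → ℝ} (hC : ∀ a, 0 ≤ C a) (h : IsChain S M c Y D t J)
    (hg : 1 ≤ g) {j : ℕ} (hj : j < J)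
    (hR : ∀ a B φ, 0 ≤ B → WordBound S a B φ →
      ‖(chain M g m Y D t j ^ a) φ‖ ≤ C a * g ^ (j * a) * B)
    {k n : ℕ} {B : ℝ} {φ : E} (hB : 0 ≤ B) (hφ : WordBound S n B φ) (a l : ℕ) (hal : a + l = n)
    (hak : a ≤ k) :
    WordBound (letters (D j) (t j)) l ((∑ i ∈ Finset.range (k + 1), C i) * g ^ ((j + 1) * k) * B)
      ((((g : ℂ) • chain M g m Y D t j) ^ a) φ) := by
  have h0 := hC a
  have hg0 : 0 ≤ g := zero_le_one.trans hg
  have h1 : WordBound (letters (D j) (t j)) l (C a * g ^ (j * a) * B)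
      ((chain M g m Y D t j ^ a) φ) := by
    refine WordBound.apply_of_commute (S := S) (a := a) (h.mode j hj).subset
      (fun x hx => (h.commute_letters le_rfl hj x hx).pow_left a) hB (hR a) (by rwa [hal])
  rw [smul_pow, _root_.smul_apply]
  refine (h1.smul _).mono ?_
  have h2 : C a ≤ ∑ i ∈ Finset.range (k + 1), C i :=
    Finset.single_le_sum (fun i _ => hC i) (Finset.mem_range.2 (by omega))
  have h4 := h0.trans h2
  have h3 : g ^ a * g ^ (j * a) ≤ g ^ ((j + 1) * k) := by
    rw [← pow_add]
    refine pow_le_pow_right₀ hg ?_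
    nlinarith
  rw [norm_pow, Complex.norm_real, Real.norm_of_nonneg hg0]
  calc g ^ a * (C a * g ^ (j * a) * B) = C a * (g ^ a * g ^ (j * a)) * B := by ring
    _ ≤ _ := by gcongr

/-- Powers of the amplified angle are bounded on states with few excitations. -/
theorem exists_norm_chain_pow_le (m : ℕ) (c : ℝ) (j : ℕ) : ∃ C : ℕ → ℝ, (∀ k, 0 ≤ C k) ∧
    ∀ (E : Type) [NormedAddCommGroup E] [InnerProductSpace ℂ E] [CompleteSpace E]
      (S : Set (E →L[ℂ] E)) (M g : ℝ) (Y : E →L[ℂ] E) (D t : ℕ → E →L[ℂ] E) (J : ℕ),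
      IsChain S M c Y D t J → 0 < M → 1 ≤ g → j ≤ J → ∀ k B φ, 0 ≤ B → WordBound S k B φ →
        ‖(chain M g m Y D t j ^ k) φ‖ ≤ C k * g ^ (j * k) * B := by
  induction j with
  | zero =>
    refine ⟨fun k => |c| ^ k, fun k => by positivity, ?_⟩
    intro E _ _ _ S M g Y D t J h hM hg _ k B φ hB hφ
    have := (h.base_order.pow k).2 0 B φ hB (by simpa using hφ)
    simp only [WordBound] at this
    rw [zero_mul, pow_zero, mul_one, abs_of_nonneg h.base_order.1]
    exact this
  | succ j ih =>
    obtain ⟨C, hC, ih⟩ := ih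
    refine ⟨fun k => ModeIn.angleConst m ^ k * (growth 6 k * ∑ i ∈ Finset.range (k + 1), C i),
      fun k => ?_, ?_⟩
    · have := one_le_growth (by norm_num : (0:ℝ) ≤ 6) k
      have := ModeIn.angleConst_nonneg m
      have := Finset.sum_nonneg (s := Finset.range (k + 1)) fun i _ => hC i
      positivity
    intro E _ _ _ S M g Y D t J h hM hg hj k B φ hB hφ
    have hG := IsChain.isSelfAdjoint_gen (g := g) (M := M) (m := m)
      (h.isSelfAdjoint (g := g) (m := m) (Nat.le_of_succ_le hj)) (h.mode j hj).star_t
      (h.commute_letters le_rfl hj _ (Or.inr (Or.inr rfl)))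
    have hsum := Finset.sum_nonneg (s := Finset.range (k + 1)) fun i _ => hC i
    -- The `k`-th power of the next chain is a unitary conjugate of `angle ^ k`, so only words of
    -- length `k` in the letters of mode `j`, applied to the evolved state, are needed.
    have hw := h.wordBound_evol (g := g) (m := m) hM hj (k := k) (by positivity)
      (fun a l hal => wordBound_chain_pow (k := k) hC h hg hj
        (ih E S M g Y D t J h hM hg (Nat.le_of_succ_le hj)) hB hφ a l hal (by omega))
      zero_le_one le_rfl
    have hX := ((ModeIn.self (h.mode j hj).toIsMode).hasOrder_angle
      (h.mode j hj).norm_letters m).pow k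
    have hgr := one_le_growth (by norm_num : (0:ℝ) ≤ 6) k
    rw [mul_one] at hX
    have := hX.norm_apply_le hw (by positivity)
    rw [chain, conj_pow (evol_neg_mul _ _) (evol_mul_neg _ _), mul_apply_eq_comp,
      mul_apply_eq_comp, norm_evol_apply hG]
    refine this.trans (le_of_eq (by ring))

/-- The error of the linear approximation in one step. -/
theorem exists_norm_chain_succ_sub_le (m : ℕ) (c : ℝ) (j : ℕ) : ∃ C : ℝ, 0 ≤ C ∧
    ∀ (E : Type) [NormedAddCommGroup E] [InnerProductSpace ℂ E] [CompleteSpace E]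
      (S : Set (E →L[ℂ] E)) (M g : ℝ) (Y : E →L[ℂ] E) (D t : ℕ → E →L[ℂ] E) (J : ℕ),
      IsChain S M c Y D t J → 0 < M → 1 ≤ g → j < J → ∀ B φ, 0 ≤ B → WordBound S (m + 1) B φ →
        ‖(chain M g m Y D t (j + 1) - angle m (D j) - (g : ℂ) • chain M g m Y D t j) φ‖ ≤
          C * g ^ ((j + 1) * (m + 1)) * B := by
  obtain ⟨C, hC, hpow⟩ := exists_norm_chain_pow_le m c j
  have hsum := Finset.sum_nonneg (s := Finset.range (m + 1 + 1)) fun i _ => hC i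
  have hgr := one_le_growth (by norm_num : (0:ℝ) ≤ 6) m
  refine ⟨growth 6 m * ∑ i ∈ Finset.range (m + 1 + 1), C i, by positivity, ?_⟩
  intro E _ _ _ S M g Y D t J h hM hg hj B φ hB hφ
  have hc := h.commute_letters (g := g) (m := m) le_rfl hj
  have ht : t j ∈ letters (D j) (t j) := Or.inr (Or.inr rfl)
  set R := chain M g m Y D t j with hR
  set H := ((g / 2 * M : ℝ) : ℂ) • (R * t j) with hHdef
  have hG : IsSelfAdjoint H := IsChain.isSelfAdjoint_gen (g := g) (M := M) (m := m)
      (h.isSelfAdjoint (g := g) (m := m) hj.le) (h.mode j hj).star_t (hc _ ht)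
  have hRH : Commute R H := (((Commute.refl R).mul_right (hc _ ht))).smul_right _
  have hRX : Commute R (angle m (D j)) :=
    Commute.angle_right (hc _ (Or.inl rfl)) (hc _ (Or.inr (Or.inl rfl))) m
  -- the commutator of the Hamiltonian and the angle
  have hcomm : angle m (D j) * H - H * angle m (D j) =
      (((g / 2 : ℝ) : ℂ) * Complex.I) • ((2 - (D j ^ m + star (D j) ^ m)) * R) := by
    have e1 : angle m (D j) * H - H * angle m (D j) =
        (-((g / 2 * M : ℝ) : ℂ)) • ((t j * angle m (D j) - angle m (D j) * t j) * R) := by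
      rw [hHdef, mul_smul_comm, smul_mul_assoc, ← smul_sub, neg_smul, ← smul_neg]
      congr 1
      rw [(hc _ ht).eq, mul_assoc (t j), hRX.eq]
      noncomm_ring
    rw [e1, (h.mode j hj).comm_t_angle, smul_mul_assoc, smul_smul]
    congr 1
    have : (M : ℂ) ≠ 0 := by exact_mod_cast hM.ne'
    push_cast
    field_simp
  -- If the angle were exactly conjugate to `t_j`, the Heisenberg evolution would shift it by `s g
  -- R` and `f` would be constant. The derivative of `f` is the truncation remainder: `m` letters of
  -- mode `j` and one factor `g R`, hence the word length `m + 1`.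
  set f : ℝ → E := fun s => evol H (-s) (angle m (D j) (evol H s φ)) - s • ((g : ℂ) • R φ) with hf
  set f' : ℝ → E := fun s => evol H (-s) ((-(((g / 2 : ℝ) : ℂ))) •
      (D j ^ m + star (D j) ^ m) (evol H s (R φ))) with hf'
  have hder : ∀ v, HasDerivAt f (f' v) v := by
    intro v
    have h1 := hasDerivAt_evol_sub H 0 v
    simp only [zero_sub] at h1
    have h2 := (hasDerivAt_clm_apply h1
      (hasDerivAt_clm_apply (hasDerivAt_const v (angle m (D j))) (hasDerivAt_evol_apply H v φ))).sub
      ((hasDerivAt_id v).smul_const ((g : ℂ) • R φ))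
    refine h2.congr_deriv ?_
    have e1 := DFunLike.congr_fun hcomm (evol H v φ)
    have e2 := DFunLike.congr_fun (Commute.evol_right hRH v).eq φ
    have e3 := DFunLike.congr_fun (evol_neg_mul H v) (R φ)
    simp only [mul_apply_eq_comp, _root_.sub_apply, _root_.smul_apply, one_apply_eq_self] at e1 e2 e3
    rw [e2] at e1
    have e4 : angle m (D j) ((-Complex.I • H) (evol H v φ)) -
        (-Complex.I • H) (angle m (D j) (evol H v φ)) =
        ((g / 2 : ℝ) : ℂ) • ((2 : E →L[ℂ] E) (evol H v (R φ)) -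
          (D j ^ m + star (D j) ^ m) (evol H v (R φ))) := by
      have hs : ∀ ψ, (-Complex.I • H) ψ = -Complex.I • H ψ := fun _ => rfl
      rw [hs, hs, map_smul, ← smul_sub, e1, smul_smul]
      congr 1
      linear_combination (-((g / 2 : ℝ) : ℂ)) * Complex.I_mul_I
    have e5 : (2 : E →L[ℂ] E) (evol H v (R φ)) = (2 : ℂ) • evol H v (R φ) := by
      have : (2 : E →L[ℂ] E) = (2 : ℂ) • 1 := by
        rw [two_smul]
        norm_num
      rw [this]
      rfl
    simp only [_root_.neg_apply, mul_apply_eq_comp, _root_.zero_apply, zero_add, one_smul]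
    rw [neg_add_eq_sub, ← map_sub, e4, e5, hf']
    simp only
    rw [smul_sub, smul_smul, map_sub, map_smul, e3, neg_smul, map_neg]
    have : (((g / 2 : ℝ) : ℂ)) * 2 = (g : ℂ) := by push_cast; ring
    rw [this]
    abel
  set B' := (∑ i ∈ Finset.range (m + 1 + 1), C i) * g ^ ((j + 1) * (m + 1)) * B with hB'
  have hbound : ∀ v ∈ Set.Icc (0:ℝ) 1, ‖f' v‖ ≤ growth 6 m * B' := by
    intro v hv
    have hw : WordBound (letters (D j) (t j)) m (growth 6 m * B')
        (evol H v (((g : ℂ) • R) φ)) := by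
      refine h.wordBound_evol hM hj (by positivity) (fun a l hal => ?_) hv.1 hv.2
      have := wordBound_chain_pow (k := m + 1) hC h hg hj
        (hpow E S M g Y D t J h hM hg hj.le) hB hφ (a + 1) l (by omega) (by omega)
      rw [pow_succ] at this
      exact this
    have hm : ModeIn (letters (D j) (t j)) M (D j) (t j) := ModeIn.self (h.mode j hj).toIsMode
    have hE := (hm.hasOrder_D.pow m).add (hm.hasOrder_star_D.pow m)
    rw [mul_one] at hE
    have h1 := hE.norm_apply_le hw (by positivity)
    simp only [one_pow] at h1
    rw [hf']
    simp only
    rw [norm_evol_apply hG, norm_smul]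
    rw [_root_.smul_apply, map_smul, map_smul, norm_smul] at h1
    have e1 : ‖-(((g / 2 : ℝ) : ℂ))‖ = ‖(g : ℂ)‖ / 2 := by
      rw [norm_neg, Complex.norm_real, Complex.norm_real, Real.norm_eq_abs, Real.norm_eq_abs,
        abs_div, abs_two]
    rw [e1]
    linarith
  have := WordBound.of_hasDerivAt (S := S) (k := 0) zero_le_one le_rfl (by positivity)
    (fun v _ => hder v) hbound
  simp only [WordBound] at this
  have hfin : f 1 - f 0 = (chain M g m Y D t (j + 1) - angle m (D j) - (g : ℂ) • R) φ := by
    simp only [hf, neg_zero, evol_zero, one_smul, zero_smul, one_apply_eq_self, chain, ← hR,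
      ← hHdef, _root_.sub_apply, mul_apply_eq_comp, _root_.smul_apply]
    abel
  rw [hfin] at this
  refine this.trans (le_of_eq (by rw [hB']; ring))

end Chains

/-! ### Linearized chains, propagation of smallness, and comparison of evolutions. -/

section Linear

variable {E : Type} [NormedAddCommGroup E] [InnerProductSpace ℂ E] [CompleteSpace E]

/-- The linear approximation of the amplified angle. -/
theorem exists_norm_chain_sub_chainLin_le (m : ℕ) (c : ℝ) (j : ℕ) : ∃ C : ℝ, 0 ≤ C ∧
    ∀ (E : Type) [NormedAddCommGroup E] [InnerProductSpace ℂ E] [CompleteSpace E]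
      (S : Set (E →L[ℂ] E)) (M g : ℝ) (Y : E →L[ℂ] E) (D t : ℕ → E →L[ℂ] E) (J : ℕ),
      IsChain S M c Y D t J → 0 < M → 1 ≤ g → j ≤ J → ∀ B φ, 0 ≤ B → WordBound S (m + 1) B φ →
        ‖(chain M g m Y D t j - chainLin g m Y D j) φ‖ ≤ C * g ^ (j * (m + 1)) * B := by
  induction j with
  | zero =>
    refine ⟨0, le_rfl, ?_⟩
    intro E _ _ _ S M g Y D t J h hM hg _ B φ hB hφ
    simp [chain, chainLin]
  | succ j ih =>
    obtain ⟨C, hC, ih⟩ := ih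
    obtain ⟨C', hC', hs⟩ := exists_norm_chain_succ_sub_le m c j
    refine ⟨C' + C, by positivity, ?_⟩
    intro E _ _ _ S M g Y D t J h hM hg hj B φ hB hφ
    have h1 := ih E S M g Y D t J h hM hg (by omega) B φ hB hφ
    have h2 := hs E S M g Y D t J h hM hg hj B φ hB hφ
    have hg0 : 0 ≤ g := zero_le_one.trans hg
    have e : chain M g m Y D t (j + 1) - chainLin g m Y D (j + 1) =
        (chain M g m Y D t (j + 1) - angle m (D j) - (g : ℂ) • chain M g m Y D t j) +
          (g : ℂ) • (chain M g m Y D t j - chainLin g m Y D j) := by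
      rw [chainLin, smul_sub]
      abel
    rw [e, _root_.add_apply, _root_.smul_apply]
    refine (norm_add_le _ _).trans ?_
    rw [norm_smul, Complex.norm_real, Real.norm_of_nonneg hg0]
    have h3 : g * g ^ (j * (m + 1)) ≤ g ^ ((j + 1) * (m + 1)) := by
      rw [← pow_succ']
      refine pow_le_pow_right₀ hg ?_
      nlinarith
    calc _ ≤ C' * g ^ ((j + 1) * (m + 1)) * B + g * (C * g ^ (j * (m + 1)) * B) := by gcongr
      _ = C' * g ^ ((j + 1) * (m + 1)) * B + C * (g * g ^ (j * (m + 1))) * B := by ring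
      _ ≤ C' * g ^ ((j + 1) * (m + 1)) * B + C * g ^ ((j + 1) * (m + 1)) * B := by gcongr
      _ = _ := by ring

/-- The linear chain is a sum of the base and `j` angles with weights at most `g ^ j`, and each of
these has commutators of order `0` and size `1 / M` with the letters. -/
lemma IsChain.hasOrder_comm_chainLin {S : Set (E →L[ℂ] E)} {M c g : ℝ} {m J : ℕ} {Y : E →L[ℂ] E}
    {D t : ℕ → E →L[ℂ] E} (h : IsChain S M c Y D t J) (hM : 0 < M) (hg : 1 ≤ g) {j : ℕ}
    (hj : j ≤ J) : ∀ x ∈ S, HasOrder S 0 ((c + j * ModeIn.angleConst m) * g ^ j / M)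
      (x * chainLin g m Y D j - chainLin g m Y D j * x) := by
  have hg0 : 0 ≤ g := zero_le_one.trans hg
  induction j with
  | zero => simpa [chainLin] using h.base_comm
  | succ j ih =>
    intro x hx
    have e : x * chainLin g m Y D (j + 1) - chainLin g m Y D (j + 1) * x =
        (x * angle m (D j) - angle m (D j) * x) +
          (g : ℂ) • (x * chainLin g m Y D j - chainLin g m Y D j * x) := by
      rw [chainLin, smul_sub, mul_add, add_mul, mul_smul_comm, smul_mul_assoc]
      abel
    rw [e]
    refine (((h.mode j hj).hasOrder_comm_angle hM h.norm_le m x hx).add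
      ((ih (by omega) x hx).smul _)).mono ?_
    rw [Complex.norm_real, Real.norm_of_nonneg hg0]
    have h1 : ModeIn.angleConst m / M ≤ ModeIn.angleConst m * g ^ (j + 1) / M := by
      have := ModeIn.angleConst_nonneg m
      have := one_le_pow₀ (n := j + 1) hg
      gcongr
      nlinarith
    refine (add_le_add_left h1 _).trans (le_of_eq ?_)
    push_cast
    ring

/-- States with few excitations. -/
def IsSmall (S : Set (E →L[ℂ] E)) (η : ℝ) (C : ℕ → ℝ) (φ : E) : Prop :=
  ∀ k, WordBound S k (C k * η ^ k) φ

/-- The constants of `IsSmall` after an evolution. -/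
noncomputable def evolConst (b : ℝ) (C : ℕ → ℝ) (k : ℕ) : ℝ :=
  growth b k * ∑ l ∈ Finset.range (k + 1), C l

lemma evolConst_nonneg {b : ℝ} (hb : 0 ≤ b) {C : ℕ → ℝ} (hC : ∀ k, 0 ≤ C k) (k : ℕ) :
    0 ≤ evolConst b C k :=
  mul_nonneg (zero_le_one.trans (one_le_growth hb k)) (Finset.sum_nonneg fun i _ => hC i)

/-- The case `Γ = η` of `WordBound.evol`: a letter lost in a commutator with `H` is replaced by the
scalar `b * η`, which is as small as a letter. -/
lemma IsSmall.evol {S : Set (E →L[ℂ] E)} {η b : ℝ} {C : ℕ → ℝ} {φ : E} {H : E →L[ℂ] E}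
    (h : IsSmall S η C φ) (hC : ∀ k, 0 ≤ C k) (hb : 0 ≤ b) (hη : 0 < η) (hH : IsSelfAdjoint H)
    (hS : ∀ x ∈ S, HasOrder S 0 (b * η) (x * H - H * x)) {s : ℝ} (hs : 0 ≤ s) (hs1 : s ≤ 1) :
    IsSmall S η (evolConst b C) (evol H s φ) := by
  intro k
  have hη' : (η : ℂ) ≠ 0 := by exact_mod_cast hη.ne'
  have hn : ‖(η : ℂ)‖ = η := by rw [Complex.norm_real, Real.norm_of_nonneg hη.le]
  have hsum := Finset.sum_nonneg (s := Finset.range (k + 1)) fun i _ => hC i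
  have := WordBound.evol (S := S) (H := H) (Γ := (η : ℂ) • 1)
    (T := fun x => ((η : ℂ)⁻¹) • (x * H - H * x)) hb hH
    ((Commute.one_left _).smul_left _) (fun x _ => (Commute.one_left _).smul_left _) ?_ ?_
    (fun x _ => (Commute.one_left _).smul_left _) k
    (B := (∑ l ∈ Finset.range (k + 1), C l) * η ^ k) (φ := φ) (by positivity) ?_ hs hs1
  · rwa [← mul_assoc] at this
  · intro x _
    rw [mul_smul_comm, mul_one, smul_smul, mul_inv_cancel₀ hη', one_smul]
  · intro x hx
    refine ((hS x hx).smul _).mono (le_of_eq ?_)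
    rw [norm_inv, hn]
    field_simp
  · intro a l hal
    rw [smul_pow, one_pow, _root_.smul_apply, one_apply_eq_self]
    refine ((h l).smul _).mono ?_
    rw [norm_pow, hn, ← hal, pow_add]
    have : C l ≤ ∑ i ∈ Finset.range (k + 1), C i :=
      Finset.single_le_sum (fun i _ => hC i) (Finset.mem_range.2 (by omega))
    rw [hal]
    calc η ^ a * (C l * η ^ l) = C l * (η ^ a * η ^ l) := by ring
      _ ≤ _ := by gcongr

/-- Comparison of two evolutions. -/
lemma norm_evol_sub_evol_le {A B : E →L[ℂ] E} (hA : IsSelfAdjoint A) {ψ : E} {C : ℝ} (hC : 0 ≤ C)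
    (h : ∀ v ∈ Set.Icc (0 : ℝ) 1, ‖(A - B) (evol B v ψ)‖ ≤ C) :
    ‖evol B 1 ψ - evol A 1 ψ‖ ≤ C := by
  -- Duhamel's formula tests `A - B` on the evolution by `B` alone. With `B` the linearized
  -- generator, smallness is never needed along the exact evolution.
  have hder : ∀ v : ℝ, HasDerivAt (fun v => evol A (1 - v) (evol B v ψ))
      (evol A (1 - v) (Complex.I • (A - B) (evol B v ψ))) v := by
    intro v
    refine (hasDerivAt_clm_apply (hasDerivAt_evol_sub A 1 v)
      (hasDerivAt_evol_apply B v ψ)).congr_deriv ?_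
    simp only [_root_.neg_apply, mul_apply_eq_comp, _root_.smul_apply, _root_.sub_apply, neg_smul,
      map_neg, smul_sub, map_sub, neg_neg]
    abel
  have := WordBound.of_hasDerivAt (S := ∅) (k := 0) zero_le_one le_rfl hC
    (fun v _ => hder v) (fun v hv => by
      simp only [WordBound]
      rw [norm_evol_apply hA, norm_smul, Complex.norm_I, one_mul]
      exact h v hv)
  simpa [WordBound, evol_zero] using this

/-- The commutator of an operator and an evolution. -/
lemma norm_comm_evol_sub_le {A B Θ : E →L[ℂ] E} (hB : IsSelfAdjoint B) (hΘB : Commute Θ B) {χ : E}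
    {C : ℝ} (hC : 0 ≤ C)
    (h : ∀ v ∈ Set.Icc (0 : ℝ) 1, ‖(A * B - B * A - Complex.I • Θ) (evol B v χ)‖ ≤ C) :
    ‖A (evol B 1 χ) - evol B 1 (A χ) - Θ (evol B 1 χ)‖ ≤ C := by
  have hder : ∀ v : ℝ, HasDerivAt
      (fun v => evol B (1 - v) (A (evol B v χ)) - v • Θ (evol B 1 χ))
      (evol B (1 - v) (-Complex.I • (A * B - B * A - Complex.I • Θ) (evol B v χ))) v := by
    intro v
    refine ((hasDerivAt_clm_apply (hasDerivAt_evol_sub B 1 v)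
      (hasDerivAt_clm_apply (hasDerivAt_const v A) (hasDerivAt_evol_apply B v χ))).sub
      ((hasDerivAt_id v).smul_const (Θ (evol B 1 χ)))).congr_deriv ?_
    have e : evol B (1 - v) (Θ (evol B v χ)) = Θ (evol B 1 χ) := by
      have e1 := DFunLike.congr_fun (Commute.evol_right hΘB (1 - v)).eq (evol B v χ)
      simp only [mul_apply_eq_comp] at e1
      rw [← e1, ← mul_apply_eq_comp (evol B (1 - v)), ← evol_add, sub_add_cancel]
    have hI : ∀ ξ : E, Complex.I • Complex.I • ξ = -ξ := fun ξ => by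
      rw [smul_smul, Complex.I_mul_I, neg_one_smul]
    simp only [_root_.neg_apply, mul_apply_eq_comp, _root_.smul_apply, _root_.sub_apply, neg_smul,
      map_neg, smul_sub, map_sub, neg_neg, map_smul, _root_.zero_apply, zero_add, one_smul, e, hI]
    abel
  have := WordBound.of_hasDerivAt (S := ∅) (k := 0) zero_le_one le_rfl hC
    (fun v _ => hder v) (fun v hv => by
      simp only [WordBound]
      rw [norm_evol_apply hB, norm_smul, norm_neg, Complex.norm_I, one_mul]
      exact h v hv)
  simp only [WordBound, sub_self, sub_zero, evol_zero, one_apply_eq_self, one_smul, zero_smul] at this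
  convert this using 2
  abel

/-- The group commutator of two evolutions whose generators have an almost central commutator. -/
lemma norm_groupCommutator_sub_le {A B Θ : E →L[ℂ] E} (hA : IsSelfAdjoint A) (hB : IsSelfAdjoint B)
    (hΘ : IsSelfAdjoint Θ) (hΘA : Commute Θ A) (hΘB : Commute Θ B) {ψ : E} {C : ℝ} (hC : 0 ≤ C)
    (h : ∀ s ∈ Set.Icc (0 : ℝ) 1, ∀ v ∈ Set.Icc (0 : ℝ) 1,
      ‖(A * B - B * A - Complex.I • Θ) (evol B v (evol A (-s) ψ))‖ ≤ C) :
    ‖evol A 1 (evol B 1 (evol A (-1) ψ)) - evol Θ 1 (evol B 1 ψ)‖ ≤ C := by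
  -- If `[A, B] = i Θ` with `Θ` central, then `e^{-isA} e^{-iB} e^{isA} = e^{-isΘ} e^{-iB}`, and the
  -- interpolation below is constant. In general its derivative is the defect estimated in
  -- `norm_comm_evol_sub_le`.
  have hder : ∀ s : ℝ, HasDerivAt
      (fun s => evol Θ (1 - s) (evol A s (evol B 1 (evol A (0 - s) ψ))))
      (evol Θ (1 - s) (evol A s (-Complex.I • (A (evol B 1 (evol A (-s) ψ)) -
        evol B 1 (A (evol A (-s) ψ)) - Θ (evol B 1 (evol A (-s) ψ)))))) s := by
    intro s
    refine (hasDerivAt_clm_apply (hasDerivAt_evol_sub Θ 1 s)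
      (hasDerivAt_clm_apply (hasDerivAt_evol A s)
        (hasDerivAt_clm_apply (hasDerivAt_const s (evol B 1))
          (hasDerivAt_clm_apply (hasDerivAt_evol_sub A 0 s) (hasDerivAt_const s ψ))))).congr_deriv ?_
    have e1 : ∀ ξ, Θ (evol A s ξ) = evol A s (Θ ξ) := fun ξ =>
      DFunLike.congr_fun (Commute.evol_right hΘA s).eq ξ
    have e2 : ∀ ξ, evol A (-s) (A ξ) = A (evol A (-s) ξ) := fun ξ =>
      (DFunLike.congr_fun (Commute.evol_right (Commute.refl A) (-s)).eq ξ).symm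
    simp only [_root_.neg_apply, mul_apply_eq_comp, _root_.smul_apply, neg_smul, zero_sub,
      map_neg, smul_sub, map_sub, neg_neg, map_smul, _root_.zero_apply, zero_add, map_zero, add_zero,
      e1, e2, map_add]
    abel
  have := WordBound.of_hasDerivAt (S := ∅) (k := 0) zero_le_one le_rfl hC
    (fun v _ => hder v) (fun s hs => by
      simp only [WordBound]
      rw [norm_evol_apply hΘ, norm_evol_apply hA, norm_smul, norm_neg, Complex.norm_I, one_mul]
      exact norm_comm_evol_sub_le hB hΘB hC (h s hs))
  simpa [WordBound, evol_zero] using this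

end Linear

/-! ### The vacuum of the modes has few excitations. -/

section Vacuum

variable {E : Type} [NormedAddCommGroup E] [InnerProductSpace ℂ E]

lemma WordBound.prod_apply {S : Set (E →L[ℂ] E)} {B : ℝ} {φ : E} (w : List (E →L[ℂ] E))
    (hw : ∀ x ∈ w, x ∈ S) (j : ℕ) (h : WordBound S (j + w.length) B φ) :
    WordBound S j B (w.prod φ) := by
  induction w generalizing j with
  | nil => simpa using h
  | cons x w ih =>
    rw [List.prod_cons]
    refine ih (fun y hy => hw y (List.mem_cons_of_mem x hy)) (j + 1) ?_ x
      (hw x List.mem_cons_self)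
    rw [List.length_cons] at h
    rwa [add_assoc, add_comm 1]

lemma WordBound.of_prod {S : Set (E →L[ℂ] E)} {B : ℝ} {k : ℕ} {φ : E}
    (h : ∀ w : List (E →L[ℂ] E), (∀ x ∈ w, x ∈ S) → w.length = k → ‖w.prod φ‖ ≤ B) :
    WordBound S k B φ := by
  induction k generalizing φ with
  | zero => simpa [WordBound] using h [] (by simp) rfl
  | succ k ih =>
    intro x hx
    refine ih fun w hw hl => ?_
    have := h (w ++ [x]) (fun y hy => ?_) (by simp [hl])
    · simpa using this
    · rcases List.mem_append.1 hy with hy | hy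
      · exact hw y hy
      · rwa [List.mem_singleton.1 hy]

/-- An operator annihilating `φ` is small on words applied to `φ`. -/
lemma WordBound.annihilator {S : Set (E →L[ℂ] E)} {T : E →L[ℂ] E} {b q : ℝ} {φ : E} {n : ℕ}
    (hq : 0 ≤ q) (hTφ : T φ = 0) (hT : ∀ x ∈ S, HasOrder S 0 b (T * x - x * T))
    (hφ : WordBound S n q φ) (w : List (E →L[ℂ] E)) (hw : ∀ x ∈ w, x ∈ S) (j : ℕ)
    (hj : j + w.length = n + 1) : WordBound S j (w.length * b * q) (T (w.prod φ)) := by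
  induction w generalizing j with
  | nil =>
    simp only [List.prod_nil, one_apply_eq_self, hTφ]
    exact WordBound.zero_vec j (by simp)
  | cons x w ih =>
    have hx := hw x List.mem_cons_self
    have hw' : ∀ y ∈ w, y ∈ S := fun y hy => hw y (List.mem_cons_of_mem x hy)
    rw [List.length_cons] at hj
    have h1 := ih hw' (j + 1) (by omega) x hx
    have h2 : WordBound S j q (w.prod φ) :=
      WordBound.prod_apply w hw' j (by rwa [show j + w.length = n by omega])
    have h3 := h1.add ((hT x hx).2 j q _ hq h2)
    have e : x (T (w.prod φ)) + (T * x - x * T) (w.prod φ) = T ((x :: w).prod φ) := by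
      simp [List.prod_cons]
    rw [e] at h3
    refine h3.mono (le_of_eq ?_)
    rw [List.length_cons]
    push_cast
    ring

variable [CompleteSpace E]

/-- A family of `n` commuting modes. -/
structure ModeFamily (n : ℕ) (M : ℝ) (D t : ℕ → E →L[ℂ] E) : Prop where
  mode : ∀ i < n, IsMode M (D i) (t i)
  commute : ∀ i < n, ∀ j < n, i ≠ j → ∀ x ∈ letters (D i) (t i), ∀ y ∈ letters (D j) (t j),
    Commute x y

/-- The letters of a family of modes. -/
def allLetters (n : ℕ) (D t : ℕ → E →L[ℂ] E) : Set (E →L[ℂ] E) :=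
  {x | ∃ i < n, x ∈ letters (D i) (t i)}

/-- The state without excitations. -/
structure IsVacuum (n : ℕ) (D t : ℕ → E →L[ℂ] E) (φ : E) : Prop where
  norm_le : ‖φ‖ ≤ 1
  apply_D : ∀ i < n, D i φ = -t i φ
  apply_star_D : ∀ i < n, star (D i) φ = t i φ

variable {n : ℕ} {M : ℝ} {D t : ℕ → E →L[ℂ] E}

lemma ModeFamily.norm_le (h : ModeFamily n M D t) : ∀ x ∈ allLetters n D t, ‖x‖ ≤ 3 := by
  rintro x ⟨i, hi, hx⟩
  exact (h.mode i hi).norm_letters x hx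

lemma ModeFamily.modeIn (h : ModeFamily n M D t) {i : ℕ} (hi : i < n) :
    ModeIn (allLetters n D t) M (D i) (t i) := by
  refine ⟨h.mode i hi, fun x hx => ⟨i, hi, hx⟩, ?_⟩
  rintro x ⟨j, hj, hx⟩
  by_cases hij : j = i
  · exact Or.inl (hij ▸ hx)
  · exact Or.inr fun y hy => h.commute j hj i hi hij x hx y hy

/-- The bound on `t` in terms of the annihilator `D - D† + 2 t`. -/
lemma IsMode.norm_t_apply_le {M : ℝ} {D t : E →L[ℂ] E} (h : IsMode M D t) (hM : 0 < M) (ψ : E) :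
    ‖t ψ‖ ≤ ‖(D - star D + (2 : ℂ) • t) ψ‖ / 2 + 2 * (√M)⁻¹ * ‖ψ‖ := by
  -- For a collective spin `N = -2i (σˣ + i σʸ)`, which annihilates the fully polarized state. Since
  -- `4 t = N + star N` and `[N, star N]` is of order `1 / M`, a bound on `N ψ` gives one on `star N
  -- ψ` and on `t ψ`.
  set N := D - star D + (2 : ℂ) • t with hN
  have hNs : star N = star D - D + (2 : ℂ) • t := by
    rw [hN, star_add, star_sub, star_star, star_smul, h.star_t]
    simp
  have hcomm : N * star N - star N * N = (8 / M : ℂ) • (2 - D - star D) := by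
    have e : N * star N - star N * N =
        (4 : ℂ) • ((t * star D - star D * t) - (t * D - D * t)) := by
      rw [hNs, hN]
      have four : ∀ x : E →L[ℂ] E, (4 : ℂ) • x = x + x + x + x := fun x => by
        rw [show (4 : ℂ) = 1 + 1 + 1 + 1 by norm_num, add_smul, add_smul, add_smul, one_smul]
      rw [four, two_smul]
      noncomm_ring
    rw [e, h.comm_t_star, h.comm_t_D, neg_smul, sub_neg_eq_add, ← smul_add, smul_smul]
    have : (2 : E →L[ℂ] E) = 1 + 1 := by norm_num
    rw [this]
    congr 1
    · ring
    · abel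
  have hn1 : ‖(1 : E →L[ℂ] E)‖ ≤ 1 := ContinuousLinearMap.norm_id_le
  have hcn : ‖N * star N - star N * N‖ ≤ 64 / M := by
    rw [hcomm, norm_smul, norm_div, Complex.norm_real, Real.norm_of_nonneg hM.le,
      Complex.norm_ofNat]
    have h2 : ‖2 - D - star D‖ ≤ 8 := by
      have e : (2 : E →L[ℂ] E) = 1 + 1 := by norm_num
      have h3 := norm_sub_le (2 - D) (star D)
      have h4 := norm_sub_le 2 D
      have h5 := norm_add_le (1 : E →L[ℂ] E) 1
      rw [← e] at h5
      rw [norm_star] at h3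
      linarith [h.norm_D]
    calc 8 / M * ‖2 - D - star D‖ ≤ 8 / M * 8 := by gcongr
      _ = 64 / M := by ring
  have h1 : ‖star N ψ‖ ^ 2 ≤ ‖N ψ‖ ^ 2 + 64 / M * ‖ψ‖ ^ 2 := by
    have a1 := ContinuousLinearMap.apply_norm_sq_eq_inner_adjoint_left (star N) ψ
    have a2 := ContinuousLinearMap.apply_norm_sq_eq_inner_adjoint_left N ψ
    have e1 : ContinuousLinearMap.adjoint (star N) ∘L star N = N * star N := by
      rw [ContinuousLinearMap.star_eq_adjoint, ContinuousLinearMap.adjoint_adjoint]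
      rfl
    have e2 : ContinuousLinearMap.adjoint N ∘L N = star N * N := rfl
    rw [e1] at a1
    rw [e2] at a2
    have e3 : N * star N = (N * star N - star N * N) + star N * N := by abel
    rw [e3, _root_.add_apply, inner_add_left, map_add, ← a2] at a1
    have a3 : RCLike.re (inner ℂ ((N * star N - star N * N) ψ) ψ) ≤ 64 / M * ‖ψ‖ ^ 2 := by
      refine (RCLike.re_le_norm _).trans ((norm_inner_le_norm _ _).trans ?_)
      have := (N * star N - star N * N).le_of_opNorm_le hcn ψ
      calc _ ≤ 64 / M * ‖ψ‖ * ‖ψ‖ := by gcongr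
        _ = _ := by ring
    linarith
  have h2 : ‖star N ψ‖ ≤ ‖N ψ‖ + 8 * (√M)⁻¹ * ‖ψ‖ := by
    refine abs_le_of_sq_le_sq' ?_ (by positivity) |>.2
    have e : (8 * (√M)⁻¹ * ‖ψ‖) ^ 2 = 64 / M * ‖ψ‖ ^ 2 := by
      rw [mul_pow, mul_pow, inv_pow, Real.sq_sqrt hM.le]
      ring
    have : 0 ≤ ‖N ψ‖ * (8 * (√M)⁻¹ * ‖ψ‖) := by positivity
    nlinarith
  have h3 : (4 : ℂ) • t ψ = N ψ + star N ψ := by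
    rw [← _root_.add_apply, hNs, hN]
    have : D - star D + (2 : ℂ) • t + (star D - D + (2 : ℂ) • t) = (4 : ℂ) • t := by
      have : (4 : ℂ) • t = (2 : ℂ) • t + (2 : ℂ) • t := by
        rw [← add_smul]
        norm_num
      rw [this]
      abel
    rw [this]
    rfl
  have h4 := norm_add_le (N ψ) (star N ψ)
  rw [← h3, norm_smul, Complex.norm_ofNat] at h4
  linarith

/-- The constants for the vacuum. -/
noncomputable def vacuumConst : ℕ → ℝ
  | 0 => 1
  | 1 => 2
  | k + 2 => 48 * (k + 1) * vacuumConst k + 2 * vacuumConst (k + 1)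

lemma vacuumConst_nonneg (k : ℕ) : 0 ≤ vacuumConst k := by
  induction k using Nat.strong_induction_on with
  | _ k ih =>
  match k, ih with
  | 0, _ => exact zero_le_one
  | 1, _ => exact zero_le_two
  | k + 2, ih =>
    have := ih k (by omega)
    have := ih (k + 1) (by omega)
    rw [vacuumConst]
    positivity

/-- The vacuum has few excitations. -/
theorem IsVacuum.isSmall {φ : E} (h : ModeFamily n M D t) (hM : 0 < M) (hφ : IsVacuum n D t φ) :
    IsSmall (allLetters n D t) (√M)⁻¹ vacuumConst φ := by
  set S := allLetters n D t with hS
  set η := (√M)⁻¹ with hη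
  have hη2 : η ^ 2 = 1 / M := by rw [hη, inv_pow, Real.sq_sqrt hM.le, one_div]
  have hη0 : 0 < η := by positivity
  -- the bound for one more letter
  have key : ∀ i < n, ∀ (ψ : E) (a : ℝ), 0 ≤ a → ‖(D i + t i) ψ‖ ≤ a → ‖(star (D i) - t i) ψ‖ ≤ a →
      ∀ x ∈ letters (D i) (t i), ‖x ψ‖ ≤ 2 * a + 2 * η * ‖ψ‖ := by
    intro i hi ψ a ha h1 h2 x hx
    have ht := (h.mode i hi).norm_t_apply_le hM ψ
    have e : (D i - star (D i) + (2 : ℂ) • t i) ψ = (D i + t i) ψ - (star (D i) - t i) ψ := by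
      rw [← _root_.sub_apply, two_smul]
      congr 1
      abel
    rw [e] at ht
    have h3 := norm_sub_le ((D i + t i) ψ) ((star (D i) - t i) ψ)
    have ht' : ‖t i ψ‖ ≤ a + 2 * η * ‖ψ‖ := by linarith
    rcases hx with rfl | rfl | rfl
    · have e2 : D i ψ = (D i + t i) ψ - t i ψ := by simp
      rw [e2]
      have := norm_sub_le ((D i + t i) ψ) (t i ψ)
      linarith
    · have e2 : star (D i) ψ = (star (D i) - t i) ψ + t i ψ := by simp
      rw [e2]
      have := norm_add_le ((star (D i) - t i) ψ) (t i ψ)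
      linarith
    · linarith
  have hann1 : ∀ i < n, (D i + t i) φ = 0 := fun i hi => by simp [hφ.apply_D i hi]
  have hann2 : ∀ i < n, (star (D i) - t i) φ = 0 := fun i hi => by
    simp [hφ.apply_star_D i hi]
  have hc1 : ∀ i < n, ∀ x ∈ S, HasOrder S 0 (24 / M) ((D i + t i) * x - x * (D i + t i)) := by
    intro i hi x hx
    have a := (h.modeIn hi).hasOrder_comm hM h.norm_le x hx
    have e : (D i + t i) * x - x * (D i + t i) =
        -((x * D i - D i * x) + (x * t i - t i * x)) := by noncomm_ring
    rw [e]
    refine (((a _ (Or.inl rfl)).add (a _ (Or.inr (Or.inr rfl)))).neg).mono (le_of_eq (by ring))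
  have hc2 : ∀ i < n, ∀ x ∈ S,
      HasOrder S 0 (24 / M) ((star (D i) - t i) * x - x * (star (D i) - t i)) := by
    intro i hi x hx
    have a := (h.modeIn hi).hasOrder_comm hM h.norm_le x hx
    have e : (star (D i) - t i) * x - x * (star (D i) - t i) =
        -((x * star (D i) - star (D i) * x) - (x * t i - t i * x)) := by noncomm_ring
    rw [e]
    refine (((a _ (Or.inr (Or.inl rfl))).sub (a _ (Or.inr (Or.inr rfl)))).neg).mono
      (le_of_eq (by ring))
  intro k
  induction k using Nat.strong_induction_on with
  | _ k ih =>
  match k, ih with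
  | 0, _ => simpa [WordBound, vacuumConst] using hφ.norm_le
  | 1, _ =>
    rintro x ⟨i, hi, hx⟩
    have := key i hi φ 0 le_rfl (by rw [hann1 i hi, norm_zero]) (by rw [hann2 i hi, norm_zero]) x hx
    simp only [WordBound, vacuumConst, pow_one]
    have := hφ.norm_le
    nlinarith
  | k + 2, ih =>
    refine WordBound.of_prod fun w hw hl => ?_
    -- The outermost letter `x` is controlled by the two annihilators of its mode and by `2 η` times
    -- the rest `w`. Moving an annihilator through `w` to the vacuum yields `k + 1` commutators of
    -- size `24 / M = 24 η ^ 2`, each of which leaves a word of length `k`. This is the recursion of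
    -- `vacuumConst`.
    obtain ⟨x, w, rfl⟩ := List.exists_cons_of_length_pos (l := w) (by omega)
    rw [List.length_cons] at hl
    obtain ⟨i, hi, hx⟩ := hw x List.mem_cons_self
    have hw' : ∀ y ∈ w, y ∈ S := fun y hy => hw y (List.mem_cons_of_mem x hy)
    have hC := vacuumConst_nonneg k
    have hC1 := vacuumConst_nonneg (k + 1)
    have a1 := WordBound.annihilator (by positivity) (hann1 i hi) (hc1 i hi) (ih k (by omega)) w hw'
      0 (by omega)
    have a2 := WordBound.annihilator (by positivity) (hann2 i hi) (hc2 i hi) (ih k (by omega)) w hw'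
      0 (by omega)
    have a3 := WordBound.prod_apply w hw' 0 (B := vacuumConst (k + 1) * η ^ (k + 1)) (φ := φ)
      (by rw [zero_add, show w.length = k + 1 by omega]; exact ih (k + 1) (by omega))
    simp only [WordBound] at a1 a2 a3
    have := key i hi (w.prod φ) _ (by positivity) a1 a2 x hx
    rw [List.prod_cons, mul_apply_eq_comp]
    refine this.trans ?_
    rw [show w.length = k + 1 by omega, vacuumConst]
    have e : (24 : ℝ) / M = 24 * η ^ 2 := by rw [hη2]; ring
    rw [e]
    have : 2 * η * ‖w.prod φ‖ ≤ 2 * η * (vacuumConst (k + 1) * η ^ (k + 1)) := by gcongr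
    refine (add_le_add_right this _).trans (le_of_eq ?_)
    push_cast
    ring

end Vacuum

/-! ### The controlled phase as a group commutator of amplified couplings. -/

section Gate

/-- Evolutions with an amplified angle and with its linear approximation. -/
theorem exists_evol_chain_error (m : ℕ) (c : ℝ) (J : ℕ) : ∃ C : ℝ, 0 ≤ C ∧
    ∀ (E : Type) [NormedAddCommGroup E] [InnerProductSpace ℂ E] [CompleteSpace E]
      (S : Set (E →L[ℂ] E)) (M g s : ℝ) (Y : E →L[ℂ] E) (D t : ℕ → E →L[ℂ] E) (Z : E →L[ℂ] E)
      (K : ℕ → ℝ) (ψ : E), IsChain S M c Y D t J → 0 < M → 1 ≤ g → |s| * g ^ J ≤ √M →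
      IsSelfAdjoint Z → ‖Z‖ ≤ 1 → (∀ x ∈ S, Commute Z x) → Commute Z Y →
      (∀ k, 0 ≤ K k) → IsSmall S (√M)⁻¹ K ψ →
      (∀ v ∈ Set.Icc (0 : ℝ) 1, IsSmall S (√M)⁻¹ (evolConst (c + J * ModeIn.angleConst m) K)
        (evol ((s : ℂ) • (Z * chainLin g m Y D J)) v ψ)) ∧
      ‖evol ((s : ℂ) • (Z * chainLin g m Y D J)) 1 ψ - evol ((s : ℂ) • (Z * chain M g m Y D t J)) 1 ψ‖
        ≤ C * evolConst (c + J * ModeIn.angleConst m) K (m + 1) *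
          (|s| * g ^ (J * (m + 1)) * (√M)⁻¹ ^ (m + 1)) := by
  obtain ⟨C, hC, herr⟩ := exists_norm_chain_sub_chainLin_le m c J
  refine ⟨C, hC, ?_⟩
  intro E _ _ _ S M g s Y D t Z K ψ h hM hg hs hZ hZ1 hZS hZY hK hψ
  have hg0 : 0 ≤ g := zero_le_one.trans hg
  have hη : 0 < (√M)⁻¹ := by positivity
  have hb : 0 ≤ c + J * ModeIn.angleConst m :=
    add_nonneg h.base_order.1 (mul_nonneg (Nat.cast_nonneg _) (ModeIn.angleConst_nonneg m))
  have hZm : ∀ i < J, ∀ x ∈ letters (D i) (t i), Commute Z x :=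
    fun i hi x hx => hZS x ((h.mode i hi).subset hx)
  have hZL : Commute Z (chainLin g m Y D J) := commute_chainLin hZY hZm
  have hZR : Commute Z (chain M g m Y D t J) := commute_chain hZY hZm
  have sa : ∀ {L : E →L[ℂ] E}, Commute Z L → IsSelfAdjoint L → IsSelfAdjoint ((s : ℂ) • (Z * L)) := by
    intro L hc hL
    rw [IsSelfAdjoint, star_smul, star_mul, hL.star_eq, hZ.star_eq, hc.eq]
    simp
  have hsL := sa hZL (h.isSelfAdjoint_lin (g := g) (m := m) le_rfl)
  have hsR := sa hZR (h.isSelfAdjoint (g := g) (m := m) le_rfl)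
  have hsmall : ∀ v ∈ Set.Icc (0 : ℝ) 1,
      IsSmall S (√M)⁻¹ (evolConst (c + J * ModeIn.angleConst m) K)
        (evol ((s : ℂ) • (Z * chainLin g m Y D J)) v ψ) := by
    intro v hv
    -- The commutators of the letters with the linear generator have size `|s| * g ^ J / M` up to a
    -- constant, and `|s| * g ^ J ≤ √M` turns this into `1 / √M`, the size of a letter.
    refine hψ.evol hK hb hη hsL (fun x hx => ?_) hv.1 hv.2
    have e : x * ((s : ℂ) • (Z * chainLin g m Y D J)) - ((s : ℂ) • (Z * chainLin g m Y D J)) * x =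
        (s : ℂ) • (Z * (x * chainLin g m Y D J - chainLin g m Y D J * x)) := by
      rw [mul_smul_comm, smul_mul_assoc, ← smul_sub, mul_sub, ← mul_assoc, ← mul_assoc, ← mul_assoc,
        (hZS x hx).eq]
    rw [e]
    refine (((HasOrder.of_commute hZS hZ1).mul
      (h.hasOrder_comm_chainLin hM hg le_rfl x hx)).smul _).mono ?_
    rw [Complex.norm_real, Real.norm_eq_abs]
    calc |s| * (1 * ((c + J * ModeIn.angleConst m) * g ^ J / M)) =
        (c + J * ModeIn.angleConst m) * (|s| * g ^ J / M) := by ring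
      _ ≤ (c + J * ModeIn.angleConst m) * (√M / M) := by gcongr
      _ = _ := by rw [Real.sqrt_div_self]
  refine ⟨hsmall, ?_⟩
  have hE := evolConst_nonneg hb hK (m + 1)
  refine norm_evol_sub_evol_le hsR (by positivity) fun v hv => ?_
  have h1 := herr E S M g Y D t J h hM hg le_rfl _ _ (by positivity) (hsmall v hv (m + 1))
  rw [← smul_sub, ← mul_sub, _root_.smul_apply, norm_smul, Complex.norm_real, Real.norm_eq_abs,
    mul_apply_eq_comp]
  have h2 := Z.le_of_opNorm_le hZ1 ((chain M g m Y D t J - chainLin g m Y D J)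
    (evol ((s : ℂ) • (Z * chainLin g m Y D J)) v ψ))
  rw [one_mul] at h2
  calc _ ≤ |s| * (C * g ^ (J * (m + 1)) *
        (evolConst (c + J * ModeIn.angleConst m) K (m + 1) * (√M)⁻¹ ^ (m + 1))) := by
        gcongr
        exact h2.trans h1
    _ = _ := by ring

variable {E : Type} [NormedAddCommGroup E] [InnerProductSpace ℂ E] [CompleteSpace E]

/-- Only the base, which enters with the weight `g ^ j`, can fail to commute with `A`. Applied to
both chains, this gives the factor `g ^ J` twice in their commutator. -/
lemma chainLin_comm {g : ℝ} {m : ℕ} {Y A : E →L[ℂ] E} {D t : ℕ → E →L[ℂ] E} {j : ℕ}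
    (h : ∀ i < j, ∀ x ∈ letters (D i) (t i), Commute A x) :
    A * chainLin g m Y D j - chainLin g m Y D j * A = ((g : ℂ) ^ j) • (A * Y - Y * A) := by
  induction j with
  | zero => simp [chainLin]
  | succ j ih =>
    have hl := h j (Nat.lt_succ_self j)
    have hc := Commute.angle_right (hl _ (Or.inl rfl)) (hl _ (Or.inr (Or.inl rfl))) m
    rw [chainLin, mul_add, add_mul, hc.eq, add_sub_add_left_eq_sub, mul_smul_comm, smul_mul_assoc,
      ← smul_sub, ih fun i hi => h i (by omega), smul_smul, pow_succ']

/-- The first chain of a family of `2 J + 1` modes: its base is the angle of mode `0`. -/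
noncomputable def chainA (M g : ℝ) (m J : ℕ) (D t : ℕ → E →L[ℂ] E) : E →L[ℂ] E :=
  chain M g m (angle m (D 0)) (fun j => D (1 + j)) (fun j => t (1 + j)) J

/-- The second chain of a family of `2 J + 1` modes: its base is the conjugate variable `t 0`. -/
noncomputable def chainB (M g : ℝ) (m J : ℕ) (D t : ℕ → E →L[ℂ] E) : E →L[ℂ] E :=
  chain M g m (t 0) (fun j => D (J + 1 + j)) (fun j => t (J + 1 + j)) J

/-- The base belongs to mode `0` and the amplifying modes are `a, …, a + J - 1`. With `a = 1` and `a
= J + 1` the two chains share mode `0` and nothing else. -/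
lemma ModeFamily.isChain {M : ℝ} {J a : ℕ} {D t : ℕ → E →L[ℂ] E} {Y : E →L[ℂ] E}
    (h : ModeFamily (2 * J + 1) M D t) (ha : 0 < a) (haJ : a ≤ J + 1) {c : ℝ} (hY : IsSelfAdjoint Y)
    (hYo : HasOrder (allLetters (2 * J + 1) D t) 1 c Y)
    (hYc : ∀ x ∈ allLetters (2 * J + 1) D t,
      HasOrder (allLetters (2 * J + 1) D t) 0 (c / M) (x * Y - Y * x))
    (hY0 : ∀ A, (∀ x ∈ letters (D 0) (t 0), Commute A x) → Commute A Y) :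
    IsChain (allLetters (2 * J + 1) D t) M c Y (fun j => D (a + j)) (fun j => t (a + j)) J where
  norm_le := h.norm_le
  base_sa := hY
  base_order := hYo
  base_comm := hYc
  mode j hj := h.modeIn (by omega)
  base_commute j hj x hx := (hY0 x fun y hy =>
    h.commute (a + j) (by omega) 0 (by omega) (by omega) x hx y hy).symm
  commute i hi j hj hij := h.commute _ (by omega) _ (by omega) (by omega)

lemma ModeFamily.isChain_angle {M : ℝ} {J : ℕ} {D t : ℕ → E →L[ℂ] E}
    (h : ModeFamily (2 * J + 1) M D t) (hM : 0 < M) (m : ℕ) :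
    IsChain (allLetters (2 * J + 1) D t) M (12 + ModeIn.angleConst m) (angle m (D 0))
      (fun j => D (1 + j)) (fun j => t (1 + j)) J := by
  have hac := ModeIn.angleConst_nonneg m
  have m0 := h.modeIn (show 0 < 2 * J + 1 by omega)
  exact h.isChain one_pos (by omega) (isSelfAdjoint_angle m _)
    ((m0.hasOrder_angle h.norm_le m).mono (by linarith)) (fun x hx =>
      (m0.hasOrder_comm_angle hM h.norm_le m x hx).mono (by gcongr; linarith))
    (fun A hx => Commute.angle_right (hx _ (Or.inl rfl)) (hx _ (Or.inr (Or.inl rfl))) m)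

lemma ModeFamily.isChain_conj {M : ℝ} {J : ℕ} {D t : ℕ → E →L[ℂ] E}
    (h : ModeFamily (2 * J + 1) M D t) (hM : 0 < M) (m : ℕ) :
    IsChain (allLetters (2 * J + 1) D t) M (12 + ModeIn.angleConst m) (t 0)
      (fun j => D (J + 1 + j)) (fun j => t (J + 1 + j)) J := by
  have hac := ModeIn.angleConst_nonneg m
  have m0 := h.modeIn (show 0 < 2 * J + 1 by omega)
  exact h.isChain (Nat.succ_pos J) le_rfl m0.star_t
    (m0.hasOrder_t.mono (by linarith)) (fun x hx =>
      (m0.hasOrder_comm hM h.norm_le x hx _ (Or.inr (Or.inr rfl))).mono (by gcongr; linarith))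
    (fun A hx => hx _ (Or.inr (Or.inr rfl)))

/-- The group commutator of the two amplified couplings is a controlled phase, up to a small error
on the vacuum of the modes. -/
theorem exists_gate_error (m J : ℕ) : ∃ C : ℝ, 0 ≤ C ∧
    ∀ (E : Type) [NormedAddCommGroup E] [InnerProductSpace ℂ E] [CompleteSpace E]
      (M g u : ℝ) (D t : ℕ → E →L[ℂ] E) (Z Z' : E →L[ℂ] E) (φ : E),
      ModeFamily (2 * J + 1) M D t → 0 < M → 1 ≤ g → 0 ≤ u → u * g ^ J ≤ √M →
      IsSelfAdjoint Z → ‖Z‖ ≤ 1 → (∀ x ∈ allLetters (2 * J + 1) D t, Commute Z x) →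
      IsSelfAdjoint Z' → ‖Z'‖ ≤ 1 → (∀ x ∈ allLetters (2 * J + 1) D t, Commute Z' x) →
      Commute Z Z' → IsVacuum (2 * J + 1) D t φ →
      ‖evol ((u : ℂ) • (Z * chainA M g m J D t)) 1 (evol ((u : ℂ) • (Z' * chainB M g m J D t)) 1
          (evol (((-u : ℝ) : ℂ) • (Z * chainA M g m J D t)) 1
            (evol (((-u : ℝ) : ℂ) • (Z' * chainB M g m J D t)) 1 φ))) -
        evol (((2 * (u * g ^ J) ^ 2 / M : ℝ) : ℂ) • (Z * Z')) 1 φ‖ ≤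
      C * (u * g ^ (J * (m + 1)) * (√M)⁻¹ ^ (m + 1) + (√M)⁻¹ ^ m) := by
  set c : ℝ := 12 + ModeIn.angleConst m with hc
  have hac := ModeIn.angleConst_nonneg m
  have hc0 : 0 ≤ c := by positivity
  obtain ⟨C, hC, herr⟩ := exists_evol_chain_error m c J
  set b := c + J * ModeIn.angleConst m with hbdef
  have hb : 0 ≤ b := by positivity
  -- Smallness constants after one, two, three and four linearized evolutions.
  set K1 := evolConst b vacuumConst with hK1def
  set K2 := evolConst b K1 with hK2def
  set K3 := evolConst b K2 with hK3def
  set K4 := evolConst b K3 with hK4def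
  have hK1 : ∀ k, 0 ≤ K1 k := evolConst_nonneg hb vacuumConst_nonneg
  have hK2 : ∀ k, 0 ≤ K2 k := evolConst_nonneg hb hK1
  have hK3 : ∀ k, 0 ≤ K3 k := evolConst_nonneg hb hK2
  have hK4 : ∀ k, 0 ≤ K4 k := evolConst_nonneg hb hK3
  refine ⟨C * (K1 (m + 1) + K2 (m + 1) + K3 (m + 1) + K4 (m + 1)) + 2 * K3 m, ?_, ?_⟩
  · have := hK1 (m + 1); have := hK2 (m + 1); have := hK3 (m + 1); have := hK4 (m + 1)
    have := hK3 m
    positivity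
  intro E _ _ _ M g u D t Z Z' φ h hM hg hu hug hZ hZ1 hZS hZ' hZ1' hZS' hZZ hφ
  have hg0 : 0 ≤ g := zero_le_one.trans hg
  have m0 := h.modeIn (show 0 < 2 * J + 1 by omega)
  have hA := h.isChain_angle hM m
  have hB := h.isChain_conj hM m
  have l0 : ∀ {x}, x ∈ letters (D 0) (t 0) → x ∈ allLetters (2 * J + 1) D t :=
    fun hx => ⟨0, by omega, hx⟩
  have cA : ∀ {A : E →L[ℂ] E}, (∀ x ∈ allLetters (2 * J + 1) D t, Commute A x) →
      Commute A (angle m (D 0)) := fun hx =>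
    Commute.angle_right (hx _ (l0 (Or.inl rfl))) (hx _ (l0 (Or.inr (Or.inl rfl)))) m
  have cB : ∀ {A : E →L[ℂ] E}, (∀ x ∈ allLetters (2 * J + 1) D t, Commute A x) →
      Commute A (t 0) := fun hx => hx _ (l0 (Or.inr (Or.inr rfl)))
  set L := chainLin g m (angle m (D 0)) (fun j => D (1 + j)) J with hL
  set L' := chainLin g m (t 0) (fun j => D (J + 1 + j)) J with hL'
  have lA : ∀ i < J, ∀ x ∈ letters (D (1 + i)) (t (1 + i)), x ∈ allLetters (2 * J + 1) D t :=
    fun i hi x hx => ⟨1 + i, by omega, hx⟩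
  have lB : ∀ i < J, ∀ x ∈ letters (D (J + 1 + i)) (t (J + 1 + i)),
      x ∈ allLetters (2 * J + 1) D t := fun i hi x hx => ⟨J + 1 + i, by omega, hx⟩
  have cL : ∀ {A : E →L[ℂ] E}, (∀ x ∈ allLetters (2 * J + 1) D t, Commute A x) → Commute A L :=
    fun hx => commute_chainLin (t := fun j => t (1 + j)) (cA hx)
      fun i hi y hy => hx y (lA i hi y hy)
  have cL' : ∀ {A : E →L[ℂ] E}, (∀ x ∈ allLetters (2 * J + 1) D t, Commute A x) → Commute A L' :=
    fun hx => commute_chainLin (t := fun j => t (J + 1 + j)) (cB hx)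
      fun i hi y hy => hx y (lB i hi y hy)
  have saL : IsSelfAdjoint L := hA.isSelfAdjoint_lin le_rfl
  have saL' : IsSelfAdjoint L' := hB.isSelfAdjoint_lin le_rfl
  -- the commutator of the linear approximations
  have hcommL : L * L' - L' * L =
      ((g : ℂ) ^ J * (g : ℂ) ^ J * (Complex.I / M)) • (2 - (D 0 ^ m + star (D 0) ^ m)) := by
    have e1 : L * L' - L' * L = ((g : ℂ) ^ J) • (L * t 0 - t 0 * L) := by
      refine chainLin_comm (t := fun j => t (J + 1 + j)) fun i hi x hx => ?_
      refine (commute_chainLin (t := fun j => t (1 + j)) (Commute.angle_right ?_ ?_ m)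
        fun k hk y hy => ?_).symm
      · exact h.commute (J + 1 + i) (by omega) 0 (by omega) (by omega) x hx _ (Or.inl rfl)
      · exact h.commute (J + 1 + i) (by omega) 0 (by omega) (by omega) x hx _ (Or.inr (Or.inl rfl))
      · exact h.commute (J + 1 + i) (by omega) (1 + k) (by omega) (by omega) x hx y hy
    have e2 : t 0 * L - L * t 0 = ((g : ℂ) ^ J) • (t 0 * angle m (D 0) - angle m (D 0) * t 0) := by
      refine chainLin_comm (t := fun j => t (1 + j)) fun i hi x hx => ?_
      exact h.commute 0 (by omega) (1 + i) (by omega) (by omega) _ (Or.inr (Or.inr rfl)) x hx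
    rw [e1, ← neg_sub, e2, m0.comm_t_angle, smul_smul, ← neg_smul, smul_smul]
    congr 1
    ring
  have neg1 : ∀ (H : E →L[ℂ] E) (s : ℝ), evol ((u : ℂ) • H) (-s) = evol (((-u : ℝ) : ℂ) • H) s := by
    intro H s
    rw [evol_smul, evol_smul]
    congr 1
    ring
  have abs1 : |u| * g ^ J ≤ √M := by rwa [abs_of_nonneg hu]
  have abs2 : |-u| * g ^ J ≤ √M := by rwa [abs_neg]
  set X := u * g ^ (J * (m + 1)) * (√M)⁻¹ ^ (m + 1) with hX
  -- one step for each of the factors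
  have stepA : ∀ (K : ℕ → ℝ), (∀ k, 0 ≤ K k) → ∀ s : ℝ, |s| = u → ∀ ψ,
      IsSmall (allLetters (2 * J + 1) D t) (√M)⁻¹ K ψ →
      (∀ v ∈ Set.Icc (0 : ℝ) 1, IsSmall (allLetters (2 * J + 1) D t) (√M)⁻¹ (evolConst b K)
        (evol ((s : ℂ) • (Z * L)) v ψ)) ∧
      ‖evol ((s : ℂ) • (Z * L)) 1 ψ - evol ((s : ℂ) • (Z * chainA M g m J D t)) 1 ψ‖
        ≤ C * evolConst b K (m + 1) * X := by
    intro K hK s hs ψ hψ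
    have := herr E _ M g s _ _ _ Z K ψ hA hM hg (by rwa [hs]) hZ hZ1 hZS (cA hZS) hK hψ
    rwa [hs] at this
  have stepB : ∀ (K : ℕ → ℝ), (∀ k, 0 ≤ K k) → ∀ s : ℝ, |s| = u → ∀ ψ,
      IsSmall (allLetters (2 * J + 1) D t) (√M)⁻¹ K ψ →
      (∀ v ∈ Set.Icc (0 : ℝ) 1, IsSmall (allLetters (2 * J + 1) D t) (√M)⁻¹ (evolConst b K)
        (evol ((s : ℂ) • (Z' * L')) v ψ)) ∧
      ‖evol ((s : ℂ) • (Z' * L')) 1 ψ - evol ((s : ℂ) • (Z' * chainB M g m J D t)) 1 ψ‖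
        ≤ C * evolConst b K (m + 1) * X := by
    intro K hK s hs ψ hψ
    have := herr E _ M g s _ _ _ Z' K ψ hB hM hg (by rwa [hs]) hZ' hZ1' hZS' (cB hZS') hK hψ
    rwa [hs] at this
  have au : |u| = u := abs_of_nonneg hu
  have anu : |-u| = u := by rw [abs_neg, au]
  have one_mem : (1 : ℝ) ∈ Set.Icc (0 : ℝ) 1 := ⟨zero_le_one, le_rfl⟩
  set x1 := evol (((-u : ℝ) : ℂ) • (Z' * L')) 1 φ with hx1
  set x2 := evol (((-u : ℝ) : ℂ) • (Z * L)) 1 x1 with hx2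
  set x3 := evol ((u : ℂ) • (Z' * L')) 1 x2 with hx3
  obtain ⟨s1, r1⟩ := stepB _ vacuumConst_nonneg (-u) anu φ (hφ.isSmall h hM)
  obtain ⟨s2, r2⟩ := stepA _ hK1 (-u) anu x1 (s1 1 one_mem)
  obtain ⟨s3, r3⟩ := stepB _ hK2 u au x2 (s2 1 one_mem)
  obtain ⟨s4, r4⟩ := stepA _ hK3 u au x3 (s3 1 one_mem)
  have saZ : ∀ (s : ℝ) {Z L : E →L[ℂ] E}, IsSelfAdjoint Z → Commute Z L → IsSelfAdjoint L →
      IsSelfAdjoint ((s : ℂ) • (Z * L)) := by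
    intro s Z L hZ hc hL
    rw [IsSelfAdjoint, star_smul, star_mul, hL.star_eq, hZ.star_eq, hc.eq]
    simp
  have cRA : Commute Z (chainA M g m J D t) := commute_chain (cA hZS) fun i hi x hx =>
    hZS x (lA i hi x hx)
  have cRB : Commute Z' (chainB M g m J D t) := commute_chain (cB hZS') fun i hi x hx =>
    hZS' x (lB i hi x hx)
  have iA : ∀ (s : ℝ) ψ, ‖evol ((s : ℂ) • (Z * chainA M g m J D t)) 1 ψ‖ = ‖ψ‖ := fun s ψ =>
    norm_evol_apply (saZ s hZ cRA (hA.isSelfAdjoint le_rfl)) 1 ψ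
  have iB : ∀ (s : ℝ) ψ, ‖evol ((s : ℂ) • (Z' * chainB M g m J D t)) 1 ψ‖ = ‖ψ‖ := fun s ψ =>
    norm_evol_apply (saZ s hZ' cRB (hB.isSelfAdjoint le_rfl)) 1 ψ
  -- The linearized factors are replaced by the exact ones one at a time. The exact evolutions are
  -- isometries, so earlier errors are not enlarged.
  have tel : ∀ {P Q : E →L[ℂ] E} {x y : E} {e e' : ℝ}, (∀ ψ, ‖Q ψ‖ = ‖ψ‖) → ‖P x - Q x‖ ≤ e →
      ‖x - y‖ ≤ e' → ‖P x - Q y‖ ≤ e + e' := by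
    intro P Q x y e e' hQ h1 h2
    have : P x - Q y = (P x - Q x) + Q (x - y) := by
      rw [map_sub]
      abel
    rw [this]
    refine (norm_add_le _ _).trans (add_le_add h1 ?_)
    rwa [hQ]
  have total := tel (iA u) r4 (tel (iB u) r3 (tel (iA (-u)) r2 r1))
  -- the exact group commutator
  set A := (u : ℂ) • (Z * L) with hAdef
  set B := (u : ℂ) • (Z' * L') with hBdef
  set θ : ℝ := 2 * (u * g ^ J) ^ 2 / M with hθ
  have cZL' : Commute Z L' := cL' hZS
  have cZ'L : Commute Z' L := cL hZS'
  have hcomm : A * B - B * A - Complex.I • ((θ : ℂ) • (Z * Z')) =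
      (-(Complex.I * (θ / 2))) • (Z * (Z' * (D 0 ^ m + star (D 0) ^ m))) := by
    have e1 : A * B - B * A = ((u : ℂ) * u) • (Z * (Z' * (L * L' - L' * L))) := by
      have a1 : Z * L * (Z' * L') = Z * (Z' * (L * L')) := by
        rw [mul_assoc, ← mul_assoc L, ← cZ'L.eq, mul_assoc]
      have a2 : Z' * L' * (Z * L) = Z * (Z' * (L' * L)) := by
        rw [mul_assoc, ← mul_assoc L', ← cZL'.eq, mul_assoc, ← mul_assoc Z', ← hZZ.eq, mul_assoc]
      rw [hAdef, hBdef, smul_mul_smul_comm, smul_mul_smul_comm, a1, a2, ← smul_sub, ← mul_sub,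
        ← mul_sub]
    have hMc : (M : ℂ) ≠ 0 := by exact_mod_cast hM.ne'
    have e2 : ((u : ℂ) * u) * ((g : ℂ) ^ J * (g : ℂ) ^ J * (Complex.I / M)) =
        Complex.I * (θ / 2) := by
      rw [hθ]
      push_cast
      field_simp
    have e3 : Complex.I • ((θ : ℂ) • (Z * Z')) =
        (Complex.I * (θ / 2)) • (Z * (Z' * 2)) := by
      have : (2 : E →L[ℂ] E) = (2 : ℂ) • 1 := by
        rw [two_smul]
        norm_num
      rw [this, mul_smul_comm, mul_smul_comm, smul_smul, smul_smul, mul_one]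
      congr 1
      ring
    rw [e1, hcommL, mul_smul_comm, mul_smul_comm, smul_smul, e2, e3, ← smul_sub, ← mul_sub,
      ← mul_sub, neg_smul, ← smul_neg, ← mul_neg, ← mul_neg]
    congr 3
    abel
  have hθ0 : 0 ≤ θ := by positivity
  -- Makes the prefactor `θ / 2` of the commutator remainder at most `1`.
  have hθ2 : θ ≤ 2 := by
    rw [hθ, div_le_iff₀ hM]
    have : (u * g ^ J) ^ 2 ≤ M := by
      rw [← Real.sq_sqrt hM.le]
      gcongr
    linarith
  have saΘ : IsSelfAdjoint ((θ : ℂ) • (Z * Z')) := saZ θ hZ hZZ hZ'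
  have hΘA : Commute ((θ : ℂ) • (Z * Z')) A := by
    refine Commute.smul_left (Commute.smul_right ?_ _) _
    exact (((Commute.refl Z).mul_right (cL hZS)).mul_left ((hZZ.symm).mul_right cZ'L))
  have hΘB : Commute ((θ : ℂ) • (Z * Z')) B := by
    refine Commute.smul_left (Commute.smul_right ?_ _) _
    exact ((hZZ.mul_right cZL').mul_left ((Commute.refl Z').mul_right (cL' hZS')))
  have hK3m := hK3 m
  -- The starting vector is `x1 = e^{iB} φ`, so the conjugated evolution gives the full group
  -- commutator on `φ`, compared with `e^{-iΘ} φ`. The defect `D 0 ^ m + star (D 0) ^ m` is two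
  -- words of length `m`.
  have hgc := norm_groupCommutator_sub_le (ψ := x1) (C := 2 * K3 m * (√M)⁻¹ ^ m)
    (saZ u hZ (cL hZS) saL) (saZ u hZ' (cL' hZS') saL') saΘ hΘA hΘB (by positivity) (by
      intro s hs v hv
      rw [neg1]
      have q1 := (stepA _ hK1 (-u) anu x1 (s1 1 one_mem)).1 s hs
      have q2 := (stepB _ hK2 u au _ q1).1 v hv m
      have hE := ((m0.hasOrder_D.pow m).add (m0.hasOrder_star_D.pow m))
      rw [mul_one] at hE
      have q3 := hE.norm_apply_le q2 (by positivity)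
      rw [one_pow] at q3
      rw [hcomm, _root_.smul_apply, norm_smul, mul_apply_eq_comp, mul_apply_eq_comp]
      set ξ := (D 0 ^ m + star (D 0) ^ m) (evol B v (evol (((-u : ℝ) : ℂ) • (Z * L)) s x1)) with hξ
      have n1 := Z.le_of_opNorm_le hZ1 (Z' ξ)
      have n2 := Z'.le_of_opNorm_le hZ1' ξ
      have n3 : ‖-(Complex.I * ((θ : ℂ) / 2))‖ ≤ 1 := by
        rw [norm_neg, norm_mul, Complex.norm_I, one_mul, norm_div, Complex.norm_real,
          Real.norm_of_nonneg hθ0, Complex.norm_ofNat]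
        linarith
      calc _ ≤ 1 * ‖Z (Z' ξ)‖ := by gcongr
        _ ≤ _ := by linarith)
  have ex : evol B 1 x1 = φ := by
    have := neg1 (Z' * L') 1
    rw [← hBdef] at this
    rw [hx1, ← this, ← mul_apply_eq_comp, evol_mul_neg]
    rfl
  rw [ex, neg1] at hgc
  have fin := norm_add_le
    (evol A 1 x3 - evol ((θ : ℂ) • (Z * Z')) 1 φ)
    (-(evol A 1 x3 - evol ((u : ℂ) • (Z * chainA M g m J D t)) 1
      (evol ((u : ℂ) • (Z' * chainB M g m J D t)) 1
          (evol (((-u : ℝ) : ℂ) • (Z * chainA M g m J D t)) 1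
            (evol (((-u : ℝ) : ℂ) • (Z' * chainB M g m J D t)) 1 φ)))))
  rw [norm_neg] at fin
  have e5 : ∀ a b c : E, (a - b) + -(a - c) = c - b := fun a b c => by abel
  rw [e5] at fin
  have hX0 : 0 ≤ X := by positivity
  have p1 := hK1 (m + 1)
  have p2 := hK2 (m + 1)
  have p3 := hK3 (m + 1)
  have p4 := hK4 (m + 1)
  have hη0 : 0 ≤ (√M)⁻¹ ^ m := by positivity
  refine fin.trans ((add_le_add hgc total).trans ?_)
  have f1 : 0 ≤ C * (K1 (m + 1) + K2 (m + 1) + K3 (m + 1) + K4 (m + 1)) * (√M)⁻¹ ^ m := by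
    positivity
  have f2 : 0 ≤ 2 * K3 m * X := by positivity
  nlinarith

end Gate

lemma norm_le_one_of_star_mul_self {E : Type} [NormedAddCommGroup E] [InnerProductSpace ℂ E]
    [CompleteSpace E] {U : E →L[ℂ] E} (h : star U * U = 1) : ‖U‖ ≤ 1 := by
  have h1 := CStarRing.norm_star_mul_self (x := U)
  rw [h] at h1
  have h2 : ‖(1 : E →L[ℂ] E)‖ ≤ 1 := ContinuousLinearMap.norm_id_le
  nlinarith [norm_nonneg U]

/-! ### Collective spins of blocks of qubits. -/

section Sites

variable {Q : Type} [Fintype Q]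

lemma star_tensorOp (A : Q → Matrix (Fin 2) (Fin 2) ℂ) :
    star (tensorOp A) = tensorOp fun i => star (A i) := by
  ext x y
  simp [tensorOp, Matrix.star_apply]

lemma tensorOp_one : tensorOp (fun _ : Q => (1 : Matrix (Fin 2) (Fin 2) ℂ)) = 1 := by
  classical
  ext x y
  simp only [tensorOp, Matrix.of_apply, Matrix.one_apply]
  by_cases h : x = y
  · simp [h]
  · rw [if_neg h]
    obtain ⟨i, hi⟩ := Function.ne_iff.1 h
    exact Finset.prod_eq_zero (Finset.mem_univ i) (if_neg hi)

variable [DecidableEq Q]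

lemma tensorOp_mul (A B : Q → Matrix (Fin 2) (Fin 2) ℂ) :
    tensorOp A * tensorOp B = tensorOp fun i => A i * B i := by
  ext x y
  simp only [Matrix.mul_apply, tensorOp, Matrix.of_apply, ← Finset.prod_mul_distrib]
  rw [Finset.prod_univ_sum, Fintype.piFinset_univ]

/-- The single-qubit operator `m` on qubit `i`. -/
def site (i : Q) (m : Matrix (Fin 2) (Fin 2) ℂ) : Operator Q :=
  tensorOp fun j => if j = i then m else 1

lemma site_apply (i : Q) (m : Matrix (Fin 2) (Fin 2) ℂ) (x y : Q → Fin 2) :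
    site i m x y = m (x i) (y i) * ∏ j ∈ Finset.univ.erase i, (1 : Matrix (Fin 2) (Fin 2) ℂ) (x j) (y j) := by
  rw [site, tensorOp, Matrix.of_apply, ← Finset.mul_prod_erase _ _ (Finset.mem_univ i), if_pos rfl]
  congr 1
  exact Finset.prod_congr rfl fun j hj => by rw [if_neg (Finset.ne_of_mem_erase hj)]

lemma site_add (i : Q) (m n : Matrix (Fin 2) (Fin 2) ℂ) : site i (m + n) = site i m + site i n := by
  ext x y
  simp only [site_apply, Matrix.add_apply, add_mul]

lemma site_smul (i : Q) (c : ℂ) (m : Matrix (Fin 2) (Fin 2) ℂ) : site i (c • m) = c • site i m := by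
  ext x y
  simp only [site_apply, Matrix.smul_apply, smul_eq_mul, mul_assoc]

lemma site_sub (i : Q) (m n : Matrix (Fin 2) (Fin 2) ℂ) : site i (m - n) = site i m - site i n := by
  ext x y
  simp only [site_apply, Matrix.sub_apply, sub_mul]

lemma site_one (i : Q) : site i 1 = 1 := by
  rw [site, ← tensorOp_one]
  congr 1
  ext1 j
  split_ifs <;> rfl

lemma site_mul (i : Q) (m n : Matrix (Fin 2) (Fin 2) ℂ) : site i m * site i n = site i (m * n) := by
  rw [site, site, tensorOp_mul, site]
  congr 1
  ext1 j
  split_ifs <;> simp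

lemma star_site (i : Q) (m : Matrix (Fin 2) (Fin 2) ℂ) : star (site i m) = site i (star m) := by
  rw [site, star_tensorOp, site]
  congr 1
  ext1 j
  split_ifs <;> simp

lemma site_commute {i j : Q} (hij : i ≠ j) (m n : Matrix (Fin 2) (Fin 2) ℂ) :
    Commute (site i m) (site j n) := by
  rw [Commute, SemiconjBy, site, site, tensorOp_mul, tensorOp_mul]
  congr 1
  ext1 k
  by_cases h1 : k = i
  · have h2 : k ≠ j := fun h => hij (h1 ▸ h)
    simp [h1, hij]
  · simp [h1]

/-- Operators as continuous linear maps. -/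
noncomputable abbrev toOp : Operator Q ≃⋆ₐ[ℂ] (State Q →L[ℂ] State Q) :=
  Matrix.toEuclideanCLM (n := Q → Fin 2) (𝕜 := ℂ)

lemma toOp_apply (A : Operator Q) (ψ : State Q) : toOp A ψ = act A ψ := rfl

/-- The average of a single-qubit operator over a block of qubits. -/
noncomputable def avg {M : ℕ} (f : Fin M → Q) (m : Matrix (Fin 2) (Fin 2) ℂ) : Operator Q :=
  (M : ℂ)⁻¹ • ∑ k, site (f k) m

variable {M : ℕ} {f : Fin M → Q}

lemma avg_add (m n : Matrix (Fin 2) (Fin 2) ℂ) : avg f (m + n) = avg f m + avg f n := by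
  simp only [avg, site_add, Finset.sum_add_distrib, smul_add]

lemma avg_sub (m n : Matrix (Fin 2) (Fin 2) ℂ) : avg f (m - n) = avg f m - avg f n := by
  simp only [avg, site_sub, Finset.sum_sub_distrib, smul_sub]

lemma avg_smul (c : ℂ) (m : Matrix (Fin 2) (Fin 2) ℂ) : avg f (c • m) = c • avg f m := by
  simp only [avg, site_smul, ← Finset.smul_sum]
  rw [smul_comm]

lemma avg_one (hM : 0 < M) : avg f 1 = 1 := by
  have : (M : ℂ) ≠ 0 := by exact_mod_cast hM.ne'
  simp only [avg, site_one, Finset.sum_const, Finset.card_univ, Fintype.card_fin]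
  rw [← Nat.cast_smul_eq_nsmul ℂ, smul_smul, inv_mul_cancel₀ this, one_smul]

lemma star_avg (m : Matrix (Fin 2) (Fin 2) ℂ) : star (avg f m) = avg f (star m) := by
  simp only [avg, star_smul, star_sum, star_site]
  simp

/-- Operators on different qubits commute, so only the `M` diagonal terms of the double sum survive
against the normalization `1 / M ^ 2`. -/
lemma avg_comm (hf : Function.Injective f) (m n : Matrix (Fin 2) (Fin 2) ℂ) :
    avg f m * avg f n - avg f n * avg f m = (M : ℂ)⁻¹ • avg f (m * n - n * m) := by
  have h1 : ∀ m n : Matrix (Fin 2) (Fin 2) ℂ, avg f m * avg f n =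
      ((M : ℂ)⁻¹ * (M : ℂ)⁻¹) • ∑ k, ∑ l, site (f k) m * site (f l) n := by
    intro m n
    rw [avg, avg, smul_mul_smul_comm, Finset.sum_mul]
    simp only [Finset.mul_sum]
  rw [h1 m n, h1 n m, Finset.sum_comm (f := fun k l => site (f k) n * site (f l) m), ← smul_sub,
    ← Finset.sum_sub_distrib, avg, smul_smul]
  congr 1
  refine Finset.sum_congr rfl fun k _ => ?_
  rw [← Finset.sum_sub_distrib, Finset.sum_eq_single k]
  · rw [site_mul, site_mul, site_sub]
  · intro l _ hl
    rw [(site_commute (fun h => hl (hf h).symm) m n).eq, sub_self]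
  · simp

lemma avg_commute {M' : ℕ} {f' : Fin M' → Q} (h : ∀ k l, f k ≠ f' l)
    (m n : Matrix (Fin 2) (Fin 2) ℂ) : Commute (avg f m) (avg f' n) :=
  (Commute.sum_right _ _ _ fun l _ => (Commute.sum_left _ _ _ fun k _ =>
    site_commute (h k l) m n)).smul_right _ |>.smul_left _

lemma site_avg_commute {i : Q} (h : ∀ k, i ≠ f k) (m n : Matrix (Fin 2) (Fin 2) ℂ) :
    Commute (site i m) (avg f n) :=
  (Commute.sum_right _ _ _ fun l _ => site_commute (h l) m n).smul_right _

lemma norm_toOp_site_le {m : Matrix (Fin 2) (Fin 2) ℂ} (hm : star m * m = 1) (i : Q) :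
    ‖toOp (site i m)‖ ≤ 1 := by
  refine norm_le_one_of_star_mul_self ?_
  rw [← map_star, ← map_mul, star_site, site_mul, hm, site_one, map_one]

lemma norm_toOp_avg_le {m : Matrix (Fin 2) (Fin 2) ℂ} (hm : star m * m = 1) :
    ‖toOp (avg f m)‖ ≤ 1 := by
  rw [avg, map_smul, map_sum, norm_smul, norm_inv, Complex.norm_natCast]
  have h1 : ‖∑ k, toOp (site (f k) m)‖ ≤ M := by
    refine (norm_sum_le _ _).trans ((Finset.sum_le_sum fun k _ => norm_toOp_site_le hm (f k)).trans ?_)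
    simp
  rcases Nat.eq_zero_or_pos M with h0 | h0
  · subst h0
    simp
  · have : (0 : ℝ) < M := by exact_mod_cast h0
    rw [inv_mul_le_iff₀ this, mul_one]
    exact h1

lemma star_pauli (a : Fin 3) : star (pauli a) = pauli a := by
  fin_cases a <;> ext i j <;> fin_cases i <;> fin_cases j <;>
    simp [pauli, Matrix.star_apply]

lemma pauli_mul_self (a : Fin 3) : pauli a * pauli a = 1 := by
  fin_cases a <;> ext i j <;> fin_cases i <;> fin_cases j <;>
    simp [pauli, Matrix.mul_apply, Fin.sum_univ_two]

/-- The single-qubit matrix `1 - σᶻ - i σˣ`. -/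
noncomputable def lowering : Matrix (Fin 2) (Fin 2) ℂ := 1 - pauli 2 - Complex.I • pauli 0

lemma lowering_eq : lowering = !![0, -Complex.I; -Complex.I, 2] := by
  ext i j
  fin_cases i <;> fin_cases j <;> simp [lowering, pauli]
  norm_num

lemma star_lowering_eq : star lowering = !![0, Complex.I; Complex.I, 2] := by
  rw [lowering_eq]
  ext i j
  fin_cases i <;> fin_cases j <;> simp [Matrix.star_apply]

lemma isMode_avg (hM : 0 < M) (hf : Function.Injective f) :
    IsMode M (toOp (avg f lowering)) (toOp (avg f (pauli 1))) where
  star_t := by rw [← map_star, star_avg, star_pauli]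
  norm_D := by
    rw [lowering, avg_sub, avg_sub, avg_smul, avg_one hM, map_sub, map_sub, map_smul, map_one]
    have h2 : ‖(1 : State Q →L[ℂ] State Q)‖ ≤ 1 := ContinuousLinearMap.norm_id_le
    have hp : ∀ a, star (pauli a) * pauli a = 1 := fun a => by rw [star_pauli, pauli_mul_self]
    have h3 := norm_toOp_avg_le (f := f) (hp 2)
    have h4 := norm_toOp_avg_le (f := f) (hp 0)
    have h5 := norm_sub_le (1 - toOp (avg f (pauli 2))) (Complex.I • toOp (avg f (pauli 0)))
    have h6 := norm_sub_le 1 (toOp (avg f (pauli 2)))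
    rw [norm_smul, Complex.norm_I, one_mul] at h5
    linarith
  norm_t := norm_toOp_avg_le (by rw [star_pauli, pauli_mul_self])
  comm_t_D := by
    rw [← map_mul, ← map_mul, ← map_sub, avg_comm hf, ← map_one toOp, ← map_sub, ← map_smul,
      ← avg_one (f := f) hM, ← avg_sub]
    have : pauli 1 * lowering - lowering * pauli 1 = (-2 : ℂ) • (1 - lowering) := by
      rw [lowering_eq]
      ext i j
      fin_cases i <;> fin_cases j <;> simp [pauli] <;> ring
    rw [this, avg_smul, smul_smul]
    congr 2
    push_cast
    ring
  comm_D_star := by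
    rw [← map_star, ← map_mul, ← map_mul, ← map_sub, star_avg, avg_comm hf, ← map_smul]
    have : lowering * star lowering - star lowering * lowering = (4 : ℂ) • pauli 1 := by
      rw [star_lowering_eq, lowering_eq]
      ext i j
      fin_cases i <;> fin_cases j <;> simp [pauli] <;> ring
    rw [this, avg_smul, smul_smul]
    congr 2
    push_cast
    ring

end Sites

/-! ### The ancilla register and its vacuum. -/

section Ancillas

variable {A B : Type} [Fintype A] [DecidableEq A] [Fintype B] [DecidableEq B]

lemma norm_withAncillas (ψ : State A) : ‖withAncillas B ψ‖ = ‖ψ‖ := by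
  rw [EuclideanSpace.norm_eq, EuclideanSpace.norm_eq]
  congr 1
  rw [← (Equiv.sumArrowEquivProdArrow A B (Fin 2)).symm.sum_comp, Fintype.sum_prod_type]
  refine Finset.sum_congr rfl fun x _ => ?_
  rw [Finset.sum_eq_single (fun _ => 0)]
  · simp [withAncillas]
  · intro y _ hy
    have : ¬ ∀ b, y b = 0 := fun h => hy (funext h)
    simp [withAncillas, this]
  · simp

/-- Adding ancillas, as a continuous linear map. -/
noncomputable def ancillaMap (A B : Type) [Fintype A] [DecidableEq A] [Fintype B] [DecidableEq B] :
    State A →L[ℂ] State (A ⊕ B) :=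
  LinearMap.toContinuousLinearMap
    { toFun := withAncillas B
      map_add' := fun ψ χ => by
        ext x
        by_cases h : ∀ b : B, x (Sum.inr b) = 0 <;> simp [withAncillas, h]
      map_smul' := fun c ψ => by
        ext x
        by_cases h : ∀ b : B, x (Sum.inr b) = 0 <;> simp [withAncillas, h] }

lemma ancillaMap_apply (ψ : State A) : ancillaMap A B ψ = withAncillas B ψ := rfl

lemma tensorOp_withAncillas (m : A → Matrix (Fin 2) (Fin 2) ℂ) (ψ : State A) :
    toOp (tensorOp (Sum.elim m fun _ : B => 1)) (withAncillas B ψ) =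
      withAncillas B (toOp (tensorOp m) ψ) := by
  ext x
  simp only [toOp_apply, act, withAncillas, Matrix.mulVec, dotProduct, tensorOp, Matrix.of_apply]
  rw [← (Equiv.sumArrowEquivProdArrow A B (Fin 2)).symm.sum_comp, Fintype.sum_prod_type]
  have : ∀ y : A → Fin 2, (∑ z : B → Fin 2,
      (∏ i, (Sum.elim m fun _ : B => (1 : Matrix (Fin 2) (Fin 2) ℂ)) i (x i) ((Equiv.sumArrowEquivProdArrow A B (Fin 2)).symm (y, z) i)) *
        if ∀ b, (Equiv.sumArrowEquivProdArrow A B (Fin 2)).symm (y, z) (Sum.inr b) = 0 then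
          ψ fun a => (Equiv.sumArrowEquivProdArrow A B (Fin 2)).symm (y, z) (Sum.inl a) else 0) =
      if ∀ b, x (Sum.inr b) = 0 then (∏ i, m i (x (Sum.inl i)) (y i)) * ψ y else 0 := by
    intro y
    rw [Finset.sum_eq_single (fun _ => 0)]
    · rw [Fintype.prod_sum_type]
      simp only [Sum.elim_inl, Sum.elim_inr, Equiv.sumArrowEquivProdArrow_symm_apply_inl,
        Equiv.sumArrowEquivProdArrow_symm_apply_inr, implies_true, if_true]
      split_ifs with h
      · rw [Finset.prod_eq_one (s := Finset.univ)
          (f := fun b : B => (1 : Matrix (Fin 2) (Fin 2) ℂ) (x (Sum.inr b)) 0)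
          (fun b _ => by rw [h b, Matrix.one_apply_eq]), mul_one]
      · push Not at h
        obtain ⟨b, hb⟩ := h
        rw [Finset.prod_eq_zero (Finset.mem_univ b)
          (show (1 : Matrix (Fin 2) (Fin 2) ℂ) (x (Sum.inr b)) 0 = 0 from Matrix.one_apply_ne hb)]
        simp
    · intro z _ hz
      have : ¬ ∀ b, z b = 0 := fun h => hz (funext h)
      simp [this]
    · simp
  rw [Finset.sum_congr rfl fun y _ => this y]
  split_ifs with h
  · rfl
  · simp

lemma site_inl_withAncillas (a : A) (m : Matrix (Fin 2) (Fin 2) ℂ) (ψ : State A) :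
    toOp (site (Sum.inl a) m) (withAncillas B ψ) = withAncillas B (toOp (site a m) ψ) := by
  rw [site, site, ← tensorOp_withAncillas]
  congr 3
  ext1 i
  rcases i with i | i <;> simp

lemma site_inr_withAncillas (b : B) {m : Matrix (Fin 2) (Fin 2) ℂ} (c : ℂ) (h0 : m 0 0 = c)
    (h1 : m 1 0 = 0) (ψ : State A) :
    toOp (site (Sum.inr b) m) (withAncillas B ψ) = c • withAncillas B ψ := by
  ext x
  simp only [toOp_apply, act, withAncillas, Matrix.mulVec, dotProduct, site_apply]
  rw [Finset.sum_eq_single x]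
  · rw [PiLp.smul_apply, smul_eq_mul]
    split_ifs with h
    · rw [h b, h0, Finset.prod_eq_one fun j _ =>
        (Matrix.one_apply_eq (x j) : (1 : Matrix (Fin 2) (Fin 2) ℂ) (x j) (x j) = 1), mul_one]
      simp [h]
    · simp [h]
  · intro y _ hy
    split_ifs with h
    · obtain ⟨i, hi⟩ := Function.ne_iff.1 hy
      by_cases hib : i = Sum.inr b
      · subst hib
        rw [h b] at hi ⊢
        have : x (Sum.inr b) = 1 := Fin.eq_one_of_ne_zero _ (Ne.symm hi)
        rw [this, h1]
        simp
      · rw [Finset.prod_eq_zero (Finset.mem_erase.2 ⟨hib, Finset.mem_univ i⟩)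
          (show (1 : Matrix (Fin 2) (Fin 2) ℂ) (x i) (y i) = 0 from Matrix.one_apply_ne (Ne.symm hi))]
        simp
    · simp
  · simp

lemma avg_inr_withAncillas {M : ℕ} {f : Fin M → B} {m : Matrix (Fin 2) (Fin 2) ℂ} (h0 : m 0 0 = 0)
    (h1 : m 1 0 = 0) (ψ : State A) :
    toOp (avg (fun k => (Sum.inr (f k) : A ⊕ B)) m) (withAncillas B ψ) = 0 := by
  rw [avg, map_smul, map_sum, _root_.smul_apply, _root_.sum_apply]
  simp only [site_inr_withAncillas _ 0 h0 h1, zero_smul, Finset.sum_const_zero, smul_zero]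

/-- The modes of disjoint blocks of ancillas, and their vacuum. -/
lemma modeFamily_avg {Q : Type} [Fintype Q] [DecidableEq Q] {n M : ℕ} (hM : 0 < M)
    (f : ℕ → Fin M → Q) (hf : ∀ i < n, Function.Injective (f i))
    (hd : ∀ i < n, ∀ j < n, i ≠ j → ∀ k l, f i k ≠ f j l) :
    ModeFamily n M (fun i => toOp (avg (f i) lowering)) (fun i => toOp (avg (f i) (pauli 1))) where
  mode i hi := isMode_avg hM (hf i hi)
  commute i hi j hj hij := by
    have hc : ∀ m n, Commute (toOp (avg (f i) m)) (toOp (avg (f j) n)) := fun m n =>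
      (avg_commute (hd i hi j hj hij) m n).map toOp
    rintro x (rfl | rfl | rfl) y (rfl | rfl | rfl) <;>
      (try simp only [← map_star, star_avg]) <;> exact hc _ _

lemma commute_allLetters_avg {Q : Type} [Fintype Q] [DecidableEq Q] {n M : ℕ}
    (f : ℕ → Fin M → Q) {i : Q} (hi : ∀ j < n, ∀ k, i ≠ f j k) (m : Matrix (Fin 2) (Fin 2) ℂ) :
    ∀ x ∈ allLetters n (fun i => toOp (avg (f i) lowering)) (fun i => toOp (avg (f i) (pauli 1))),
      Commute (toOp (site i m)) x := by
  rintro x ⟨j, hj, hx⟩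
  have hc : ∀ n, Commute (toOp (site i m)) (toOp (avg (f j) n)) := fun n =>
    (site_avg_commute (hi j hj) m n).map toOp
  rcases hx with rfl | rfl | rfl <;> (try simp only [← map_star, star_avg]) <;> exact hc _

/-- The matrices `lowering + pauli 1` and `star lowering - pauli 1` have vanishing first columns, so
they annihilate every ancilla in the state `|0⟩`. -/
lemma isVacuum_withAncillas {n M : ℕ} (f : ℕ → Fin M → B) {ψ : State A}
    (hψ : ‖ψ‖ ≤ 1) :
    IsVacuum n (fun i => toOp (avg (fun k => (Sum.inr (f i k) : A ⊕ B)) lowering))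
      (fun i => toOp (avg (fun k => (Sum.inr (f i k) : A ⊕ B)) (pauli 1)))
      (withAncillas B ψ) where
  norm_le := by rwa [norm_withAncillas]
  apply_D i _ := by
    rw [eq_neg_iff_add_eq_zero, ← _root_.add_apply, ← map_add, ← avg_add]
    exact avg_inr_withAncillas (by simp [lowering_eq, pauli]) (by simp [lowering_eq, pauli]) ψ
  apply_star_D i _ := by
    rw [← sub_eq_zero, ← _root_.sub_apply, ← map_star, ← map_sub, star_avg, ← avg_sub]
    exact avg_inr_withAncillas (by simp [star_lowering_eq, pauli]) (by simp [star_lowering_eq, pauli]) ψ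

end Ancillas

open MeasureTheory

/-! ### Concatenation of protocols, and pulses constant in time. -/

section Concatenation

variable {Q : Type} [Fintype Q] [DecidableEq Q] {K : ℕ}

namespace Protocol

lemma intervalIntegrable_finset_sum {ι : Type} (s : Finset ι) {f : ι → ℝ → ℂ} {a b : ℝ}
    (h : ∀ i ∈ s, IntervalIntegrable (f i) volume a b) :
    IntervalIntegrable (fun t => ∑ i ∈ s, f i t) volume a b := by
  have := IntervalIntegrable.sum s h
  rwa [show ∑ i ∈ s, f i = fun t => ∑ i ∈ s, f i t from funext fun t => Finset.sum_apply t s f]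
    at this

lemma intervalIntegrable_glue {f g : ℝ → ℝ} {a b : ℝ} (ha : 0 ≤ a) (hb : 0 ≤ b)
    (hf : IntervalIntegrable f volume 0 a) (hg : IntervalIntegrable g volume 0 b) :
    IntervalIntegrable (fun t => if t ≤ a then f t else g (t - a)) volume 0 (a + b) := by
  have h1 : IntervalIntegrable (fun t => if t ≤ a then f t else g (t - a)) volume 0 a := by
    refine hf.congr_uIoo fun t ht => ?_
    rw [Set.uIoo_of_le ha] at ht
    simp [ht.2.le]
  have h2 : IntervalIntegrable (fun t => if t ≤ a then f t else g (t - a)) volume a (a + b) := by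
    have := hg.comp_sub_right a
    rw [zero_add, add_comm b] at this
    refine this.congr_uIoo fun t ht => ?_
    rw [Set.uIoo_of_le (by linarith)] at ht
    simp [not_le.2 ht.1]
  exact h1.trans h2

/-- First `p`, then `q`. -/
noncomputable def glue (p q : Protocol Q K) : Protocol Q K where
  T := p.T + q.T
  T_nonneg := add_nonneg p.T_nonneg q.T_nonneg
  J t P := if t ≤ p.T then p.J t P else q.J (t - p.T) P
  h t i a := if t ≤ p.T then p.h t i a else q.h (t - p.T) i a
  J_le t ht s h2 hK := by
    by_cases h : t ≤ p.T
    · simp only [h, if_true]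
      exact p.J_le t ⟨ht.1, h⟩ s h2 hK
    · simp only [h, if_false]
      push Not at h
      exact q.J_le (t - p.T) ⟨by linarith, by linarith [ht.2]⟩ s h2 hK
  J_integrable P := intervalIntegrable_glue p.T_nonneg q.T_nonneg (p.J_integrable P)
    (q.J_integrable P)
  h_integrable i a := intervalIntegrable_glue p.T_nonneg q.T_nonneg (p.h_integrable i a)
    (q.h_integrable i a)

lemma ham_glue (p q : Protocol Q K) (t : ℝ) :
    (p.glue q).ham t = if t ≤ p.T then p.ham t else q.ham (t - p.T) := by
  by_cases h : t ≤ p.T <;> simp [ham, hamInt, hamRot, glue, h]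

lemma ham_integrable (p : Protocol Q K) (x y : Q → Fin 2) :
    IntervalIntegrable (fun t => p.ham t x y) volume 0 p.T := by
  have cast : ∀ {f : ℝ → ℝ}, IntervalIntegrable f volume 0 p.T →
      IntervalIntegrable (fun t => (f t : ℂ)) volume 0 p.T := fun hf =>
    ⟨hf.1.ofReal, hf.2.ofReal⟩
  simp only [ham, hamInt, hamRot, Matrix.add_apply, Matrix.sum_apply, Matrix.smul_apply, smul_eq_mul]
  refine IntervalIntegrable.add ?_ ?_
  · refine intervalIntegrable_finset_sum _ fun P _ => ?_
    exact (cast ((p.J_integrable P).const_mul _)).mul_const _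
  · refine intervalIntegrable_finset_sum _ fun i _ => ?_
    refine intervalIntegrable_finset_sum _ fun a _ => ?_
    exact (cast (p.h_integrable i a)).mul_const _

lemma ham_mul_integrable (p : Protocol Q K) {U : ℝ → Operator Q}
    (hU : ∀ x y, ContinuousOn (fun t => U t x y) (Set.Icc 0 p.T)) (x y : Q → Fin 2) :
    IntervalIntegrable (fun t => (p.ham t * U t) x y) volume 0 p.T := by
  simp only [Matrix.mul_apply]
  refine intervalIntegrable_finset_sum _ fun z _ => ?_
  refine (p.ham_integrable x z).mul_continuousOn ?_
  rw [Set.uIcc_of_le p.T_nonneg]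
  exact hU z y

theorem isEvolution_glue {p q : Protocol Q K} {V W : Operator Q} (hp : p.IsEvolution V)
    (hq : q.IsEvolution W) : (p.glue q).IsEvolution (W * V) := by
  obtain ⟨U₁, c₁, e₁, rfl⟩ := hp
  obtain ⟨U₂, c₂, e₂, rfl⟩ := hq
  have hp0 := p.T_nonneg
  have hq0 := q.T_nonneg
  have hT : (p.glue q).T = p.T + q.T := rfl
  set U : ℝ → Operator Q := fun t => if t ≤ p.T then U₁ t else U₂ (t - p.T) * U₁ p.T with hU
  have U20 : U₂ 0 = 1 := by
    ext x y
    rw [e₂ 0 ⟨le_rfl, hq0⟩ x y]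
    simp
  have hU1 : ∀ t ≤ p.T, U t = U₁ t := fun t ht => by simp [hU, ht]
  have hU2 : ∀ t, p.T ≤ t → U t = U₂ (t - p.T) * U₁ p.T := by
    intro t ht
    rcases ht.eq_or_lt with rfl | ht
    · simp [hU, U20]
    · simp [hU, not_le.2 ht]
  have hcont : ∀ x y, ContinuousOn (fun t => U t x y) (Set.Icc 0 (p.glue q).T) := by
    intro x y
    have h1 : ContinuousOn (fun t => U t x y) (Set.Icc 0 p.T) :=
      (c₁ x y).congr fun t ht => by rw [hU1 t ht.2]
    have h2 : ContinuousOn (fun t => U t x y) (Set.Icc p.T (p.T + q.T)) := by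
      have : ContinuousOn (fun t => ∑ z, U₂ (t - p.T) x z * U₁ p.T z y)
          (Set.Icc p.T (p.T + q.T)) := by
        refine continuousOn_finsetSum _ fun z _ => ContinuousOn.mul ?_ continuousOn_const
        refine (c₂ x z).comp (continuousOn_id.sub continuousOn_const) fun t ht => ?_
        exact ⟨by simpa using ht.1, by simpa [add_comm] using ht.2⟩
      refine this.congr fun t ht => ?_
      simp only [hU2 t ht.1, Matrix.mul_apply]
    have := h1.union_of_isClosed h2 isClosed_Icc isClosed_Icc
    rwa [Set.Icc_union_Icc_eq_Icc hp0 (by linarith), ← hT] at this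
  refine ⟨U, hcont, ?_, ?_⟩
  · intro t ht x y
    have hint := (p.glue q).ham_mul_integrable hcont x y
    have first : ∀ t, 0 ≤ t → t ≤ p.T →
        ∫ s in (0 : ℝ)..t, ((p.glue q).ham s * U s) x y = ∫ s in (0 : ℝ)..t, (p.ham s * U₁ s) x y := by
      intro t h0 h1
      refine intervalIntegral.integral_congr fun s hs => ?_
      rw [Set.uIcc_of_le h0] at hs
      simp only [ham_glue, if_pos (hs.2.trans h1), hU1 s (hs.2.trans h1)]
    rcases le_total t p.T with h | h
    · rw [hU1 t h, first t ht.1 h]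
      exact e₁ t ⟨ht.1, h⟩ x y
    · have ht2 : t - p.T ∈ Set.Icc 0 q.T := ⟨by linarith, by rw [hT] at ht; linarith [ht.2]⟩
      rw [← intervalIntegral.integral_add_adjacent_intervals (b := p.T), first p.T hp0 le_rfl]
      · have second : ∫ s in p.T..t, ((p.glue q).ham s * U s) x y =
            ∑ z, (∫ s in (0 : ℝ)..(t - p.T), (q.ham s * U₂ s) x z) * U₁ p.T z y := by
          have e : ∫ s in p.T..t, ((p.glue q).ham s * U s) x y =
              ∫ s in p.T..t, (fun s => ∑ z, (q.ham s * U₂ s) x z * U₁ p.T z y) (s - p.T) := by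
            -- At `s = p.T` the glued Hamiltonian still has the value of `p`, so the integrands are
            -- compared on the open interval only.
            refine intervalIntegral.integral_congr_uIoo fun s hs => ?_
            rw [Set.uIoo_of_le h] at hs
            simp only [ham_glue, if_neg (not_le.2 hs.1), hU2 s hs.1.le]
            rw [← mul_assoc, Matrix.mul_apply]
          rw [e, intervalIntegral.integral_comp_sub_right
            (fun s => ∑ z, (q.ham s * U₂ s) x z * U₁ p.T z y) p.T, sub_self]
          rw [intervalIntegral.integral_finsetSum]
          · simp only [intervalIntegral.integral_mul_const]
          · intro z _
            refine IntervalIntegrable.mul_const ?_ _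
            refine (q.ham_mul_integrable c₂ x z).mono_set ?_
            rw [Set.uIcc_of_le ht2.1, Set.uIcc_of_le hq0]
            exact Set.Icc_subset_Icc le_rfl ht2.2
        rw [second, hU2 t h, Matrix.mul_apply]
        have e3 : ∀ z, U₂ (t - p.T) x z * U₁ p.T z y = (1 : Operator Q) x z * U₁ p.T z y -
            Complex.I * ((∫ s in (0 : ℝ)..(t - p.T), (q.ham s * U₂ s) x z) * U₁ p.T z y) := by
          intro z
          rw [e₂ _ ht2 x z]
          ring
        simp only [e3]
        rw [Finset.sum_sub_distrib, ← Finset.mul_sum, ← Matrix.mul_apply, one_mul,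
          e₁ p.T ⟨hp0, le_rfl⟩ x y]
        ring
      · refine hint.mono_set ?_
        rw [Set.uIcc_of_le hp0, Set.uIcc_of_le (p.glue q).T_nonneg]
        exact Set.Icc_subset_Icc le_rfl (h.trans ht.2)
      · refine hint.mono_set ?_
        rw [Set.uIcc_of_le h, Set.uIcc_of_le (p.glue q).T_nonneg]
        exact Set.Icc_subset_Icc hp0 ht.2
  · rw [hU2 _ (by rw [hT]; linarith), hT, add_sub_cancel_left]

end Protocol

/-- `W` is the evolution operator of a protocol of duration `τ`. -/
def Reach (K : ℕ) (τ : ℝ) (W : State Q →L[ℂ] State Q) : Prop :=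
  ∃ p : Protocol Q K, p.T = τ ∧ p.IsEvolution (toOp.symm W)

lemma Reach.mul {τ τ' : ℝ} {V W : State Q →L[ℂ] State Q} (hV : Reach K τ V) (hW : Reach K τ' W) :
    Reach K (τ + τ') (W * V) := by
  obtain ⟨p, rfl, hp⟩ := hV
  obtain ⟨q, rfl, hq⟩ := hW
  refine ⟨p.glue q, rfl, ?_⟩
  rw [map_mul]
  exact Protocol.isEvolution_glue hp hq

/-- Matrix entries as a continuous linear functional. -/
noncomputable def entry (x y : Q → Fin 2) : (State Q →L[ℂ] State Q) →L[ℂ] ℂ :=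
  (EuclideanSpace.proj x).comp (ContinuousLinearMap.apply ℂ (State Q) (EuclideanSpace.single y 1))

lemma entry_apply (A : State Q →L[ℂ] State Q) (x y : Q → Fin 2) :
    entry x y A = toOp.symm A x y := by
  have key : ∀ B : Operator Q, entry x y (toOp B) = B x y := by
    intro B
    simp only [entry, ContinuousLinearMap.comp_apply, ContinuousLinearMap.apply_apply, toOp_apply,
      act]
    simp
  have := key (toOp.symm A)
  rwa [StarAlgEquiv.apply_symm_apply] at this

/-- A Hamiltonian that is constant in time. -/
lemma reach_of_const (p : Protocol Q K) {H : State Q →L[ℂ] State Q}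
    (hH : ∀ t, p.ham t = toOp.symm H) : Reach K p.T (evol H p.T) := by
  refine ⟨p, rfl, fun t => toOp.symm (evol H t), fun x y => ?_, fun t _ x y => ?_, rfl⟩
  · simp only [← entry_apply]
    refine Continuous.continuousOn ((entry x y).continuous.comp ?_)
    exact continuous_iff_continuousAt.2 fun t => (hasDerivAt_evol H t).continuousAt
  · have hd : ∀ s : ℝ, HasDerivAt (fun s => entry x y (evol H s))
        (-Complex.I * (p.ham s * toOp.symm (evol H s)) x y) s := by
      intro s
      have h1 := ((entry x y).restrictScalars ℝ).hasFDerivAt.comp_hasDerivAt s (hasDerivAt_evol' H s)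
      refine h1.congr_deriv ?_
      rw [hH, ← map_mul, ← entry_apply]
      simp
    have hcont : Continuous fun s => (p.ham s * toOp.symm (evol H s)) x y := by
      simp only [hH, ← map_mul, ← entry_apply]
      refine (entry x y).continuous.comp (continuous_const.mul ?_)
      exact continuous_iff_continuousAt.2 fun t => (hasDerivAt_evol H t).continuousAt
    have := intervalIntegral.integral_eq_sub_of_hasDerivAt (a := 0) (b := t) (fun s _ => hd s)
      ((continuous_const.mul hcont).intervalIntegrable _ _)
    rw [intervalIntegral.integral_const_mul, entry_apply, entry_apply, evol_zero, map_one] at this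
    linear_combination -this

lemma reach_one : Reach K 0 (1 : State Q →L[ℂ] State Q) := by
  have := reach_of_const (K := K) (Q := Q) (H := 0)
    { T := 0, T_nonneg := le_rfl, J := fun _ _ => 0, h := fun _ _ _ => 0
      J_le := by simp
      J_integrable := by simp
      h_integrable := by simp } (fun t => by simp [Protocol.ham, Protocol.hamInt, Protocol.hamRot])
  simpa [evol_zero] using this

/-- The Pauli string with a single Pauli matrix. -/
def singleString (i : Q) (a : Fin 3) : PauliString Q := fun j => if j = i then some a else none

lemma op_singleString (i : Q) (a : Fin 3) : (singleString i a).op = sitePauli i a := by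
  rw [PauliString.op, sitePauli]
  congr 1
  ext1 j
  by_cases h : j = i <;> simp [singleString, h]

lemma support_singleString (i : Q) (a : Fin 3) : (singleString i a).support = {i} := by
  ext j
  by_cases h : j = i <;> simp [PauliString.support, singleString, h]

lemma sum_card_one (F : PauliString Q → Operator Q) :
    ∑ P : PauliString Q with P.support.card = 1, F P = ∑ i : Q, ∑ a : Fin 3, F (singleString i a) := by
  rw [← Finset.sum_product', Finset.univ_product_univ]
  symm
  refine Finset.sum_bij (fun ia _ => singleString ia.1 ia.2) ?_ ?_ ?_ ?_
  · intro ia _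
    simp [support_singleString]
  · rintro ⟨i, a⟩ _ ⟨j, b⟩ _ h
    have h1 := congrFun h i
    by_cases hij : i = j
    · subst hij
      simpa [singleString] using h1
    · simp [singleString, hij] at h1
  · intro P hP
    obtain ⟨i, hi⟩ := Finset.card_eq_one.1 (Finset.mem_filter.1 hP).2
    have hPi : (P i).isSome = true := by
      have : i ∈ P.support := by rw [hi]; exact Finset.mem_singleton_self i
      exact (Finset.mem_filter.1 this).2
    refine ⟨(i, (P i).get hPi), Finset.mem_univ _, ?_⟩
    ext1 j
    by_cases h : j = i
    · subst h
      simp [singleString]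
    · have : j ∉ P.support := by rw [hi]; simpa using h
      simp only [PauliString.support, Finset.mem_filter, Finset.mem_univ, true_and,
        Option.not_isSome_iff_eq_none] at this
      simp [singleString, h, this]
  · intro ia _
    rfl

/-- A pulse of duration `τ`. -/
theorem reach_pulse {τ : ℝ} (hτ : 0 < τ) (f : PauliString Q → ℝ)
    (hK : ∀ P, K < P.support.card → f P = 0) (h0 : ∀ P, P.support = ∅ → f P = 0)
    (hs : ∀ s : Finset Q, 2 ≤ s.card → s.card ≤ K →
      ∑ P : PauliString Q with P.support = s, |f P| ≤ τ * (Fintype.card Q : ℝ) ^ (2 - (s.card : ℤ))) :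
    Reach K τ (evol (toOp (∑ P, (f P : ℂ) • P.op)) 1) := by
  set N : ℝ := (Fintype.card Q : ℝ) with hN
  have hNpos : ∀ s : Finset Q, 2 ≤ s.card → 0 < N := by
    intro s h
    have := s.card_le_univ
    have : 0 < Fintype.card Q := by omega
    rw [hN]
    exact_mod_cast this
  have := reach_of_const (K := K) (Q := Q) (H := ((τ⁻¹ : ℝ) : ℂ) • toOp (∑ P, (f P : ℂ) • P.op))
    { T := τ, T_nonneg := hτ.le
      J := fun _ P => f P / (τ * N ^ (2 - (P.support.card : ℤ)))
      h := fun _ i a => f (singleString i a) / τ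
      J_le := by
        intro t _ s h2 hsK
        have hp := hNpos s h2
        have hp' : 0 < τ * N ^ (2 - (s.card : ℤ)) := by positivity
        rw [Finset.sum_congr rfl (g := fun P => |f P| / (τ * N ^ (2 - (s.card : ℤ))))]
        · rw [← Finset.sum_div, div_le_one hp']
          exact hs s h2 hsK
        · intro P hP
          rw [(Finset.mem_filter.1 hP).2, abs_div, abs_of_pos hp']
      J_integrable := by simp
      h_integrable := by simp } (fun t => ?_)
  · rwa [evol_smul, mul_inv_cancel₀ hτ.ne'] at this
  · rw [map_smul, StarAlgEquiv.symm_apply_apply, Protocol.ham, Protocol.hamInt, Protocol.hamRot]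
    -- Strings on one qubit become fields and cost no time; only those on `2, …, K` qubits are
    -- limited by the coupling strength. The remaining coefficients vanish.
    have split : ∑ P, (f P : ℂ) • P.op =
        (∑ P : PauliString Q with 2 ≤ P.support.card ∧ P.support.card ≤ K, (f P : ℂ) • P.op) +
          ∑ P : PauliString Q with P.support.card = 1, (f P : ℂ) • P.op := by
      rw [← Finset.sum_union]
      · symm
        refine Finset.sum_subset (Finset.subset_univ _) fun P _ hP => ?_
        simp only [Finset.mem_union, Finset.mem_filter, Finset.mem_univ, true_and, not_or, not_and,
          not_le] at hP
        have : f P = 0 := by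
          by_cases h2 : 2 ≤ P.support.card
          · exact hK P (hP.1 h2)
          · exact h0 P (Finset.card_eq_zero.1 (by omega))
        rw [this]
        simp
      · rw [Finset.disjoint_left]
        intro P h1 h2
        have h1 := (Finset.mem_filter.1 h1).2.1
        have h2 := (Finset.mem_filter.1 h2).2
        omega
    rw [split, smul_add, sum_card_one]
    congr 1
    · rw [Finset.smul_sum]
      refine Finset.sum_congr rfl fun P hP => ?_
      have hp := hNpos P.support (Finset.mem_filter.1 hP).2.1
      rw [smul_smul, ← Complex.ofReal_mul]
      congr 2
      have : N ^ (2 - (P.support.card : ℤ)) ≠ 0 := by positivity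
      simp only [← hN]
      field_simp
    · rw [Finset.smul_sum]
      refine Finset.sum_congr rfl fun i _ => ?_
      rw [Finset.smul_sum]
      refine Finset.sum_congr rfl fun a _ => ?_
      rw [smul_smul, ← Complex.ofReal_mul, op_singleString]
      congr 2
      exact div_eq_inv_mul _ _

end Concatenation

/-! ### Pauli expansions of polynomials in collective spins. -/

section PauliStrings

set_option linter.unusedSectionVars false

/-- The Pauli label of `σ_a` times a given Pauli label. -/
def pauliMul (a : Fin 3) : Option (Fin 3) → Option (Fin 3)
  | none => some a
  -- The three labels sum to `0` in `Fin 3`, so the label different from `a` and `b` is `-(a + b)`.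
  | some b => if a = b then none else some (-(a + b))

/-- The phase of the product of `σ_a` and a given Pauli label. -/
noncomputable def pauliPhase (a : Fin 3) : Option (Fin 3) → ℂ
  | none => 1
  | some b => if a = b then 1 else if b = a + 1 then Complex.I else -Complex.I

lemma pauliMul_pauliMul (a : Fin 3) (o : Option (Fin 3)) : pauliMul a (pauliMul a o) = o := by
  revert a o
  decide

lemma norm_pauliPhase (a : Fin 3) (o : Option (Fin 3)) : ‖pauliPhase a o‖ = 1 := by
  rcases o with _ | b
  · simp [pauliPhase]
  · simp only [pauliPhase]
    split_ifs <;> simp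

lemma pauli_mul_elim (a : Fin 3) (o : Option (Fin 3)) :
    pauli a * o.elim 1 pauli = pauliPhase a o • (pauliMul a o).elim 1 pauli := by
  rcases o with _ | b
  · simp [pauliPhase, pauliMul]
  · fin_cases a <;> fin_cases b <;> ext i j <;> fin_cases i <;> fin_cases j <;>
      simp [pauliPhase, pauliMul, pauli, Matrix.mul_apply, Fin.sum_univ_two]

variable {Q : Type} [Fintype Q] [DecidableEq Q]

/-- Multiplication of a Pauli string by the Pauli matrix `a` at `i`, up to the phase. -/
def PauliString.mulAt (i : Q) (a : Fin 3) (P : PauliString Q) : PauliString Q :=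
  Function.update P i (pauliMul a (P i))

namespace PauliString

lemma mulAt_mulAt (i : Q) (a : Fin 3) (P : PauliString Q) : mulAt i a (mulAt i a P) = P := by
  simp [mulAt, pauliMul_pauliMul]

lemma site_mul_op (i : Q) (a : Fin 3) (P : PauliString Q) :
    site i (pauli a) * P.op = pauliPhase a (P i) • (mulAt i a P).op := by
  have h : (mulAt i a P).op = site i ((pauliMul a (P i)).elim 1 pauli) *
      tensorOp (fun j => if j = i then 1 else (P j).elim 1 pauli) := by
    rw [op, site, tensorOp_mul]
    congr 1
    ext1 j
    by_cases h : j = i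
    · subst h
      simp [mulAt]
    · simp [mulAt, h]
  rw [h, ← smul_mul_assoc, ← site_smul, ← pauli_mul_elim, ← site_mul, mul_assoc]
  congr 1
  rw [op, site, tensorOp_mul]
  congr 1
  ext1 j
  by_cases h : j = i
  · subst h
    simp
  · simp [h]

lemma mem_support {P : PauliString Q} {i : Q} : i ∈ P.support ↔ P i ≠ none := by
  simp [support, Option.isSome_iff_ne_none]

lemma support_mulAt_subset (i : Q) (a : Fin 3) (P : PauliString Q) :
    (mulAt i a P).support ⊆ insert i P.support := by
  intro j hj
  rw [Finset.mem_insert]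
  by_cases h : j = i
  · exact Or.inl h
  · rw [mem_support, mulAt, Function.update_of_ne h] at hj
    exact Or.inr (mem_support.2 hj)

lemma support_subset_mulAt (i : Q) (a : Fin 3) (P : PauliString Q) :
    P.support ⊆ insert i (mulAt i a P).support := by
  simpa only [mulAt_mulAt] using support_mulAt_subset i a (mulAt i a P)

lemma support_mulAt_of_notMem {i : Q} (a : Fin 3) {P : PauliString Q} (h : i ∉ P.support) :
    (mulAt i a P).support = insert i P.support := by
  refine (support_mulAt_subset i a P).antisymm ?_
  intro j hj
  rcases Finset.mem_insert.1 hj with rfl | hj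
  · rw [mem_support, not_not] at h
    simp [mem_support, mulAt, h, pauliMul]
  · have hji : j ≠ i := fun e => h (e ▸ hj)
    rw [mem_support] at hj ⊢
    rwa [mulAt, Function.update_of_ne hji]

lemma card_support_le (s : Finset Q) :
    (Finset.univ.filter fun P : PauliString Q => P.support = s).card ≤ 4 ^ s.card := by
  have h1 : (Finset.univ : Finset (s → Option (Fin 3))).card = 4 ^ s.card := by
    rw [Finset.card_univ, Fintype.card_fun, Fintype.card_option, Fintype.card_fin,
      Fintype.card_coe]
  rw [← h1]
  refine Finset.card_le_card_of_injOn (fun P i => P i) (fun _ _ => Finset.mem_univ _) ?_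
  intro P hP P' hP' h
  simp only [Finset.coe_filter, Finset.mem_univ, true_and, Set.mem_ofPred_eq] at hP hP'
  ext1 i
  by_cases hi : i ∈ s
  · exact congrFun h ⟨i, hi⟩
  · have e1 : P i = none := by
      by_contra h'
      exact hi (hP ▸ mem_support.2 h')
    have e2 : P' i = none := by
      by_contra h'
      exact hi (hP' ▸ mem_support.2 h')
    rw [e1, e2]

lemma star_op (P : PauliString Q) : star P.op = P.op := by
  rw [op, star_tensorOp]
  congr 1
  ext1 i
  rcases P i with _ | a
  · simp
  · exact star_pauli a

lemma op_none : op (fun _ : Q => none) = 1 := tensorOp_one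

lemma support_none : support (fun _ : Q => none) = ∅ := by
  ext i
  simp [support]

lemma sum_mulAt {E : Type*} [AddCommMonoid E] (i : Q) (a : Fin 3) (F : PauliString Q → E) :
    ∑ P, F (mulAt i a P) = ∑ P, F P :=
  Function.Bijective.sum_comp (Function.Involutive.bijective (mulAt_mulAt i a)) F

lemma site_mul_sum (i : Q) (a : Fin 3) (f : PauliString Q → ℂ) :
    toOp (site i (pauli a)) * ∑ P, f P • toOp P.op =
      ∑ P : PauliString Q, (f (mulAt i a P) * pauliPhase a (mulAt i a P i)) • toOp P.op := by
  rw [← sum_mulAt i a (fun P => (f (mulAt i a P) * pauliPhase a (mulAt i a P i)) • toOp P.op),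
    Finset.mul_sum]
  refine Finset.sum_congr rfl fun P _ => ?_
  rw [mulAt_mulAt, mul_smul_comm, ← map_mul, site_mul_op, map_smul, smul_smul]

end PauliString

open PauliString

/-- Operators with a Pauli expansion of degree at most `k` on a block of `M` qubits, in which the
coefficient of every string of degree `l` is at most `c / M ^ l`. -/
def PauliClass {M : ℕ} (e : Fin M → Q) (k : ℕ) (c : ℝ) (Y : State Q →L[ℂ] State Q) : Prop :=
  ∃ f : PauliString Q → ℂ, Y = ∑ P, f P • toOp P.op ∧
    (∀ P, f P ≠ 0 → P.support.card ≤ k ∧ ∀ i ∈ P.support, ∃ l, e l = i) ∧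
    ∀ P, ‖f P‖ ≤ c * ((M : ℝ)⁻¹) ^ P.support.card

namespace PauliClass

variable {M k : ℕ} {e : Fin M → Q} {c c' : ℝ} {Y Y' : State Q →L[ℂ] State Q}

lemma mono {k' : ℕ} (h : PauliClass e k c Y) (hk : k ≤ k') (hc : c ≤ c') : PauliClass e k' c' Y := by
  obtain ⟨f, h1, h2, h3⟩ := h
  exact ⟨f, h1, fun P hP => ⟨(h2 P hP).1.trans hk, (h2 P hP).2⟩,
    fun P => (h3 P).trans (mul_le_mul_of_nonneg_right hc (by positivity))⟩

lemma add (h : PauliClass e k c Y) (h' : PauliClass e k c' Y') : PauliClass e k (c + c') (Y + Y') := by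
  obtain ⟨f, rfl, h2, h3⟩ := h
  obtain ⟨f', rfl, h2', h3'⟩ := h'
  refine ⟨fun P => f P + f' P, ?_, fun P hP => ?_, fun P => ?_⟩
  · rw [← Finset.sum_add_distrib]
    exact Finset.sum_congr rfl fun P _ => (add_smul _ _ _).symm
  · by_cases h0 : f P = 0
    · refine h2' P fun h0' => hP ?_
      simp only [h0, h0', add_zero]
    · exact h2 P h0
  · rw [add_mul]
    exact (norm_add_le _ _).trans (add_le_add (h3 P) (h3' P))

lemma smul (r : ℂ) (h : PauliClass e k c Y) : PauliClass e k (‖r‖ * c) (r • Y) := by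
  obtain ⟨f, rfl, h2, h3⟩ := h
  refine ⟨fun P => r * f P, ?_, fun P hP => h2 P (right_ne_zero_of_mul hP), fun P => ?_⟩
  · simp only [Finset.smul_sum, smul_smul]
  · rw [norm_mul, mul_assoc]
    exact mul_le_mul_of_nonneg_left (h3 P) (norm_nonneg r)

lemma sub (h : PauliClass e k c Y) (h' : PauliClass e k c' Y') : PauliClass e k (c + c') (Y - Y') := by
  have := h.add (h'.smul (-1))
  have e1 : (-1 : ℂ) • Y' = -Y' := neg_one_smul ℂ Y'
  rwa [norm_neg, norm_one, one_mul, e1, ← sub_eq_add_neg] at this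

lemma one : PauliClass e 0 1 (1 : State Q →L[ℂ] State Q) := by
  refine ⟨fun P => if P = fun _ => none then 1 else 0, ?_, fun P hP => ?_, fun P => ?_⟩
  · rw [Finset.sum_eq_single (fun _ => none)]
    · simp only [if_true, one_smul]
      rw [op_none, map_one]
    · intro (P : PauliString Q) _ h
      simp only [if_neg h]
      ext1 φ
      exact zero_smul ℂ (toOp P.op φ)
    · simp
  · have : P = fun _ => none := by
      by_contra h
      exact hP (if_neg h)
    rw [this, support_none]
    simp
  · by_cases h : P = fun _ => none
    · subst h
      simp [support_none]
    · simp only [if_neg h, norm_zero]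
      positivity

lemma sum {ι : Type} (s : Finset ι) {c : ι → ℝ} {Y : ι → State Q →L[ℂ] State Q}
    (h : ∀ i ∈ s, PauliClass e k (c i) (Y i)) : PauliClass e k (∑ i ∈ s, c i) (∑ i ∈ s, Y i) := by
  classical
  induction s using Finset.induction_on with
  | empty =>
    have := (one (e := e)).smul (0 : ℂ)
    have e1 : (0 : ℂ) • (1 : State Q →L[ℂ] State Q) = 0 :=
      ContinuousLinearMap.ext fun φ => zero_smul ℂ φ
    rw [e1, norm_zero, zero_mul] at this
    simpa using this.mono (Nat.zero_le k) le_rfl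
  | insert i s hi ih =>
    rw [Finset.sum_insert hi, Finset.sum_insert hi]
    exact (h i (Finset.mem_insert_self i s)).add
      (ih fun j hj => h j (Finset.mem_insert_of_mem hj))

lemma avg_mul (hM : 0 < M) (he : Function.Injective e) (hc : 0 ≤ c) (a : Fin 3)
    (h : PauliClass e k c Y) :
    PauliClass e (k + 1) ((k + 2) * c) (toOp (avg e (pauli a)) * Y) := by
  obtain ⟨f, rfl, h2, h3⟩ := h
  have hM' : (0 : ℝ) < M := by exact_mod_cast hM
  have deg : ∀ P l, f (mulAt (e l) a P) ≠ 0 →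
      P.support.card ≤ k + 1 ∧ ∀ i ∈ P.support, ∃ l, e l = i := by
    intro P l h
    refine ⟨?_, fun i hi => ?_⟩
    · have h1 := Finset.card_le_card (support_subset_mulAt (e l) a P)
      have h4 := Finset.card_insert_le (e l) (mulAt (e l) a P).support
      have := (h2 _ h).1
      omega
    · rcases Finset.mem_insert.1 (support_subset_mulAt (e l) a P hi) with rfl | hi
      · exact ⟨l, rfl⟩
      · exact (h2 _ h).2 i hi
  refine ⟨fun P => (M : ℂ)⁻¹ * ∑ l, f (mulAt (e l) a P) * pauliPhase a (mulAt (e l) a P (e l)),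
    ?_, fun P hP => ?_, fun P => ?_⟩
  · rw [avg, map_smul, map_sum, smul_mul_assoc, Finset.sum_mul]
    simp only [site_mul_sum]
    rw [Finset.sum_comm, Finset.smul_sum]
    refine Finset.sum_congr rfl fun P _ => ?_
    rw [← Finset.sum_smul, smul_smul]
  · obtain ⟨l, -, hl⟩ := Finset.exists_ne_zero_of_sum_ne_zero (right_ne_zero_of_mul hP)
    exact deg P l (left_ne_zero_of_mul hl)
  · by_cases hk : P.support.card ≤ k + 1
    · rw [norm_mul, norm_inv, Complex.norm_natCast, inv_mul_le_iff₀ hM']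
      -- A qubit outside the support of `P` comes from a string of larger degree. One inside the
      -- support, of which there are at most `k + 1`, may come from a string of degree one less,
      -- which costs a factor `M`. After division by `M` the contributions are `c` and `(k + 1) *
      -- c`.
      have key : ∀ l, ‖f (mulAt (e l) a P) * pauliPhase a (mulAt (e l) a P (e l))‖ ≤
          c * (M : ℝ)⁻¹ ^ P.support.card + if e l ∈ P.support then
            M * (c * (M : ℝ)⁻¹ ^ P.support.card) else 0 := by
        intro l
        rw [norm_mul, norm_pauliPhase, mul_one]
        have hinv : (M : ℝ)⁻¹ ≤ 1 := inv_le_one_of_one_le₀ (by exact_mod_cast hM)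
        refine (h3 _).trans ?_
        split_ifs with hl
        · have h1 := Finset.card_le_card (support_subset_mulAt (e l) a P)
          have h4 := Finset.card_insert_le (e l) (mulAt (e l) a P).support
          have h5 : (M : ℝ)⁻¹ ^ (mulAt (e l) a P).support.card ≤ M * (M : ℝ)⁻¹ ^ P.support.card := by
            have : M * (M : ℝ)⁻¹ ^ ((mulAt (e l) a P).support.card + 1) =
                (M : ℝ)⁻¹ ^ (mulAt (e l) a P).support.card := by
              rw [pow_succ]
              field_simp
            rw [← this]
            refine mul_le_mul_of_nonneg_left ?_ hM'.le
            exact pow_le_pow_of_le_one (by positivity) hinv (by omega)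
          have h6 := mul_le_mul_of_nonneg_left h5 hc
          have : 0 ≤ c * (M : ℝ)⁻¹ ^ P.support.card := by positivity
          linarith [mul_left_comm c (M : ℝ) ((M : ℝ)⁻¹ ^ P.support.card)]
        · rw [support_mulAt_of_notMem a hl, Finset.card_insert_of_notMem hl, add_zero]
          exact mul_le_mul_of_nonneg_left
            (pow_le_pow_of_le_one (by positivity) hinv (Nat.le_succ _)) hc
      refine (norm_sum_le _ _).trans ((Finset.sum_le_sum fun l _ => key l).trans ?_)
      rw [Finset.sum_add_distrib, ← Finset.sum_filter, Finset.sum_const, Finset.sum_const,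
        Finset.card_univ, Fintype.card_fin, nsmul_eq_mul, nsmul_eq_mul]
      have hcard : (Finset.univ.filter fun l => e l ∈ P.support).card ≤ P.support.card :=
        Finset.card_le_card_of_injOn e (fun l hl => (Finset.mem_filter.1 hl).2) he.injOn
      have hcard' : ((Finset.univ.filter fun l => e l ∈ P.support).card : ℝ) ≤ k + 1 := by
        exact_mod_cast hcard.trans hk
      have hx : 0 ≤ M * (c * (M : ℝ)⁻¹ ^ P.support.card) := by positivity
      nlinarith [mul_le_mul_of_nonneg_right hcard' hx]
    · have : ∑ l, f (mulAt (e l) a P) * pauliPhase a (mulAt (e l) a P (e l)) = 0 := by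
        by_contra h
        obtain ⟨l, -, hl⟩ := Finset.exists_ne_zero_of_sum_ne_zero h
        exact hk (deg P l (left_ne_zero_of_mul hl)).1
      simp only [this, mul_zero, norm_zero]
      positivity

end PauliClass

lemma pauliClass_avg {M : ℕ} {e : Fin M → Q} (hM : 0 < M) (he : Function.Injective e) (a : Fin 3) :
    PauliClass e 1 2 (toOp (avg e (pauli a))) := by
  have := PauliClass.one.avg_mul hM he zero_le_one a
  simpa using this

lemma star_lowering : star lowering = 1 - pauli 2 - (-Complex.I) • pauli 0 := by
  simp [lowering, star_sub, star_pauli, star_smul]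

/-- The base is the average of `lowering` for `z = i` and its adjoint for `z = -i`. The constant
depends neither on `M` nor on the set of qubits. -/
lemma pauliClass_pow (z : ℂ) (hz : ‖z‖ = 1) (k : ℕ) : ∃ c, 0 ≤ c ∧
    ∀ {Q : Type} [Fintype Q] [DecidableEq Q] {M : ℕ} (e : Fin M → Q), 0 < M → Function.Injective e →
      PauliClass e k c (toOp (avg e (1 - pauli 2 - z • pauli 0)) ^ k) := by
  induction k with
  | zero => exact ⟨1, zero_le_one, fun e _ _ => by simpa using PauliClass.one⟩
  | succ k ih =>
    obtain ⟨c, hc, h⟩ := ih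
    refine ⟨c + (k + 2) * c + ‖z‖ * ((k + 2) * c), by positivity, fun e hM he => ?_⟩
    have hY := h e hM he
    rw [pow_succ']
    nth_rewrite 1 [avg_sub, avg_sub, avg_smul, avg_one hM]
    rw [map_sub, map_sub, map_smul, map_one, sub_mul, sub_mul, one_mul, smul_mul_assoc]
    exact ((hY.mono k.le_succ le_rfl).sub (hY.avg_mul hM he hc 2)).sub
      ((hY.avg_mul hM he hc 0).smul z)

lemma pauliClass_angle (m : ℕ) : ∃ c, 0 ≤ c ∧
    ∀ {Q : Type} [Fintype Q] [DecidableEq Q] {M : ℕ} (e : Fin M → Q), 0 < M → Function.Injective e →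
      PauliClass e m c (angle m (toOp (avg e lowering))) := by
  choose c hc h using pauliClass_pow Complex.I (by simp)
  choose c' hc' h' using pauliClass_pow (-Complex.I) (by simp)
  refine ⟨‖Complex.I / 2‖ * ∑ k ∈ Finset.range m, ‖(((k + 1 : ℕ) : ℂ))⁻¹‖ * (c (k + 1) + c' (k + 1)), ?_,
    fun e hM he => ?_⟩
  · refine mul_nonneg (norm_nonneg _) (Finset.sum_nonneg fun k _ => ?_)
    have := hc (k + 1)
    have := hc' (k + 1)
    positivity
  · rw [angle]
    refine PauliClass.smul _ (PauliClass.sum _ fun k hk => ?_)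
    have hk := Finset.mem_range.1 hk
    have e1 : ((k : ℂ) + 1)⁻¹ = (((k + 1 : ℕ) : ℂ))⁻¹ := by push_cast; rfl
    rw [e1]
    refine PauliClass.smul _ (PauliClass.sub ((h (k + 1) e hM he).mono hk le_rfl) ?_)
    rw [← map_star, star_avg, star_lowering]
    exact (h' (k + 1) e hM he).mono hk le_rfl

end PauliStrings

lemma evol_conj {E : Type} [NormedAddCommGroup E] [InnerProductSpace ℂ E] [CompleteSpace E]
    {V V' : E →L[ℂ] E} (h : V' * V = 1) (h' : V * V' = 1) (X : E →L[ℂ] E) (s : ℝ) :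
    evol (V' * X * V) s = V' * evol X s * V := by
  let _ : NormedAlgebra ℚ (E →L[ℂ] E) := .restrictScalars ℚ ℂ _
  have := NormedSpace.exp_units_conj ⟨V', V, h, h'⟩ (s • (-Complex.I • X))
  simp only [Units.inv_mk] at this
  rw [evol, evol, ← this]
  simp only [mul_smul_comm, smul_mul_assoc]

/-! ### Pulses with collective spins and with amplified angles. -/

section Pulses

variable {Q : Type} [Fintype Q] [DecidableEq Q]

open PauliString

/-- The sum of a Pauli matrix over a set of qubits. -/
noncomputable def total (I : Finset Q) (a : Fin 3) : State Q →L[ℂ] State Q :=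
  toOp (∑ i ∈ I, site i (pauli a))

lemma star_total (I : Finset Q) (a : Fin 3) : star (total I a) = total I a := by
  rw [total, ← map_star, star_sum]
  simp only [star_site, star_pauli]

lemma PauliString.commute_site_op {i : Q} {P : PauliString Q} (h : i ∉ P.support) (a : Fin 3) :
    Commute (site i (pauli a)) P.op := by
  have h1 : site i (pauli a) * P.op = (mulAt i a P).op := by
    rw [mem_support, not_not] at h
    rw [site_mul_op, h, pauliPhase, one_smul]
  have h2 := congrArg star h1
  rw [star_mul, star_op, star_op, star_site, star_pauli] at h2
  rw [Commute, SemiconjBy, h1, h2]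

lemma PauliClass.commute_total {M k : ℕ} {e : Fin M → Q} {c : ℝ} {Y : State Q →L[ℂ] State Q}
    (h : PauliClass e k c Y) {I : Finset Q} (hI : ∀ i ∈ I, ∀ l, i ≠ e l) (a : Fin 3) :
    Commute (total I a) Y := by
  obtain ⟨f, rfl, h2, -⟩ := h
  rw [total, map_sum]
  refine Commute.sum_left _ _ _ fun i hi => Commute.sum_right _ _ _ fun P _ => ?_
  by_cases hP : f P = 0
  · rw [hP]
    have : (0 : ℂ) • toOp P.op = 0 := ContinuousLinearMap.ext fun φ => zero_smul ℂ (toOp P.op φ)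
    rw [this]
    exact Commute.zero_right _
  · refine Commute.smul_right ?_ _
    refine (commute_site_op (fun hs => ?_) a).map toOp
    obtain ⟨l, hl⟩ := (h2 P hP).2 i hs
    exact hI i hi l hl.symm

/-- Couplings of a protocol are real. Pauli strings are self-adjoint, so averaging the expansion
with its adjoint takes the real parts of the coefficients, without appeal to the uniqueness of the
expansion. -/
lemma toOp_sum_eq_re {f : PauliString Q → ℂ} (h : IsSelfAdjoint (toOp (∑ P, f P • P.op))) :
    toOp (∑ P, f P • P.op) = toOp (∑ P, ((f P).re : ℂ) • P.op) := by
  have h1 : star (∑ P, f P • P.op) = ∑ P, f P • P.op := by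
    have := h.star_eq
    rw [← map_star] at this
    exact toOp.injective this
  rw [star_sum] at h1
  simp only [star_smul, star_op] at h1
  congr 1
  have h2 : (2 : ℂ) • ∑ P, f P • P.op = (2 : ℂ) • ∑ P, ((f P).re : ℂ) • P.op := by
    rw [two_smul]
    nth_rewrite 1 [← h1]
    rw [← Finset.sum_add_distrib, Finset.smul_sum]
    refine Finset.sum_congr rfl fun P _ => ?_
    rw [← add_smul, smul_smul]
    congr 1
    rw [add_comm]
    exact_mod_cast Complex.add_conj (f P)
  exact smul_right_injective _ two_ne_zero h2

/-- A collective pulse: a sum of Pauli matrices times an operator on a block of `M` qubits. -/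
theorem PauliClass.reach_total {M k K : ℕ} {e : Fin M → Q} {c ρ Θ θ : ℝ}
    {Y : State Q →L[ℂ] State Q} (h : PauliClass e k c Y) (hY : IsSelfAdjoint Y) {I : Finset Q}
    (hI : ∀ i ∈ I, ∀ l, i ≠ e l) (a : Fin 3) (hM : 0 < M) (hc : 0 < c) (hΘ : 0 < Θ) (hθ : |θ| ≤ Θ)
    (hK : k + 1 ≤ K) (hρ : 1 ≤ ρ) (hN : (Fintype.card Q : ℝ) ≤ ρ * M) :
    Reach K (4 ^ K * ρ ^ K * c * Θ / M) (evol ((θ : ℂ) • (total I a * Y)) 1) := by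
  have hcomm := h.commute_total hI a
  obtain ⟨f, rfl, h2, h3⟩ := h
  have hM' : (0 : ℝ) < M := by exact_mod_cast hM
  set F : PauliString Q → ℂ := fun P =>
    θ * ∑ i ∈ I, f (mulAt i a P) * pauliPhase a (mulAt i a P i) with hF
  have hsum : (θ : ℂ) • (total I a * ∑ P, f P • toOp P.op) = toOp (∑ P, F P • P.op) := by
    rw [total, map_sum, Finset.sum_mul]
    simp only [site_mul_sum]
    rw [Finset.sum_comm, Finset.smul_sum, map_sum]
    refine Finset.sum_congr rfl fun P _ => ?_
    rw [← Finset.sum_smul, smul_smul, map_smul]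
  have hsa : IsSelfAdjoint (toOp (∑ P, F P • P.op)) := by
    rw [← hsum, IsSelfAdjoint, star_smul, star_mul, hY.star_eq, star_total, hcomm.eq]
    simp
  rw [hsum, toOp_sum_eq_re hsa]
  have hnot : ∀ P, ∀ i ∈ I, f (mulAt i a P) ≠ 0 → i ∉ (mulAt i a P).support := by
    intro P i hi hP hs
    obtain ⟨l, hl⟩ := (h2 _ hP).2 i hs
    exact hI i hi l hl.symm
  have hsupp : ∀ P, ∀ i ∈ I, f (mulAt i a P) ≠ 0 →
      P.support = insert i (mulAt i a P).support := by
    intro P i hi hP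
    simpa only [mulAt_mulAt] using support_mulAt_of_notMem a (hnot P i hi hP)
  have hcard : ∀ P, ∀ i ∈ I, f (mulAt i a P) ≠ 0 →
      P.support.card = (mulAt i a P).support.card + 1 := by
    intro P i hi hP
    rw [hsupp P i hi hP, Finset.card_insert_of_notMem (hnot P i hi hP)]
  have hF0 : ∀ P, F P ≠ 0 → ∃ i ∈ I, f (mulAt i a P) ≠ 0 := by
    intro P hP
    obtain ⟨i, hi, h⟩ := Finset.exists_ne_zero_of_sum_ne_zero (right_ne_zero_of_mul hP)
    exact ⟨i, hi, left_ne_zero_of_mul h⟩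
  have hzero : ∀ P, (¬ ∃ i ∈ I, f (mulAt i a P) ≠ 0) → (F P).re = 0 := by
    intro P hP
    by_contra h
    exact hP (hF0 P fun h0 => h (by rw [h0, Complex.zero_re]))
  have hbound : ∀ P, 2 ≤ P.support.card →
      |(F P).re| ≤ Θ * (c * (M * (M : ℝ)⁻¹ ^ P.support.card)) := by
    intro P _
    refine (Complex.abs_re_le_norm _).trans ?_
    by_cases hP : ∃ i ∈ I, f (mulAt i a P) ≠ 0
    · obtain ⟨i, hi, hP⟩ := hP
      -- A contributing string consists of one qubit of `I` and qubits of the block, and `I` is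
      -- disjoint from the block. So a single `i` contributes, and no coefficient grows with the
      -- size of `I`.
      have hone : ∑ i ∈ I, f (mulAt i a P) * pauliPhase a (mulAt i a P i) =
          f (mulAt i a P) * pauliPhase a (mulAt i a P i) := by
        refine Finset.sum_eq_single i (fun j hj hji => ?_) (fun h => absurd hi h)
        by_contra h
        have hj' := left_ne_zero_of_mul h
        have h1 : i ∈ P.support := by
          rw [hsupp P i hi hP]
          exact Finset.mem_insert_self i _
        rw [hsupp P j hj hj'] at h1
        rcases Finset.mem_insert.1 h1 with h1 | h1
        · exact hji h1.symm
        · obtain ⟨l, hl⟩ := (h2 _ hj').2 i h1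
          exact hI i hi l hl.symm
      simp only [hF]
      rw [hone, norm_mul, norm_mul, norm_pauliPhase, mul_one, Complex.norm_real, Real.norm_eq_abs]
      refine mul_le_mul hθ ((h3 _).trans ?_) (norm_nonneg _) hΘ.le
      refine mul_le_mul_of_nonneg_left (le_of_eq ?_) hc.le
      rw [hcard P i hi hP, pow_succ]
      field_simp
    · have : F P = 0 := by
        by_contra h
        exact hP (hF0 P h)
      rw [this, norm_zero]
      positivity
  refine reach_pulse (by positivity) _ (fun P hP => hzero P ?_) (fun P hP => hzero P ?_)
    fun s h2s hsK => ?_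
  · rintro ⟨i, hi, h⟩
    have := hcard P i hi h
    have := (h2 _ h).1
    omega
  · rintro ⟨i, hi, h⟩
    have := hcard P i hi h
    rw [hP, Finset.card_empty] at this
    omega
  · have hNpos : (0 : ℝ) < Fintype.card Q := by
      have := s.card_le_univ
      have : 0 < Fintype.card Q := by omega
      exact_mod_cast this
    have h1 : ∑ P : PauliString Q with P.support = s, |(F P).re| ≤
        4 ^ K * (Θ * (c * (M * (M : ℝ)⁻¹ ^ s.card))) := by
      have : ∀ P ∈ Finset.univ.filter (fun P : PauliString Q => P.support = s),
          |(F P).re| ≤ Θ * (c * (M * (M : ℝ)⁻¹ ^ s.card)) := by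
        intro P hP
        have hP := (Finset.mem_filter.1 hP).2
        rw [← hP]
        exact hbound P (by rwa [hP])
      refine (Finset.sum_le_card_nsmul _ _ _ this).trans ?_
      rw [nsmul_eq_mul]
      refine mul_le_mul_of_nonneg_right ?_ (by positivity)
      have h4 : ((Finset.univ.filter fun P : PauliString Q => P.support = s).card : ℝ) ≤ 4 ^ s.card := by
        exact_mod_cast card_support_le s
      exact h4.trans (pow_le_pow_right₀ (by norm_num) hsK)
    refine h1.trans ?_
    -- On a set of `2 + l` qubits the coefficients are of order `M ^ (-1 - l)` and the allowed
    -- strength is of order `M ^ (-l)`, up to powers of `ρ`. Hence a time of order `1 / M` suffices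
    -- for every `l`.
    obtain ⟨l, hl⟩ := Nat.exists_eq_add_of_le h2s
    have h5 : (Fintype.card Q : ℝ) ^ (2 - (s.card : ℤ)) = ((Fintype.card Q : ℝ) ^ l)⁻¹ := by
      rw [hl, ← zpow_natCast, ← zpow_neg]
      congr 1
      push_cast
      ring
    rw [h5, hl]
    have h6 : (Fintype.card Q : ℝ) ^ l ≤ ρ ^ K * (M : ℝ) ^ l := by
      refine (pow_le_pow_left₀ hNpos.le hN l).trans ?_
      rw [mul_pow]
      exact mul_le_mul_of_nonneg_right (pow_le_pow_right₀ hρ (by omega)) (by positivity)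
    rw [← div_eq_mul_inv, le_div_iff₀ (by positivity)]
    calc 4 ^ K * (Θ * (c * (M * (M : ℝ)⁻¹ ^ (2 + l)))) * (Fintype.card Q : ℝ) ^ l
        ≤ 4 ^ K * (Θ * (c * (M * (M : ℝ)⁻¹ ^ (2 + l)))) * (ρ ^ K * (M : ℝ) ^ l) := by gcongr
      _ = 4 ^ K * ρ ^ K * c * Θ / M := by
        rw [inv_pow, pow_add]
        field_simp

lemma natCast_smul_avg {M : ℕ} (hM : 0 < M) {f : Fin M → Q} (hf : Function.Injective f) (a : Fin 3)
    (r : ℝ) : ((r * M : ℝ) : ℂ) • toOp (avg f (pauli a)) =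
      (r : ℂ) • total (Finset.univ.image f) a := by
  have : (M : ℂ) ≠ 0 := by exact_mod_cast hM.ne'
  rw [total, Finset.sum_image hf.injOn, avg, map_smul, smul_smul]
  congr 1
  push_cast
  field_simp

/-- Pulses with an amplified angle. -/
theorem reach_chain {M m K J : ℕ} {e : Fin M → Q} {f : ℕ → Fin M → Q} {c ρ g Θ : ℝ}
    {Y : State Q →L[ℂ] State Q} (hY : PauliClass e m c Y) (hYsa : IsSelfAdjoint Y)
    (hX : ∀ j < J, PauliClass (f j) m c (angle m (toOp (avg (f j) lowering))))
    (hf : ∀ j < J, Function.Injective (f j)) (hef : ∀ j < J, ∀ k l, f j k ≠ e l)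
    (hff : ∀ i < J, ∀ j < J, i ≠ j → ∀ k l, f i k ≠ f j l)
    (hM : 0 < M) (hc : 0 < c) (hΘ : 0 < Θ) (hg0 : 0 ≤ g) (hg : g ≤ Θ)
    (hK : m + 1 ≤ K) (hρ : 1 ≤ ρ) (hN : (Fintype.card Q : ℝ) ≤ ρ * M)
    {j : ℕ} (hj : j ≤ J) {I : Finset Q} (a : Fin 3) {θ : ℝ} (hθ : |θ| ≤ Θ)
    (hIe : ∀ i ∈ I, ∀ l, i ≠ e l) (hIf : ∀ i ∈ I, ∀ j' < j, ∀ l, i ≠ f j' l) :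
    Reach K ((2 ^ (j + 1) - 1) * (4 ^ K * ρ ^ K * c * Θ / M)) (evol ((θ : ℂ) • (total I a *
      chain M g m Y (fun i => toOp (avg (f i) lowering)) (fun i => toOp (avg (f i) (pauli 1))) j)) 1) := by
  induction j generalizing I a θ with
  | zero =>
    have := hY.reach_total hYsa hIe a hM hc hΘ hθ hK hρ hN
    simpa [chain, show (2 : ℝ) - 1 = 1 by norm_num] using this
  | succ j ih =>
    have hj' : j < J := hj
    set D : ℕ → State Q →L[ℂ] State Q := fun i => toOp (avg (f i) lowering) with hD
    set t : ℕ → State Q →L[ℂ] State Q := fun i => toOp (avg (f i) (pauli 1)) with ht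
    set τ := 4 ^ K * ρ ^ K * c * Θ / M with hτ
    -- a total Pauli operator commutes with the chain if it lives on other qubits
    have comm_letters : ∀ (I : Finset Q) (a : Fin 3) (i : ℕ), (∀ q ∈ I, ∀ l, q ≠ f i l) →
        ∀ x ∈ letters (D i) (t i), Commute (total I a) x := by
      intro I a i hI x hx
      have hc : ∀ n, Commute (total I a) (toOp (avg (f i) n)) := fun n =>
        (Commute.sum_left _ _ _ fun q hq => site_avg_commute (hI q hq) (pauli a) n).map toOp
      rcases hx with rfl | rfl | rfl <;> (try simp only [hD, ht, ← map_star, star_avg]) <;> exact hc _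
    have comm_chain : ∀ (I : Finset Q) (a : Fin 3), (∀ q ∈ I, ∀ l, q ≠ e l) →
        (∀ q ∈ I, ∀ i < j, ∀ l, q ≠ f i l) → Commute (total I a) (chain M g m Y D t j) := by
      intro I a h1 h2
      exact commute_chain (hY.commute_total h1 a) fun i hi =>
        comm_letters I a i fun q hq l => h2 q hq i hi l
    set I' := Finset.univ.image (f j) with hI'
    have hI'e : ∀ i ∈ I', ∀ l, i ≠ e l := by
      intro i hi l
      obtain ⟨k, -, rfl⟩ := Finset.mem_image.1 hi
      exact hef j hj' k l
    have hI'f : ∀ i ∈ I', ∀ j' < j, ∀ l, i ≠ f j' l := by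
      intro i hi j' hjj l
      obtain ⟨k, -, rfl⟩ := Finset.mem_image.1 hi
      exact hff j hj' j' (hjj.trans hj') hjj.ne' k l
    -- Since `M * t j` is a total Pauli operator over block `j`, the conjugating evolution is itself
    -- a pulse with the shorter chain, with block `j` in the role of `I`. The induction hypothesis
    -- covers it because `I` is arbitrary.
    have hgen : ((g / 2 * M : ℝ) : ℂ) • (chain M g m Y D t j * t j) =
        ((g / 2 : ℝ) : ℂ) • (total I' 1 * chain M g m Y D t j) := by
      rw [(comm_chain I' 1 hI'e hI'f).eq, ← mul_smul_comm, ← mul_smul_comm, ht,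
        natCast_smul_avg hM (hf j hj')]
    set G := ((g / 2 : ℝ) : ℂ) • (total I' 1 * chain M g m Y D t j) with hG
    have hV : Reach K ((2 ^ (j + 1) - 1) * τ) (evol G 1) :=
      ih hj'.le 1 (by rw [abs_of_nonneg (by positivity)]; linarith) hI'e hI'f
    have hV' : Reach K ((2 ^ (j + 1) - 1) * τ) (evol G (-1)) := by
      have := ih hj'.le (θ := -(g / 2)) 1
        (by rw [abs_neg, abs_of_nonneg (by positivity)]; linarith) hI'e hI'f
      have e1 : ((-(g / 2) : ℝ) : ℂ) • (total I' 1 * chain M g m Y D t j) = ((-1 : ℝ) : ℂ) • G := by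
        rw [hG, smul_smul]
        congr 1
        push_cast
        ring
      rwa [e1, evol_smul, one_mul] at this
    have hIj : ∀ q ∈ I, ∀ l, q ≠ f j l := fun q hq l => hIf q hq j (Nat.lt_succ_self j) l
    have hcG : Commute (total I a) G := by
      rw [← hgen]
      refine ((comm_chain I a hIe fun q hq i hi l => hIf q hq i (hi.trans (Nat.lt_succ_self j)) l).mul_right
        ?_).smul_right _
      exact comm_letters I a j hIj _ (Or.inr (Or.inr rfl))
    have hX' := (hX j hj').reach_total (isSelfAdjoint_angle m _) hIj a hM hc hΘ hθ hK hρ hN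
    have hfin := (hV.mul hX').mul hV'
    -- Two pulses with the shorter chain around one with the angle of mode `j`: the recursion `T (j
    -- + 1) = 2 * T j + τ`.
    have htime : (2 ^ (j + 1) - 1) * τ + 4 ^ K * ρ ^ K * c * Θ / M + (2 ^ (j + 1) - 1) * τ =
        (2 ^ (j + 1 + 1) - 1) * τ := by
      rw [← hτ]
      ring
    rw [htime] at hfin
    have e2 : (θ : ℂ) • (total I a * chain M g m Y D t (j + 1)) =
        evol G (-1) * ((θ : ℂ) • (total I a * angle m (D j))) * evol G 1 := by
      rw [chain, hgen, mul_smul_comm, smul_mul_assoc]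
      congr 1
      rw [← mul_assoc, ← mul_assoc, (AllToAll.Commute.evol_right hcG (-1)).eq]
      simp only [mul_assoc]
    rw [e2, evol_conj (evol_neg_mul G 1) (evol_mul_neg G 1), mul_assoc]
    exact hfin

end Pulses

/-! ### A two-qubit phase gate from four amplified pulses. -/

section Gate

variable {A B : Type} [Fintype A] [DecidableEq A] [Fintype B] [DecidableEq B]

lemma total_singleton {Q : Type} [Fintype Q] [DecidableEq Q] (i : Q) (a : Fin 3) :
    total {i} a = toOp (site i (pauli a)) := by
  rw [total, Finset.sum_singleton]

lemma norm_evol_total_mul {Q : Type} [Fintype Q] [DecidableEq Q] {i : Q} {a : Fin 3}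
    {R : State Q →L[ℂ] State Q} (hR : IsSelfAdjoint R)
    (h : Commute (toOp (site i (pauli a))) R) (r : ℝ) (φ : State Q) :
    ‖evol ((r : ℂ) • (toOp (site i (pauli a)) * R)) 1 φ‖ = ‖φ‖ := by
  refine norm_evol_apply ?_ 1 φ
  rw [IsSelfAdjoint, star_smul, star_mul, hR.star_eq, ← map_star, star_site, star_pauli, h.eq,
    RCLike.star_def, Complex.conj_ofReal]

/-- The evolution `exp (-i φ Z_a Z_b)` of two data qubits, by a group commutator of pulses with
amplified angles. -/
theorem exists_reach_zz (m J : ℕ) (hm : 1 ≤ m) : ∃ C c : ℝ, 0 ≤ C ∧ 0 < c ∧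
    ∀ (A B : Type) [Fintype A] [DecidableEq A] [Fintype B] [DecidableEq B] (M K : ℕ) (g u ρ : ℝ)
      (f : ℕ → Fin M → B) (a b : A), a ≠ b → 0 < M → (∀ i < 2 * J + 1, Function.Injective (f i)) →
      (∀ i < 2 * J + 1, ∀ j < 2 * J + 1, i ≠ j → ∀ k l, f i k ≠ f j l) →
      1 ≤ g → g ≤ u → u * g ^ J ≤ √M → m + 1 ≤ K → 1 ≤ ρ →
      (Fintype.card (A ⊕ B) : ℝ) ≤ ρ * M →
      ∃ W : State (A ⊕ B) →L[ℂ] State (A ⊕ B),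
        Reach K (4 * ((2 ^ (J + 1) - 1) * (4 ^ K * ρ ^ K * c * u / M))) W ∧
        (∀ φ, ‖W φ‖ = ‖φ‖) ∧
        ∀ ψ : State A, ‖ψ‖ ≤ 1 →
          ‖W (withAncillas B ψ) - evol (((2 * (u * g ^ J) ^ 2 / M : ℝ) : ℂ) •
            (toOp (site (Sum.inl a) (pauli 2)) * toOp (site (Sum.inl b) (pauli 2)))) 1
              (withAncillas B ψ)‖ ≤
          C * (u * g ^ (J * (m + 1)) * (√M)⁻¹ ^ (m + 1) + (√M)⁻¹ ^ m) := by
  obtain ⟨C, hC, hgate⟩ := exists_gate_error m J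
  obtain ⟨c, hc, hangle⟩ := pauliClass_angle m
  refine ⟨C, c + 2, hC, by linarith, ?_⟩
  intro A B _ _ _ _ M K g u ρ f a b hab hM hinj hdisj hg hgu hug hK hρ hN
  have hM' : (0 : ℝ) < M := by exact_mod_cast hM
  have hu : 0 < u := by linarith
  set F : ℕ → Fin M → A ⊕ B := fun i k => Sum.inr (f i k) with hF
  have hFinj : ∀ i < 2 * J + 1, Function.Injective (F i) := fun i hi =>
    Sum.inr_injective.comp (hinj i hi)
  have hFdisj : ∀ i < 2 * J + 1, ∀ j < 2 * J + 1, i ≠ j → ∀ k l, F i k ≠ F j l :=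
    fun i hi j hj hij k l h => hdisj i hi j hj hij k l (Sum.inr_injective h)
  set D : ℕ → State (A ⊕ B) →L[ℂ] State (A ⊕ B) := fun i => toOp (avg (F i) lowering) with hD
  set t : ℕ → State (A ⊕ B) →L[ℂ] State (A ⊕ B) := fun i => toOp (avg (F i) (pauli 1)) with ht
  have hfam : ModeFamily (2 * J + 1) M D t := modeFamily_avg hM F hFinj hFdisj
  have hcl : ∀ i : A, ∀ x ∈ allLetters (2 * J + 1) D t,
      Commute (toOp (site (Sum.inl i) (pauli 2))) x := fun i =>
    commute_allLetters_avg F (fun j _ k => Sum.inl_ne_inr) (pauli 2)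
  have hzsa : ∀ i : A, IsSelfAdjoint (toOp (site (Sum.inl i : A ⊕ B) (pauli 2))) := by
    intro i
    rw [IsSelfAdjoint, ← map_star, star_site, star_pauli]
  have hz1 : ∀ i : A, ‖toOp (site (Sum.inl i : A ⊕ B) (pauli 2))‖ ≤ 1 := fun i =>
    norm_toOp_site_le (by rw [star_pauli, pauli_mul_self]) _
  have hRA : ∀ r : ℝ, |r| ≤ u → Reach K ((2 ^ (J + 1) - 1) * (4 ^ K * ρ ^ K * (c + 2) * u / M))
      (evol ((r : ℂ) • (toOp (site (Sum.inl a) (pauli 2)) * chainA M g m J D t)) 1) := by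
    intro r hr
    rw [← total_singleton]
    refine reach_chain (e := F 0) (f := fun j => F (1 + j)) (J := J)
      ((hangle (F 0) hM (hFinj 0 (by omega))).mono le_rfl (by linarith)) (isSelfAdjoint_angle m _)
      (fun j hj => (hangle _ hM (hFinj _ (by omega))).mono le_rfl (by linarith))
      (fun j hj => hFinj _ (by omega)) (fun j hj => hFdisj _ (by omega) _ (by omega) (by omega))
      (fun i hi j hj hij => hFdisj _ (by omega) _ (by omega) (by omega)) hM (by linarith) hu
      (by linarith) hgu hK hρ hN le_rfl 2 hr ?_ ?_
    · intro i hi l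
      rw [Finset.mem_singleton.1 hi]
      exact Sum.inl_ne_inr
    · intro i hi j _ l
      rw [Finset.mem_singleton.1 hi]
      exact Sum.inl_ne_inr
  have hRB : ∀ r : ℝ, |r| ≤ u → Reach K ((2 ^ (J + 1) - 1) * (4 ^ K * ρ ^ K * (c + 2) * u / M))
      (evol ((r : ℂ) • (toOp (site (Sum.inl b) (pauli 2)) * chainB M g m J D t)) 1) := by
    intro r hr
    rw [← total_singleton]
    refine reach_chain (e := F 0) (f := fun j => F (J + 1 + j)) (J := J)
      -- The base `t 0` of the second chain has degree `1`, and `1 ≤ m` lets it pass as degree `m`.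
      ((pauliClass_avg hM (hFinj 0 (by omega)) 1).mono hm (by linarith))
      (hfam.mode 0 (by omega)).star_t
      (fun j hj => (hangle _ hM (hFinj _ (by omega))).mono le_rfl (by linarith))
      (fun j hj => hFinj _ (by omega)) (fun j hj => hFdisj _ (by omega) _ (by omega) (by omega))
      (fun i hi j hj hij => hFdisj _ (by omega) _ (by omega) (by omega)) hM (by linarith) hu
      (by linarith) hgu hK hρ hN le_rfl 2 hr ?_ ?_
    · intro i hi l
      rw [Finset.mem_singleton.1 hi]
      exact Sum.inl_ne_inr
    · intro i hi j _ l
      rw [Finset.mem_singleton.1 hi]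
      exact Sum.inl_ne_inr
  have hu1 : |u| ≤ u := (abs_of_pos hu).le
  have hu2 : |(-u)| ≤ u := by rw [abs_neg]; exact hu1
  have hcA : Commute (toOp (site (Sum.inl a) (pauli 2))) (chainA M g m J D t) := by
    refine commute_chain ?_ fun i hi x hx => hcl a x ⟨1 + i, by omega, hx⟩
    exact Commute.angle_right (hcl a _ ⟨0, by omega, Or.inl rfl⟩)
      (hcl a _ ⟨0, by omega, Or.inr (Or.inl rfl)⟩) m
  have hcB : Commute (toOp (site (Sum.inl b) (pauli 2))) (chainB M g m J D t) :=
    commute_chain (hcl b _ ⟨0, by omega, Or.inr (Or.inr rfl)⟩)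
      fun i hi x hx => hcl b x ⟨J + 1 + i, by omega, hx⟩
  have hsA : IsSelfAdjoint (chainA M g m J D t) := (hfam.isChain_angle hM' m).isSelfAdjoint le_rfl
  have hsB : IsSelfAdjoint (chainB M g m J D t) := (hfam.isChain_conj hM' m).isSelfAdjoint le_rfl
  set za := toOp (site (Sum.inl a : A ⊕ B) (pauli 2)) with hza
  set zb := toOp (site (Sum.inl b : A ⊕ B) (pauli 2)) with hzb
  have hcab : Commute za zb := (site_commute (fun h => hab (Sum.inl_injective h)) _ _).map toOp
  set VA : ℝ → State (A ⊕ B) →L[ℂ] State (A ⊕ B) := fun r =>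
    evol ((r : ℂ) • (za * chainA M g m J D t)) 1 with hVA
  set VB : ℝ → State (A ⊕ B) →L[ℂ] State (A ⊕ B) := fun r =>
    evol ((r : ℂ) • (zb * chainB M g m J D t)) 1 with hVB
  have nA : ∀ r φ, ‖VA r φ‖ = ‖φ‖ := norm_evol_total_mul hsA hcA
  have nB : ∀ r φ, ‖VB r φ‖ = ‖φ‖ := norm_evol_total_mul hsB hcB
  refine ⟨VA u * (VB u * (VA (-u) * VB (-u))), ?_, fun φ => ?_, fun ψ hψ => ?_⟩
  · have := (((hRB _ hu2).mul (hRA _ hu2)).mul (hRB _ hu1)).mul (hRA _ hu1)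
    convert this using 1
    ring
  · simp only [mul_apply_eq_comp, nA, nB]
  · exact hgate (State (A ⊕ B)) M g u D t za zb (withAncillas B ψ) hfam hM' hg hu.le hug (hzsa a)
      (hz1 a) (hcl a) (hzsa b) (hz1 b) (hcl b) hcab (isVacuum_withAncillas f hψ)

end Gate

/-! ### Logarithms of unitaries and intertwining of evolutions. -/

section Log

variable {E F : Type} [NormedAddCommGroup E] [InnerProductSpace ℂ E] [CompleteSpace E]
  [NormedAddCommGroup F] [InnerProductSpace ℂ F] [CompleteSpace F]

/-- The generator is minus the argument of `U`. On a finite spectrum the argument is continuous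
despite its branch cut, so the continuous functional calculus applies. -/
lemma exists_evol_eq {U : E →L[ℂ] E} (hU : U ∈ unitary (E →L[ℂ] E)) (hfin : (spectrum ℂ U).Finite) :
    ∃ H, IsSelfAdjoint H ∧ evol H 1 = U := by
  have hn : IsStarNormal U := ⟨by
    rw [Commute, SemiconjBy, (Unitary.mem_iff.1 hU).1, (Unitary.mem_iff.1 hU).2]⟩
  have hc : ∀ f : ℂ → ℂ, ContinuousOn f (spectrum ℂ U) := fun f => hfin.continuousOn f
  refine ⟨-cfc (fun z => (z.arg : ℂ)) U, (IsSelfAdjoint.cfc_arg U).neg, ?_⟩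
  have e1 : evol (-cfc (fun z => (z.arg : ℂ)) U) 1 =
      NormedSpace.exp (Complex.I • cfc (fun z => (z.arg : ℂ)) U) := by
    simp [evol]
  rw [e1, ← cfc_smul Complex.I _ U (hc _), ← CFC.exp_eq_normedSpace_exp (𝕜 := ℂ),
    ← cfc_comp' _ _ U ((hfin.image _).continuousOn _) (hc _)]
  conv_rhs => rw [← cfc_id' ℂ U]
  refine cfc_congr fun z hz => ?_
  have hz1 : ‖z‖ = 1 := spectrum.norm_eq_one_of_unitary hU hz
  have := Complex.norm_mul_exp_arg_mul_I z
  rw [hz1, Complex.ofReal_one, one_mul] at this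
  rw [smul_eq_mul, mul_comm Complex.I, ← Complex.exp_eq_exp_ℂ, this]

lemma evol_intertwine {X : E →L[ℂ] E} {X' : F →L[ℂ] F} {V : F →L[ℂ] E}
    (h : ∀ ψ, X (V ψ) = V (X' ψ)) (s : ℝ) (ψ : F) : evol X s (V ψ) = V (evol X' s ψ) := by
  have hd : ∀ v : ℝ, HasDerivAt (fun v => evol X (s - v) (V (evol X' v ψ))) 0 v := by
    intro v
    have h2 : HasDerivAt (fun v => V (evol X' v ψ)) (V (-Complex.I • X' (evol X' v ψ))) v :=
      (V.restrictScalars ℝ).hasFDerivAt.comp_hasDerivAt v (hasDerivAt_evol_apply X' v ψ)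
    refine (hasDerivAt_clm_apply (hasDerivAt_evol_sub X s v) h2).congr_deriv ?_
    simp [h]
  have := is_const_of_deriv_eq_zero (fun v => (hd v).differentiableAt) (fun v => (hd v).deriv) 0 s
  simpa [evol_zero] using this

end Log

/-! ### Single-qubit unitaries from on-site fields. -/

section SingleQubit

lemma exists_pauli_expansion {h : Matrix (Fin 2) (Fin 2) ℂ} (hh : star h = h) :
    ∃ (α : ℝ) (n : Fin 3 → ℝ), h = (α : ℂ) • 1 + ∑ a, (n a : ℂ) • pauli a := by
  have h00 := congrFun (congrFun hh 0) 0
  have h11 := congrFun (congrFun hh 1) 1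
  have h01 := congrFun (congrFun hh 0) 1
  rw [Matrix.star_apply] at h00 h11 h01
  have i0 : (h 0 0).im = 0 := by
    have := congrArg Complex.im h00
    simp at this
    linarith
  have i1 : (h 1 1).im = 0 := by
    have := congrArg Complex.im h11
    simp at this
    linarith
  have r1 := congrArg Complex.re h01
  have r2 := congrArg Complex.im h01
  simp at r1 r2
  refine ⟨((h 0 0).re + (h 1 1).re) / 2,
    ![(h 0 1).re, -(h 0 1).im, ((h 0 0).re - (h 1 1).re) / 2], ?_⟩
  ext i j
  fin_cases i <;> fin_cases j <;> apply Complex.ext <;>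
    simp [Fin.sum_univ_three, pauli, i0, i1] <;> linarith

lemma finite_spectrum_toEuclideanCLM (u : Matrix (Fin 2) (Fin 2) ℂ) :
    (spectrum ℂ (Matrix.toEuclideanCLM (n := Fin 2) (𝕜 := ℂ) u)).Finite := by
  rw [AlgEquiv.spectrum_eq]
  exact u.finite_spectrum

variable {Q : Type} [Fintype Q] [DecidableEq Q]

/-- Single-qubit operators on the qubit `i`, as a ring homomorphism. -/
noncomputable def siteHom (i : Q) :
    (EuclideanSpace ℂ (Fin 2) →L[ℂ] EuclideanSpace ℂ (Fin 2)) →ₐ[ℂ] (State Q →L[ℂ] State Q) :=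
  AlgHom.ofLinearMap
    { toFun := fun X => toOp (site i ((Matrix.toEuclideanCLM (n := Fin 2) (𝕜 := ℂ)).symm X))
      map_add' := fun X Y => by rw [map_add, site_add, map_add]
      map_smul' := fun c X => by rw [map_smul, site_smul, map_smul]; rfl }
    (by simp [site_one]) (fun X Y => by simp [← site_mul])

lemma siteHom_apply (i : Q) (m : Matrix (Fin 2) (Fin 2) ℂ) :
    siteHom i (Matrix.toEuclideanCLM (n := Fin 2) (𝕜 := ℂ) m) = toOp (site i m) := by
  change toOp (site i _) = _
  rw [StarAlgEquiv.symm_apply_apply]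

/-- The logarithm is taken on one qubit and carried to the register by `siteHom`, a continuous
algebra homomorphism and hence compatible with exponentials. -/
lemma exists_evol_site_eq (u : Matrix.unitaryGroup (Fin 2) ℂ) :
    ∃ h : Matrix (Fin 2) (Fin 2) ℂ, star h = h ∧ ∀ {Q : Type} [Fintype Q] [DecidableEq Q] (i : Q),
      evol (toOp (site i h)) 1 = toOp (site i (u : Matrix (Fin 2) (Fin 2) ℂ)) := by
  set Φ := Matrix.toEuclideanCLM (n := Fin 2) (𝕜 := ℂ) with hΦ
  have hU : Φ (u : Matrix (Fin 2) (Fin 2) ℂ) ∈ unitary _ := by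
    rw [Unitary.mem_iff, ← map_star, ← map_mul, ← map_mul, (Unitary.mem_iff.1 u.2).1,
      (Unitary.mem_iff.1 u.2).2, map_one]
    exact ⟨rfl, rfl⟩
  obtain ⟨H, hH, he⟩ := exists_evol_eq hU (finite_spectrum_toEuclideanCLM _)
  refine ⟨Φ.symm H, Φ.injective ?_, fun i => ?_⟩
  · change Φ (star _) = Φ _
    rw [map_star Φ, StarAlgEquiv.apply_symm_apply, hH.star_eq]
  rw [← siteHom_apply, ← siteHom_apply, ← hΦ, StarAlgEquiv.apply_symm_apply, ← he]
  let _ : NormedAlgebra ℚ (EuclideanSpace ℂ (Fin 2) →L[ℂ] EuclideanSpace ℂ (Fin 2)) :=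
    .restrictScalars ℚ ℂ _
  have hc : Continuous (siteHom i) := (siteHom i).toLinearMap.continuous_of_finiteDimensional
  rw [evol, evol, NormedSpace.map_exp _ hc, one_smul, one_smul]
  exact congrArg NormedSpace.exp ((siteHom i).toLinearMap.map_smul _ _).symm

/-- On-site fields alone. -/
lemma reach_field {K : ℕ} {τ : ℝ} (hτ : 0 < τ) (h : Q → Fin 3 → ℝ) :
    Reach K τ (evol (toOp (∑ i, ∑ a, (h i a : ℂ) • sitePauli i a)) 1) := by
  have := reach_of_const (K := K) (Q := Q)
    (H := ((τ⁻¹ : ℝ) : ℂ) • toOp (∑ i, ∑ a, (h i a : ℂ) • sitePauli i a))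
    { T := τ, T_nonneg := hτ.le, J := fun _ _ => 0, h := fun _ i a => τ⁻¹ * h i a
      J_le := by simp
      J_integrable := by simp
      h_integrable := by simp } (fun t => ?_)
  · rwa [evol_smul, mul_inv_cancel₀ hτ.ne'] at this
  · rw [map_smul, StarAlgEquiv.symm_apply_apply, Protocol.ham, Protocol.hamInt, Protocol.hamRot]
    simp only [mul_zero, Complex.ofReal_zero, zero_smul, Finset.sum_const_zero, zero_add,
      Finset.smul_sum, smul_smul, Complex.ofReal_mul]

end SingleQubit

/-! ### Composition of simulations. -/

section Simulation

variable {A B : Type} [Fintype A] [DecidableEq A] [Fintype B] [DecidableEq B] {K : ℕ}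

/-- The contraction `V` on the data qubits can be simulated within time `τ` with error `ε`. -/
def Sim (B : Type) [Fintype B] [DecidableEq B] (K : ℕ) (τ : ℝ) (V : State A →L[ℂ] State A) (ε : ℝ) :
    Prop :=
  ‖V‖ ≤ 1 ∧ ∃ W : State (A ⊕ B) →L[ℂ] State (A ⊕ B), (∃ τ' ≤ τ, Reach K τ' W) ∧ (∀ φ, ‖W φ‖ = ‖φ‖) ∧
    ∀ ψ : State A, ‖ψ‖ ≤ 1 → ‖W (withAncillas B ψ) - withAncillas B (V ψ)‖ ≤ ε

lemma Sim.mono {τ τ' ε ε' : ℝ} {V : State A →L[ℂ] State A} (h : Sim B K τ V ε) (hτ : τ ≤ τ')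
    (hε : ε ≤ ε') : Sim B K τ' V ε' := by
  obtain ⟨hV, W, ⟨t, ht, hr⟩, hW, he⟩ := h
  exact ⟨hV, W, ⟨t, ht.trans hτ, hr⟩, hW, fun ψ hψ => (he ψ hψ).trans hε⟩

lemma Sim.one : Sim B K 0 (1 : State A →L[ℂ] State A) 0 :=
  ⟨ContinuousLinearMap.norm_id_le, 1, ⟨0, le_rfl, reach_one⟩, fun _ => rfl, fun ψ _ => by simp⟩

/-- Errors add because `W'` is an isometry, and the second estimate applies to `V ψ` because `V` is
a contraction. -/
lemma Sim.mul {τ τ' ε ε' : ℝ} {V V' : State A →L[ℂ] State A} (h : Sim B K τ V ε)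
    (h' : Sim B K τ' V' ε') : Sim B K (τ + τ') (V' * V) (ε + ε') := by
  obtain ⟨hV, W, ⟨t, ht, h1⟩, h2, h3⟩ := h
  obtain ⟨hV', W', ⟨t', ht', h1'⟩, h2', h3'⟩ := h'
  refine ⟨(norm_mul_le _ _).trans (mul_le_one₀ hV' (norm_nonneg _) hV), W' * W,
    ⟨t + t', add_le_add ht ht', h1.mul h1'⟩, fun φ => by rw [mul_apply_eq_comp, h2', h2],
    fun ψ hψ => ?_⟩
  have hVψ : ‖V ψ‖ ≤ 1 := (V.le_opNorm ψ).trans (mul_le_one₀ hV (norm_nonneg _) hψ)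
  have e1 : (W' * W) (withAncillas B ψ) - withAncillas B ((V' * V) ψ) =
      W' (W (withAncillas B ψ) - withAncillas B (V ψ)) +
        (W' (withAncillas B (V ψ)) - withAncillas B (V' (V ψ))) := by
    rw [map_sub, mul_apply_eq_comp, mul_apply_eq_comp]
    abel
  rw [e1]
  refine (norm_add_le _ _).trans (add_le_add ?_ (h3' _ hVψ))
  rw [h2']
  exact h3 ψ hψ

/-- The phase must be right as well, but fields contain no multiple of the identity. The identity
component `α` of the generator is realized as `α Z` on an ancilla `b`, where `Z` has the eigenvalue
`1`; the simulation is exact. -/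
lemma Sim.site {τ : ℝ} (hτ : 0 < τ) (i : A) (b : B) (u : Matrix.unitaryGroup (Fin 2) ℂ) :
    Sim B K τ (toOp (site i (u : Matrix (Fin 2) (Fin 2) ℂ))) 0 := by
  obtain ⟨h, hh, hu⟩ := exists_evol_site_eq u
  obtain ⟨α, n, hn⟩ := exists_pauli_expansion hh
  set f : A ⊕ B → Fin 3 → ℝ := fun q a =>
    if q = Sum.inl i then n a else if q = Sum.inr b then (if a = 2 then α else 0) else 0 with hf
  set H := toOp (∑ q, ∑ a, (f q a : ℂ) • sitePauli q a) with hH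
  have hHsa : IsSelfAdjoint H := by
    rw [IsSelfAdjoint, hH, ← map_star, star_sum]
    simp only [star_sum, star_smul, RCLike.star_def, Complex.conj_ofReal]
    congr 1
    refine Finset.sum_congr rfl fun q _ => Finset.sum_congr rfl fun a _ => ?_
    change _ • star (AllToAll.site q (pauli a)) = _ • AllToAll.site q (pauli a)
    rw [star_site, star_pauli]
  refine ⟨norm_toOp_site_le (Unitary.mem_iff.1 u.2).1 i, evol H 1,
    ⟨τ, le_rfl, reach_field hτ f⟩, norm_evol_apply hHsa 1, fun ψ _ => ?_⟩
  have hHeq : H = ∑ a, (n a : ℂ) • toOp (AllToAll.site (Sum.inl i) (pauli a)) +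
      (α : ℂ) • toOp (AllToAll.site (Sum.inr b) (pauli 2)) := by
    rw [hH, ← Finset.add_sum_erase _ _ (Finset.mem_univ (Sum.inl i)),
      ← Finset.add_sum_erase _ _ (Finset.mem_erase.2 ⟨Sum.inr_ne_inl, Finset.mem_univ (Sum.inr b)⟩),
      Finset.sum_eq_zero (s := (Finset.univ.erase (Sum.inl i)).erase (Sum.inr b)), add_zero, map_add]
    · congr 1
      · rw [map_sum]
        refine Finset.sum_congr rfl fun a _ => ?_
        rw [map_smul, hf]
        simp only [if_true]
        rfl
      · rw [Fin.sum_univ_three]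
        simp only [hf, reduceCtorEq, if_true, if_false, Fin.reduceEq, Complex.ofReal_zero,
          zero_smul, zero_add]
        rw [map_smul]
        rfl
    · intro q hq
      have h1 := Finset.ne_of_mem_erase hq
      have h2 := Finset.ne_of_mem_erase (Finset.mem_of_mem_erase hq)
      simp [hf, h1, h2]
  have key : ∀ ψ : State A, H (ancillaMap A B ψ) = ancillaMap A B (toOp (AllToAll.site i h) ψ) := by
    intro ψ
    have e1 : toOp (AllToAll.site (Sum.inr b) (pauli 2)) (withAncillas B ψ) = withAncillas B ψ := by
      have := site_inr_withAncillas b (m := pauli 2) 1 (by simp [pauli]) (by simp [pauli]) ψ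
      rwa [one_smul] at this
    rw [hHeq, hn, site_add, site_smul, site_one]
    have e2 : AllToAll.site i (∑ a, (n a : ℂ) • pauli a) = ∑ a, (n a : ℂ) • AllToAll.site i (pauli a) := by
      simp only [Fin.sum_univ_three, site_add, site_smul]
    rw [e2]
    simp only [map_add, map_sum, map_smul, map_one, _root_.add_apply, _root_.sum_apply,
      _root_.smul_apply, one_apply_eq_self, ancillaMap_apply, e1, site_inl_withAncillas]
    rw [add_comm]
  have := evol_intertwine key 1 ψ
  rw [ancillaMap_apply, ancillaMap_apply, hu i] at this
  rw [this, sub_self, norm_zero]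

end Simulation

/-! ### CZ from the two-qubit phase gate. -/

section ControlledZ

lemma evol_apply_of_eigenvector {E : Type} [NormedAddCommGroup E] [InnerProductSpace ℂ E]
    [CompleteSpace E] {X : E →L[ℂ] E} {ψ : E} {r : ℂ} (h : X ψ = r • ψ) (s : ℝ) :
    evol X s ψ = Complex.exp (-Complex.I * r * s) • ψ := by
  have hd : ∀ v : ℝ, HasDerivAt (fun v : ℝ => Complex.exp (-Complex.I * r * v) • evol X (s - v) ψ)
      0 v := by
    intro v
    have h1 : HasDerivAt (fun v : ℝ => evol X (s - v) ψ) ((Complex.I * r) • evol X (s - v) ψ) v := by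
      have := hasDerivAt_clm_apply (hasDerivAt_evol_sub X s v) (hasDerivAt_const v ψ)
      refine this.congr_deriv ?_
      simp [h, smul_smul]
    have h2 : HasDerivAt (fun v : ℝ => Complex.exp (-Complex.I * r * v))
        (Complex.exp (-Complex.I * r * v) * (-Complex.I * r)) v := by
      have := ((hasDerivAt_id (v : ℂ)).const_mul (-Complex.I * r)).cexp.comp_ofReal
      simpa using this
    refine (h2.smul h1).congr_deriv ?_
    rw [smul_smul, ← add_smul]
    ring_nf
    exact zero_smul ℂ _
  have := is_const_of_deriv_eq_zero (fun v => (hd v).differentiableAt) (fun v => (hd v).deriv) 0 s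
  simpa [evol_zero] using this

variable {Q : Type} [Fintype Q] [DecidableEq Q]

lemma site_diagonal (i : Q) (v : Fin 2 → ℂ) :
    site i (Matrix.diagonal v) = Matrix.diagonal fun x : Q → Fin 2 => v (x i) := by
  ext x y
  rw [site_apply]
  by_cases h : x = y
  · subst h
    simp
  · rw [Matrix.diagonal_apply_ne _ h]
    obtain ⟨j, hj⟩ := Function.ne_iff.1 h
    by_cases hji : j = i
    · subst hji
      rw [Matrix.diagonal_apply_ne _ hj, zero_mul]
    · rw [Finset.prod_eq_zero (Finset.mem_erase.2 ⟨hji, Finset.mem_univ j⟩)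
        (show (1 : Matrix (Fin 2) (Fin 2) ℂ) (x j) (y j) = 0 from Matrix.one_apply_ne hj), mul_zero]

lemma pauli_two_eq : pauli 2 = Matrix.diagonal ![1, -1] := by
  ext i j
  fin_cases i <;> fin_cases j <;> simp [pauli]

lemma evol_toOp_diagonal (d : (Q → Fin 2) → ℂ) (s : ℝ) :
    evol (toOp (Matrix.diagonal d)) s =
      toOp (Matrix.diagonal fun x => Complex.exp (-Complex.I * d x * s)) := by
  have single : ∀ (d : (Q → Fin 2) → ℂ) x, toOp (Matrix.diagonal d) (EuclideanSpace.single x 1) =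
      d x • EuclideanSpace.single x (1 : ℂ) := by
    intro d x
    ext y
    by_cases h : y = x
    · subst h
      simp [toOp_apply, act]
    · simp [toOp_apply, act, h]
  have : (evol (toOp (Matrix.diagonal d)) s : State Q →ₗ[ℂ] State Q) =
      toOp (Matrix.diagonal fun x => Complex.exp (-Complex.I * d x * s)) := by
    refine (EuclideanSpace.basisFun (Q → Fin 2) ℂ).toBasis.ext fun x => ?_
    rw [OrthonormalBasis.coe_toBasis, EuclideanSpace.basisFun_apply]
    change evol _ s _ = toOp _ _
    rw [evol_apply_of_eigenvector (single d x), single]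
  exact ContinuousLinearMap.coe_injective this

/-- The single-qubit phase that turns `exp (-i π/4 Z Z)` into the controlled-Z gate. -/
noncomputable def czPhase : Fin 2 → ℂ :=
  ![Complex.exp (Complex.I * (Real.pi / 8 : ℝ)), Complex.exp (Complex.I * (-(3 * Real.pi / 8) : ℝ))]

lemma norm_czPhase (i : Fin 2) : ‖czPhase i‖ = 1 := by
  fin_cases i <;> exact Complex.norm_exp_I_mul_ofReal _

/-- The single-qubit unitary of `czPhase`. -/
noncomputable def czRot : Matrix.unitaryGroup (Fin 2) ℂ :=
  ⟨Matrix.diagonal czPhase, by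
    have h : ∀ i, czPhase i * star (czPhase i) = 1 := fun i => by
      rw [RCLike.star_def, Complex.mul_conj, Complex.normSq_eq_norm_sq, norm_czPhase]
      simp
    rw [Matrix.mem_unitaryGroup_iff, Matrix.star_eq_conjTranspose, Matrix.diagonal_conjTranspose,
      Matrix.diagonal_mul_diagonal, ← Matrix.diagonal_one]
    congr 1
    ext1 i
    exact h i⟩

/-- All factors are diagonal. The phases on `00`, `01` and `11` are `π/4 - π/4 = 0`, `-π/4 + π/4 =
0` and `-3π/4 - π/4 = -π`; the global phase is included in `czPhase`. -/
lemma cz_eq (a b : Q) :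
    toOp (cz a b) = toOp (site b (czRot : Matrix (Fin 2) (Fin 2) ℂ)) *
      (toOp (site a (czRot : Matrix (Fin 2) (Fin 2) ℂ)) *
        evol (((Real.pi / 4 : ℝ) : ℂ) • (toOp (site a (pauli 2)) * toOp (site b (pauli 2)))) 1) := by
  have e1 : ((Real.pi / 4 : ℝ) : ℂ) • (toOp (site a (pauli 2)) * toOp (site b (pauli 2))) =
      toOp (Matrix.diagonal fun x : Q → Fin 2 => ((Real.pi / 4 : ℝ) : ℂ) *
        ((![1, -1] : Fin 2 → ℂ) (x a) * (![1, -1] : Fin 2 → ℂ) (x b))) := by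
    rw [← map_mul, pauli_two_eq, site_diagonal, site_diagonal, Matrix.diagonal_mul_diagonal, ← map_smul,
      ← Matrix.diagonal_smul]
    rfl
  rw [e1, evol_toOp_diagonal, ← map_mul, ← map_mul, czRot, site_diagonal, site_diagonal,
    Matrix.diagonal_mul_diagonal, Matrix.diagonal_mul_diagonal, cz]
  congr 2
  ext1 x
  have hpi : Complex.exp (Complex.I * Real.pi) = -1 := by rw [mul_comm, Complex.exp_pi_mul_I]
  have hpi' : Complex.exp (-(Complex.I * Real.pi)) = -1 := by rw [Complex.exp_neg, hpi]; norm_num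
  have two : ∀ i : Fin 2, i = 0 ∨ i = 1 := by decide
  rcases two (x a) with ha | ha <;> rcases two (x b) with hb | hb <;>
    simp only [ha, hb, czPhase, Matrix.cons_val_zero, Matrix.cons_val_one, ← Complex.exp_add] <;>
    push_cast <;> ring_nf
  · simp
  · simp
  · simp
  · simp only [mul_comm Complex.I] at hpi' ⊢
    simp [hpi']

/-- The controlled-Z gate from an approximate evolution `exp (-i π/4 Z Z)`. -/
lemma Sim.controlledZ {A B : Type} [Fintype A] [DecidableEq A] [Fintype B] [DecidableEq B] {K : ℕ}
    {τ τ' ε : ℝ} (hτ' : 0 < τ') (a b : A) (b₀ : B) {W : State (A ⊕ B) →L[ℂ] State (A ⊕ B)}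
    (hW : Reach K τ W) (hn : ∀ φ, ‖W φ‖ = ‖φ‖)
    (h : ∀ ψ : State A, ‖ψ‖ ≤ 1 → ‖W (withAncillas B ψ) - evol (((Real.pi / 4 : ℝ) : ℂ) •
      (toOp (AllToAll.site (Sum.inl a) (pauli 2)) * toOp (AllToAll.site (Sum.inl b) (pauli 2)))) 1
        (withAncillas B ψ)‖ ≤ ε) :
    Sim B K (τ + (τ' + τ')) (toOp (cz a b)) ε := by
  have hz : IsSelfAdjoint (((Real.pi / 4 : ℝ) : ℂ) •
      (toOp (AllToAll.site a (pauli 2)) * toOp (AllToAll.site b (pauli 2)))) := by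
    have hs : ∀ i : A, star (toOp (AllToAll.site i (pauli 2))) = toOp (AllToAll.site i (pauli 2)) := by
      intro i
      rw [← map_star, star_site, star_pauli]
    have hc : toOp (AllToAll.site b (pauli 2)) * toOp (AllToAll.site a (pauli 2)) =
        toOp (AllToAll.site a (pauli 2)) * toOp (AllToAll.site b (pauli 2)) := by
      rw [← map_mul, ← map_mul, pauli_two_eq, site_diagonal, site_diagonal,
        Matrix.diagonal_mul_diagonal, Matrix.diagonal_mul_diagonal]
      simp only [mul_comm]
    rw [IsSelfAdjoint, star_smul, star_mul, hs, hs, hc, RCLike.star_def, Complex.conj_ofReal]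
  have hZ : Sim B K τ (evol (((Real.pi / 4 : ℝ) : ℂ) •
      (toOp (AllToAll.site a (pauli 2)) * toOp (AllToAll.site b (pauli 2)))) 1) ε := by
    refine ⟨?_, W, ⟨τ, le_rfl, hW⟩, hn, fun ψ hψ => ?_⟩
    · refine norm_le_one_of_star_mul_self ?_
      rw [star_evol hz, evol_neg_mul]
    · have key : ∀ ψ : State A, (((Real.pi / 4 : ℝ) : ℂ) • (toOp (AllToAll.site (Sum.inl a) (pauli 2)) *
          toOp (AllToAll.site (Sum.inl b) (pauli 2))) : State (A ⊕ B) →L[ℂ] State (A ⊕ B))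
            (ancillaMap A B ψ) = ancillaMap A B
          ((((Real.pi / 4 : ℝ) : ℂ) •
            (toOp (AllToAll.site a (pauli 2)) * toOp (AllToAll.site b (pauli 2))) :
              State A →L[ℂ] State A) ψ) := by
        intro ψ
        rw [_root_.smul_apply, _root_.smul_apply, map_smul, mul_apply_eq_comp, mul_apply_eq_comp,
          ancillaMap_apply, ancillaMap_apply, site_inl_withAncillas, site_inl_withAncillas]
      have := evol_intertwine key 1 ψ
      rw [ancillaMap_apply, ancillaMap_apply] at this
      rw [← this]
      exact h ψ hψ
  rw [cz_eq]
  have := (hZ.mul (Sim.site hτ' a b₀ czRot)).mul (Sim.site hτ' b b₀ czRot)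
  rw [add_zero, add_zero, add_assoc] at this
  exact this

end ControlledZ

/-! ### From gates to circuits. -/

section Circuits

variable {A B : Type} [Fintype A] [DecidableEq A] [Fintype B] [DecidableEq B] {K : ℕ}

lemma Sim.list_prod {τ ε : ℝ} (l : List (A × A))
    (h : ∀ g ∈ l, Sim B K τ (toOp (cz g.1 g.2)) ε) :
    Sim B K (l.length * τ) (toOp (l.map fun g => cz g.1 g.2).prod) (l.length * ε) := by
  induction l with
  | nil => simpa using Sim.one
  | cons g l ih =>
    have := (ih fun g hg => h g (List.mem_cons_of_mem _ hg)).mul (h g List.mem_cons_self)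
    rw [List.map_cons, List.prod_cons, map_mul]
    refine this.mono (le_of_eq ?_) (le_of_eq ?_) <;>
    · rw [List.length_cons]
      push_cast
      ring

lemma Sim.tensorOp {τ : ℝ} (hτ : 0 < τ) (b : B) (u : A → Matrix.unitaryGroup (Fin 2) ℂ) :
    Sim B K (Fintype.card A * τ)
      (toOp (tensorOp fun i => (u i : Matrix (Fin 2) (Fin 2) ℂ))) 0 := by
  have key : ∀ s : Finset A, Sim B K (s.card * τ)
      (toOp (AllToAll.tensorOp fun i => if i ∈ s then (u i : Matrix (Fin 2) (Fin 2) ℂ) else 1)) 0 := by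
    intro s
    induction s using Finset.induction_on with
    | empty => simpa [tensorOp_one] using Sim.one
    | insert i s hi ih =>
      have := ih.mul (Sim.site (K := K) hτ i b (u i))
      rw [← map_mul, AllToAll.site, tensorOp_mul, add_zero] at this
      rw [Finset.card_insert_of_notMem hi]
      convert this using 1
      · push_cast
        ring
      · congr 2
        ext1 j
        by_cases hj : j = i
        · subst hj
          simp [hi]
        · simp [hj]
  simpa using key Finset.univ

lemma Layer.length_gates_le {Q : Type} [Fintype Q] (L : Layer Q) :
    L.gates.length ≤ Fintype.card Q := by
  have : (L.gates.map Prod.fst).Nodup := by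
    rw [List.Nodup, List.pairwise_map]
    exact L.gates_disjoint.imp fun h => h.1
  simpa using this.length_le_card

/-- All gates are executed one by one. There are at most `Fintype.card A` of them, and CZ gates and
single-qubit unitaries take half of the time each. -/
lemma Sim.layer {τ ε : ℝ} (hτ : 0 < τ) (hε : 0 ≤ ε) (b : B)
    (h : ∀ i j : A, i ≠ j → Sim B K (τ / 2) (toOp (cz i j)) ε) (L : Layer A) :
    Sim B K (Fintype.card A * τ) (toOp L.unitary) (Fintype.card A * ε) := by
  have h1 := Sim.list_prod L.gates fun g hg => h g.1 g.2 (L.gates_ne g hg)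
  have h2 := h1.mul (Sim.tensorOp (K := K) (half_pos hτ) b L.rot)
  rw [← map_mul] at h2
  have hl : (L.gates.length : ℝ) ≤ Fintype.card A := by exact_mod_cast L.length_gates_le
  refine h2.mono ?_ ?_
  · nlinarith
  · rw [add_zero]
    exact mul_le_mul_of_nonneg_right hl hε

lemma Sim.circuit {τ ε : ℝ} (h : ∀ L : Layer A, Sim B K τ (toOp L.unitary) ε) {D : ℕ}
    {U : Operator A} (hU : IsCircuit D U) : Sim B K (D * τ) (toOp U) (D * ε) := by
  induction hU with
  | zero => simpa using Sim.one
  | succ L _ ih =>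
    have := ih.mul (h L)
    rw [← map_mul] at this
    refine this.mono (le_of_eq ?_) (le_of_eq ?_) <;>
    · push_cast
      ring

lemma Sim.exists_simulates {τ ε : ℝ} {U : Operator A} (h : Sim B K τ (toOp U) ε) :
    ∃ p : Protocol (A ⊕ B) K, p.T ≤ τ ∧ Simulates p U ε := by
  obtain ⟨-, W, ⟨t, ht, p, rfl, hp⟩, -, he⟩ := h
  refine ⟨p, ht, toOp.symm W, hp, fun ψ hψ => ?_⟩
  have := he ψ hψ.le
  rw [← toOp.apply_symm_apply W] at this
  exact this

end Circuits

/-! ### Choice of the parameters. -/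

section Parameters

open Filter

lemma eventually_le_rpow {r : ℝ} (hr : 0 < r) (c : ℝ) :
    ∀ᶠ N : ℕ in atTop, c ≤ (N : ℝ) ^ r :=
  ((tendsto_rpow_atTop hr).comp tendsto_natCast_atTop_atTop).eventually_ge_atTop c

/-- Disjoint blocks of `M` qubits. -/
lemma exists_blocks {n M N : ℕ} (h : M * n ≤ N) (hN : 0 < N) : ∃ f : ℕ → Fin M → Fin N,
    (∀ i < n, Function.Injective (f i)) ∧
    ∀ i < n, ∀ j < n, i ≠ j → ∀ k l, f i k ≠ f j l := by
  have hlt : ∀ i < n, ∀ k : Fin M, i * M + k < N := by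
    intro i hi k
    have h1 := Nat.mul_le_mul_right M hi
    have h2 := k.2
    rw [Nat.succ_mul] at h1
    rw [mul_comm] at h
    omega
  set f : ℕ → Fin M → Fin N := fun i k => if h : i < n then ⟨i * M + k, hlt i h k⟩ else ⟨0, hN⟩
    with hf
  have hfv : ∀ i < n, ∀ k, (f i k : ℕ) = i * M + k := fun i hi k => by
    simp only [hf, dif_pos hi]
  have hlt' : ∀ i < n, ∀ j < n, i < j → ∀ k l, f i k ≠ f j l := by
    intro i hi j hj hij k l h
    have h1 := congrArg Fin.val h
    rw [hfv i hi, hfv j hj] at h1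
    have h2 := Nat.mul_le_mul_right M hij
    have h3 := k.2
    rw [Nat.succ_mul] at h2
    omega
  refine ⟨f, fun i hi k l h => ?_, fun i hi j hj hij k l => ?_⟩
  · have := congrArg Fin.val h
    rw [hfv i hi, hfv i hi] at this
    exact Fin.ext (by omega)
  · rcases lt_or_gt_of_ne hij with h | h
    · exact hlt' i hi j hj h k l
    · exact (hlt' j hj i hi h l k).symm

/-- Here `s` stands for `√M`, and `g ^ J / s ≤ 1 / u` bounds both error terms by `u ^ (-m) = N ^ (-r
m)`. The surplus `1` in `κ + 1 ≤ r * m` pays for the constant `2 * C`. -/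
lemma gate_error_le {N κ r C u w s g : ℝ} {J m : ℕ} (hN : 1 ≤ N) (hC : 0 ≤ C) (h3 : 2 * C ≤ N)
    (hm : κ + 1 ≤ r * m) (hu : u = N ^ r) (hu0 : 0 < u) (huw : u ≤ w) (hws : w ≤ s)
    (hgJ : g ^ J = w / u) :
    C * (u * g ^ (J * (m + 1)) * s⁻¹ ^ (m + 1) + s⁻¹ ^ m) ≤ N ^ (-κ) := by
  have hNpos : 0 < N := by linarith
  have hw : 0 < w := by linarith
  have hs : 0 < s := by linarith
  have e1 : u * g ^ (J * (m + 1)) * s⁻¹ ^ (m + 1) ≤ u⁻¹ ^ m := by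
    have e2 : g ^ (J * (m + 1)) * s⁻¹ ^ (m + 1) ≤ u⁻¹ ^ (m + 1) := by
      rw [pow_mul, hgJ, ← mul_pow]
      refine pow_le_pow_left₀ (by positivity) ?_ _
      rw [← div_eq_mul_inv, div_le_iff₀ hs, div_eq_inv_mul]
      exact mul_le_mul_of_nonneg_left hws (by positivity)
    calc u * g ^ (J * (m + 1)) * s⁻¹ ^ (m + 1)
        = u * (g ^ (J * (m + 1)) * s⁻¹ ^ (m + 1)) := by ring
      _ ≤ u * u⁻¹ ^ (m + 1) := by gcongr
      _ = u⁻¹ ^ m := by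
        rw [pow_succ]
        field_simp
  have e2 : s⁻¹ ^ m ≤ u⁻¹ ^ m := by
    have := huw.trans hws
    gcongr
  have e3 : u⁻¹ ^ m ≤ N ^ (-κ) * N⁻¹ := by
    rw [inv_pow, hu, ← Real.rpow_natCast, ← Real.rpow_mul hNpos.le, ← Real.rpow_neg hNpos.le,
      ← Real.rpow_neg_one N, ← Real.rpow_add hNpos]
    exact Real.rpow_le_rpow_of_exponent_le hN (by linarith)
  have hκ0 : 0 < N ^ (-κ) := Real.rpow_pos_of_pos hNpos _
  calc C * (u * g ^ (J * (m + 1)) * s⁻¹ ^ (m + 1) + s⁻¹ ^ m)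
      ≤ C * (N ^ (-κ) * N⁻¹ + N ^ (-κ) * N⁻¹) :=
        mul_le_mul_of_nonneg_left (add_le_add (e1.trans e3) (e2.trans e3)) hC
    _ = N ^ (-κ) * (2 * C / N) := by ring
    _ ≤ N ^ (-κ) * 1 := by
        refine mul_le_mul_of_nonneg_left ?_ hκ0.le
        rwa [div_le_one hNpos]
    _ = N ^ (-κ) := mul_one _

/-- The pulses take a time of order `u / N = N ^ (-1 + δ / 2)`, and the other factor `N ^ (δ / 2)`
absorbs the constants. Pulses and the two single-qubit rotations get `N ^ (-1 + δ) / 4` each in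
total. -/
lemma gate_time_le {N M δ c ρ u : ℝ} {J m : ℕ} (hN : 0 < N) (hM : 0 < M) (hc : 0 < c) (hρ : 1 ≤ ρ)
    (hNM : N ≤ ρ * M) (hu : u = N ^ (δ / 2))
    (h1 : 4 * (4 * ((2 ^ (J + 1) - 1) * (4 ^ (m + 1) * ρ ^ (m + 1) * c * ρ))) ≤ N ^ (δ / 2)) :
    4 * ((2 ^ (J + 1) - 1) * (4 ^ (m + 1) * ρ ^ (m + 1) * c * u / M)) +
      (N ^ (-1 + δ) / 8 + N ^ (-1 + δ) / 8) ≤ N ^ (-1 + δ) / 2 := by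
  have hu0 : 0 < u := hu ▸ Real.rpow_pos_of_pos hN _
  have e1 : N ^ (-1 + δ) = N ^ (δ / 2) * (u / N) := by
    rw [hu, div_eq_mul_inv _ N, ← Real.rpow_neg_one N, ← Real.rpow_add hN, ← Real.rpow_add hN]
    congr 1
    ring
  have e3 : u / M ≤ ρ * (u / N) := by
    rw [← mul_div_assoc, div_le_div_iff₀ hM hN]
    nlinarith
  have e4 : (0 : ℝ) ≤ 2 ^ (J + 1) - 1 := by
    have : (1 : ℝ) ≤ 2 ^ (J + 1) := one_le_pow₀ (by norm_num)
    linarith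
  have e2 : 4 * ((2 ^ (J + 1) - 1) * (4 ^ (m + 1) * ρ ^ (m + 1) * c * u / M)) ≤
      4 * ((2 ^ (J + 1) - 1) * (4 ^ (m + 1) * ρ ^ (m + 1) * c * ρ)) * (u / N) := by
    calc 4 * ((2 ^ (J + 1) - 1) * (4 ^ (m + 1) * ρ ^ (m + 1) * c * u / M))
        = 4 * ((2 ^ (J + 1) - 1) * (4 ^ (m + 1) * ρ ^ (m + 1) * c)) * (u / M) := by ring
      _ ≤ 4 * ((2 ^ (J + 1) - 1) * (4 ^ (m + 1) * ρ ^ (m + 1) * c)) * (ρ * (u / N)) :=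
          mul_le_mul_of_nonneg_left e3 (by positivity)
      _ = _ := by ring
  have e5 := mul_le_mul_of_nonneg_right h1 (div_pos hu0 hN).le
  rw [← e1] at e5
  linarith

/-- Controlled-Z gates in time `N ^ (-1 + δ) / 2`, with an error `N ^ (-κ)`. -/
theorem exists_sim_cz (δ κ : ℝ) (hδ : 0 < δ) (hδ' : δ < 1) (hκ : 0 < κ) :
    ∃ K : ℕ, 2 ≤ K ∧ ∃ N₀ : ℕ, ∀ N : ℕ, N₀ ≤ N → 0 < N ∧ ∀ Nd : ℕ, Nd ≤ N → ∀ a b : Fin Nd, a ≠ b →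
      Sim (Fin N) K ((N : ℝ) ^ (-1 + δ) / 2) (toOp (cz a b)) ((N : ℝ) ^ (-κ)) := by
  set r := δ / 2 with hr
  -- The choice of `J` gives `u ^ J ≥ √N`, so that `J` amplifications by `g ≤ u` suffice; that of
  -- `m` makes `u ^ (-m)` at most `N ^ (-κ - 1)`.
  have hr0 : 0 < r := by positivity
  obtain ⟨J, hJ⟩ : ∃ J : ℕ, 1 / (2 * r) ≤ J := exists_nat_ge _
  obtain ⟨m, hm⟩ : ∃ m : ℕ, (κ + 1) / r ≤ m := exists_nat_ge _
  have hJ' : 1 / 2 ≤ r * J := by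
    rw [div_le_iff₀ (by positivity)] at hJ
    linarith
  have hm' : κ + 1 ≤ r * m := by
    rw [div_le_iff₀ hr0] at hm
    linarith
  have hJ1 : J ≠ 0 := by
    rintro rfl
    norm_num at hJ'
  have hm1 : 1 ≤ m := by
    rcases Nat.eq_zero_or_pos m with rfl | h
    · norm_num at hm'
      linarith
    · exact h
  obtain ⟨C, c, hC, hc, hzz⟩ := exists_reach_zz m J hm1
  -- Rounding down in `M` costs at most a factor `2`, so `N ≤ ρ / 2 * M`; with `Nd ≤ N` the number
  -- of all qubits is at most `ρ * M`.
  set ρ : ℝ := 4 * (2 * J + 1) with hρ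
  have hρ1 : 1 ≤ ρ := by
    have : (0 : ℝ) ≤ J := J.cast_nonneg
    linarith
  -- In this order: constants in the gate time, the inequality `u ≤ w` (where `1 - 2 * r = 1 - δ` is
  -- positive), constants in the gate error, and nonempty blocks.
  have hev := (((eventually_le_rpow hr0
    (4 * (4 * ((2 ^ (J + 1) - 1) * (4 ^ (m + 1) * ρ ^ (m + 1) * c * ρ))))).and
    (eventually_le_rpow (show 0 < 1 - 2 * r by linarith) (ρ * 8 / Real.pi))).and
    (eventually_le_rpow one_pos (2 * C))).and (eventually_ge_atTop (2 * J + 1))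
  obtain ⟨N₀, hN₀⟩ := eventually_atTop.1 hev
  refine ⟨m + 1, by omega, N₀, fun N hN => ?_⟩
  obtain ⟨⟨⟨h1, h2⟩, h3⟩, h4⟩ := hN₀ N hN
  rw [Real.rpow_one] at h3
  have hN0 : 0 < N := by omega
  refine ⟨hN0, fun Nd hNd a b hab => ?_⟩
  have hNpos : (0 : ℝ) < N := by exact_mod_cast hN0
  have hN1 : (1 : ℝ) ≤ N := by exact_mod_cast hN0
  set M := N / (2 * J + 1) with hM
  have hM0 : 0 < M := Nat.div_pos h4 (by omega)
  have hM0' : (0 : ℝ) < M := by exact_mod_cast hM0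
  have hMN : M * (2 * J + 1) ≤ N := Nat.div_mul_le_self N _
  have hNM : (N : ℝ) ≤ ρ / 2 * M := by
    have h5 : N < (M + 1) * (2 * J + 1) := by
      rw [mul_comm]
      exact Nat.lt_mul_div_succ N (by omega)
    have h6 : N ≤ 2 * (2 * J + 1) * M := by nlinarith
    have : (N : ℝ) ≤ 2 * (2 * J + 1) * M := by exact_mod_cast h6
    rw [hρ]
    linarith
  have hMle : (M : ℝ) ≤ N := by exact_mod_cast Nat.div_le_self N _
  obtain ⟨f, hinj, hdisj⟩ := exists_blocks hMN hN0
  set u : ℝ := (N : ℝ) ^ r with hu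
  have hu1 : 1 ≤ u := Real.one_le_rpow hN1 hr0.le
  have hu0 : 0 < u := by linarith
  -- The required value of `u * g ^ J`: it makes the phase `2 * w ^ 2 / M` equal to `π / 4`.
  set w : ℝ := √(Real.pi * M / 8) with hw
  have hpi := Real.pi_pos
  have hw0 : 0 < w := Real.sqrt_pos.2 (by positivity)
  have hw2 : w ^ 2 = Real.pi * M / 8 := Real.sq_sqrt (by positivity)
  have hwM : w ≤ √M := Real.sqrt_le_sqrt (by nlinarith [Real.pi_le_four])
  have huw : u ≤ w := by
    refine Real.le_sqrt_of_sq_le ?_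
    have e1 : u ^ 2 * (N : ℝ) ^ (1 - 2 * r) = N := by
      rw [hu, ← Real.rpow_natCast, ← Real.rpow_mul hNpos.le, ← Real.rpow_add hNpos]
      have : r * ((2 : ℕ) : ℝ) + (1 - 2 * r) = 1 := by push_cast; ring
      rw [this, Real.rpow_one]
    have e2 : u ^ 2 * (ρ * 8 / Real.pi) ≤ ρ * M := by
      have := mul_le_mul_of_nonneg_left h2 (sq_nonneg u)
      rw [e1] at this
      nlinarith
    have e3 : u ^ 2 * (ρ * 8 / Real.pi) = ρ * (u ^ 2 * 8 / Real.pi) := by ring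
    rw [e3] at e2
    have := le_of_mul_le_mul_left e2 (by linarith)
    rw [div_le_iff₀ hpi] at this
    linarith
  set g : ℝ := (w / u) ^ ((J : ℝ)⁻¹) with hg
  have hwu : 1 ≤ w / u := by rwa [one_le_div hu0]
  have hg1 : 1 ≤ g := Real.one_le_rpow hwu (by positivity)
  have hgJ : g ^ J = w / u := Real.rpow_inv_natCast_pow (by linarith) hJ1
  have hug : u * g ^ J = w := by
    rw [hgJ]
    field_simp
  have hgu : g ≤ u := by
    refine le_of_pow_le_pow_left₀ hJ1 hu0.le ?_
    rw [hgJ, div_le_iff₀ hu0]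
    have e1 : √(N : ℝ) ≤ u ^ J := by
      rw [hu, ← Real.rpow_natCast, ← Real.rpow_mul hNpos.le, Real.sqrt_eq_rpow]
      exact Real.rpow_le_rpow_of_exponent_le hN1 hJ'
    have e2 : √(M : ℝ) ≤ √N := Real.sqrt_le_sqrt hMle
    have : u ^ J ≤ u ^ J * u := le_mul_of_one_le_right (by positivity) hu1
    linarith
  have hcard : (Fintype.card (Fin Nd ⊕ Fin N) : ℝ) ≤ ρ * M := by
    have : (Nd : ℝ) ≤ N := by exact_mod_cast hNd
    rw [Fintype.card_sum, Fintype.card_fin, Fintype.card_fin]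
    push_cast
    linarith
  obtain ⟨W, hW1, hW2, hW3⟩ := hzz (Fin Nd) (Fin N) M (m + 1) g u ρ f a b hab hM0 hinj hdisj hg1 hgu
    (hug.le.trans hwM) le_rfl hρ1 hcard
  have hangle : 2 * (u * g ^ J) ^ 2 / M = Real.pi / 4 := by
    rw [hug, hw2]
    field_simp
    ring
  rw [hangle] at hW3
  have hT0 : 0 < (N : ℝ) ^ (-1 + δ) / 8 := div_pos (Real.rpow_pos_of_pos hNpos _) (by norm_num)
  exact (Sim.controlledZ hT0 a b ⟨0, hN0⟩ hW1 hW2 hW3).mono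
    (gate_time_le hNpos hM0' hc hρ1 (by linarith [mul_pos (lt_of_lt_of_le one_pos hρ1) hM0']) hu h1)
    (gate_error_le hN1 hC h3 hm' hu hu0 huw hwM hgJ)

end Parameters
end AllToAll

theorem corollary3 (δ κ : ℝ) (hδ : 0 < δ) (hδ' : δ < 1) (hκ : 0 < κ) :
    ∃ K : ℕ, 2 ≤ K ∧ ∃ N₀ : ℕ, ∀ N : ℕ, N₀ ≤ N → ∀ Nd : ℕ, Nd ≤ N →
      ∀ (D : ℕ) (U : AllToAll.Operator (Fin Nd)), AllToAll.IsCircuit D U →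
        ∃ p : AllToAll.Protocol (Fin Nd ⊕ Fin N) K,
          p.T ≤ (D : ℝ) * (Nd : ℝ) * (N : ℝ) ^ (-1 + δ) ∧
          AllToAll.Simulates p U ((D : ℝ) * (N : ℝ) ^ (-κ)) := by
  -- The exponent `κ + 1` leaves a factor `1 / N` for the up to `Nd ≤ N` gates of a layer.
  obtain ⟨K, hK, N₀, h⟩ := AllToAll.exists_sim_cz δ (κ + 1) hδ hδ' (by linarith)
  refine ⟨K, hK, N₀, fun N hN Nd hNd D U hU => ?_⟩
  obtain ⟨hN0, hcz⟩ := h N hN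
  have hNpos : (0 : ℝ) < N := by exact_mod_cast hN0
  have hlayer := AllToAll.Sim.layer (Real.rpow_pos_of_pos hNpos (-1 + δ))
    (Real.rpow_nonneg hNpos.le (-(κ + 1))) ⟨0, hN0⟩ (hcz Nd hNd)
  obtain ⟨p, hp, hs⟩ := (AllToAll.Sim.circuit hlayer hU).exists_simulates
  rw [Fintype.card_fin] at hp hs
  refine ⟨p, by rwa [← mul_assoc] at hp, ?_⟩
  obtain ⟨W, hW, he⟩ := hs
  refine ⟨W, hW, fun ψ hψ => (he ψ hψ).trans ?_⟩
  refine mul_le_mul_of_nonneg_left ?_ D.cast_nonneg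
  have e1 : (N : ℝ) ^ (-κ) = N * (N : ℝ) ^ (-(κ + 1)) := by
    rw [neg_add, Real.rpow_add hNpos, Real.rpow_neg_one]
    field_simp
  rw [e1]
  exact mul_le_mul_of_nonneg_right (by exact_mod_cast hNd) (Real.rpow_nonneg hNpos.le _)
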